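/- Let $\Omega\subset\mathbb R^2$ be a bounded simply connected open set with $C^\infty$ boundary $\Sigma=\partial\Omega$, a closed curve with a smooth positively oriented arc-length parametrization; put $\Omega_+=\Omega$, $\Omega_-=\mathbb R^2\setminus\overline{\Omega}$, let $\mathbf n=(n_1,n_2)$ be the unit normal on $\Sigma$ pointing out of $\Omega$, and let $\mathbf t=(-n_2,n_1)$. Let $\sigma_1,\sigma_2,\sigma_3$ be the Pauli matrices, $\sigma\cdot A=A_1\sigma_1+A_2\sigma_2$, $\sigma\cdot\nabla=\sigma_1\partial_1+\sigma_2\partial_2$, and $m\in\mathbb R$. Let $H(\sigma,\Omega_\pm)$ be the space of $f\in L^2(\Omega_\pm;\mathbb C^2)$ with $\sigma\cdot\nabla f\in L^2(\Omega_\pm;\mathbb C^2)$ (distributional derivatives), with norm $(\|f\|^2+\|\sigma\cdot\nabla f\|^2)^{1/2}$, and let $\mathcal T_\pm f_\pm\in H^{-1/2}(\Sigma;\mathbb C^2)$ be the Dirichlet trace on $\Sigma$ of $f_\pm\in H(\sigma,\Omega_\pm)$, i.e. the continuous extension to $H(\sigma,\Omega_\pm)$ of restriction to $\Sigma$. For constants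 $\eta,\tau,\lambda\in\mathbb R$ let $\mathscr D_{\eta,\tau,\lambda}$ be the operator in $L^2(\mathbb R^2;\mathbb C^2)=L^2(\Omega_+;\mathbb C^2)\oplus L^2(\Omega_-;\mathbb C^2)$ whose domain consists of all $f=f_+\oplus f_-\in H(\sigma,\Omega_+)\oplus H(\sigma,\Omega_-)$ with $$ i(\sigma\cdot\mathbf n)(\mathcal T_-f_--\mathcal T_+f_+)=\tfrac12\big(\eta\,\mathbb I_2+\tau\sigma_3+\lambda(\sigma\cdot\mathbf t)\big)(\mathcal T_-f_-+\mathcal T_+f_+)\quad\text{in }H^{-1/2}(\Sigma;\mathbb C^2), $$ and which acts as $\mathscr D_{\eta,\tau,\lambda}f=(-i\sigma\cdot\nabla+m\sigma_3)f_+\oplus(-i\sigma\cdot\nabla+m\sigma_3)f_-$. Let $\sigma_p$ denote the point spectrum (the set of eigenvalues), $d=\eta^2-\tau^2-\lambda^2$, and let $C f=\sigma_1\overline f$ on $L^2(\mathbb R^2;\mathbb C^2)$. Then, for all $\eta,\tau,\lambda\in\mathbb R$: (i) if $d\neq0$, then for every $z\in\mathbb C$: $z\in\sigma_p(\mathscr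 D_{\eta,\tau,\lambda})$ if and only if $z\in\sigma_p(\mathscr D_{-4\eta/d,\,-4\tau/d,\,-4\lambda/d})$; (ii) for every $z\in\mathbb C$: $z\in\sigma_p(\mathscr D_{\eta,\tau,\lambda})$ if and only if $-z\in\sigma_p(\mathscr D_{-\eta,\tau,-\lambda})$. Moreover, $C$ is an involution, $f\in\operatorname{dom}\mathscr D_{\eta,\tau,\lambda}$ if and only if $Cf\in\operatorname{dom}\mathscr D_{-\eta,\tau,-\lambda}$, and $\mathscr D_{-\eta,\tau,-\lambda}Cf=-C\,\mathscr D_{\eta,\tau,\lambda}f$ for all $f\in\operatorname{dom}\mathscr D_{\eta,\tau,\lambda}$. -/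

import Mathlib

open MeasureTheory Filter Topology
open scoped ContDiff ENNReal

namespace DiracShell

noncomputable section

/-- The Euclidean plane `ℝ²`. -/
abbrev Plane := EuclideanSpace ℝ (Fin 2)

/-- The spinor space `ℂ²`. -/
abbrev Spinor := EuclideanSpace ℂ (Fin 2)

/-- The Hilbert space `L²(ℝ²; ℂ²)`. -/
abbrev SpinorL2 := Lp Spinor 2 (volume : Measure Plane)

/-! ### Pauli matrices and the differential expression `σ · ∇` -/

/-- The Pauli matrix `σ₁`. -/
def pauli₁ : Matrix (Fin 2) (Fin 2) ℂ := !![0, 1; 1, 0]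

/-- The Pauli matrix `σ₂`. -/
def pauli₂ : Matrix (Fin 2) (Fin 2) ℂ := !![0, -Complex.I; Complex.I, 0]

/-- The Pauli matrix `σ₃`. -/
def pauli₃ : Matrix (Fin 2) (Fin 2) ℂ := !![1, 0; 0, -1]

/-- A complex `2 × 2` matrix acting on `ℂ²`. -/
abbrev act (M : Matrix (Fin 2) (Fin 2) ℂ) : Spinor →L[ℂ] Spinor :=
  Matrix.toEuclideanCLM (n := Fin 2) (𝕜 := ℂ) M

/-- `σ · ∇ u = σ₁ ∂₁ u + σ₂ ∂₂ u`, for a differentiable spinor field `u`. -/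
def sigmaGrad (u : Plane → Spinor) (x : Plane) : Spinor :=
  act pauli₁ (fderiv ℝ u x (EuclideanSpace.single 0 1)) +
    act pauli₂ (fderiv ℝ u x (EuclideanSpace.single 1 1))

/-- `h = σ · ∇ f` on the open set `U` in the sense of distributions. As the Pauli matrices are
Hermitian, `σ · ∇` is formally anti-symmetric for the inner product
(which is conjugate-linear in its first argument). -/
def IsWeakSigmaGrad (U : Set Plane) (f h : Plane → Spinor) : Prop :=
  ∀ φ : Plane → Spinor, ContDiff ℝ ∞ φ → HasCompactSupport φ → tsupport φ ⊆ U →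
    ∫ x in U, inner ℂ (sigmaGrad φ x) (f x) = -∫ x in U, inner ℂ (φ x) (h x)

/-! ### The domain and its boundary curve -/

/-- A bounded simply connected open set `Ω ⊆ ℝ²` with `C^∞` boundary `Σ = ∂Ω`, together with a
smooth, `ℓ`-periodic, arc-length parametrization `γ` of the closed curve `Σ` with positive
orientation, i.e. such that the unit normal `(γ₂', -γ₁')` points out of `Ω`. -/
structure Shell where
  /-- The domain. -/
  Ω : Set Plane
  isOpen : IsOpen Ω
  isBounded : Bornology.IsBounded Ω
  simplyConnected : SimplyConnectedSpace Ω
  /-- The length of the boundary curve. -/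
  ℓ : ℝ
  ℓ_pos : 0 < ℓ
  /-- The arc-length parametrization of the boundary curve. -/
  γ : ℝ → Plane
  smooth : ContDiff ℝ ∞ γ
  periodic : Function.Periodic γ ℓ
  injOn : Set.InjOn γ (Set.Ico 0 ℓ)
  unitSpeed : ∀ s, ‖deriv γ s‖ = 1
  range_eq : Set.range γ = frontier Ω
  outward : ∀ s, ∀ᶠ p in 𝓝[>] (0 : ℝ),
    γ s + p • (!₂[deriv γ s 1, -deriv γ s 0] : Plane) ∉ closure Ω ∧
    γ s - p • (!₂[deriv γ s 1, -deriv γ s 0] : Plane) ∈ Ω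

/-- The exterior domain `Ω₋ = ℝ² \ closure Ω`. -/
def Shell.ext (S : Shell) : Set Plane := (closure S.Ω)ᶜ

/-- `C^∞(ℝ/ℓℤ; ℂ)`: the smooth `ℓ`-periodic functions on the line. Through the arc-length
parametrization this is `C^∞(Σ; ℂ)`. -/
def SmoothPeriodic (ℓ : ℝ) : Subalgebra ℂ (ℝ → ℂ) where
  carrier := {ψ | ContDiff ℝ ∞ ψ ∧ Function.Periodic ψ ℓ}
  mul_mem' ha hb := ⟨ha.1.mul hb.1, ha.2.mul hb.2⟩
  add_mem' ha hb := ⟨ha.1.add hb.1, ha.2.add hb.2⟩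
  algebraMap_mem' _ := ⟨contDiff_const, fun _ => rfl⟩

/-- The Fourier coefficient `ψ̂(n) = ℓ⁻¹ ∫₀^ℓ e^{-2πins/ℓ} ψ(s) ds`. -/
def fourierCoefficient (ℓ : ℝ) (ψ : ℝ → ℂ) (n : ℤ) : ℂ :=
  (1 / ℓ : ℂ) * ∫ s in (0 : ℝ)..ℓ, Complex.exp (-2 * Real.pi * Complex.I * n * s / ℓ) * ψ s

/-- The `H^{1/2}`-norm of `ψ ∈ C^∞(Σ; ℂ)`: the square root of `∑ₙ (1 + |n|) |ψ̂(n)|²`. -/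
def halfNorm {ℓ : ℝ} (ψ : SmoothPeriodic ℓ) : ℝ≥0∞ :=
  (∑' n : ℤ, ENNReal.ofReal (1 + |(n : ℝ)|) * ‖fourierCoefficient ℓ ψ n‖ₑ ^ 2) ^ (1 / 2 : ℝ)

/-- The norm of a functional on `C^∞(Σ; ℂ)` that is dual to the `H^{1/2}`-norm, i.e. its norm
in `H^{-1/2}(Σ) = (H^{1/2}(Σ))'`; it is `∞` for functionals outside `H^{-1/2}(Σ)`. -/
def negHalfNorm {ℓ : ℝ} (F : SmoothPeriodic ℓ → ℂ) : ℝ≥0∞ :=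
  ⨆ (ψ : SmoothPeriodic ℓ) (_ : halfNorm ψ ≤ 1), ‖F ψ‖ₑ

/-- Linear functionals on `C^∞(Σ; ℂ)`. Those of finite `negHalfNorm` form `H^{-1/2}(Σ)`. -/
abbrev BoundaryFunctional (ℓ : ℝ) := SmoothPeriodic ℓ →ₗ[ℂ] ℂ

/-- The product `a φ` of a functional `φ` with a smooth function `a`: `⟨a φ, ψ⟩ = ⟨φ, a ψ⟩`. -/
def mulFunctional {ℓ : ℝ} (a : SmoothPeriodic ℓ) (φ : BoundaryFunctional ℓ) :
    BoundaryFunctional ℓ :=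
  φ ∘ₗ LinearMap.mulLeft ℂ a

/-- A matrix of smooth functions on `Σ` acting on a `ℂ²`-valued functional on `Σ`. -/
def matFunctional {ℓ : ℝ} (M : Matrix (Fin 2) (Fin 2) (SmoothPeriodic ℓ))
    (φ : Fin 2 → BoundaryFunctional ℓ) : Fin 2 → BoundaryFunctional ℓ :=
  fun i => ∑ j, mulFunctional (M i j) (φ j)

/-- A constant complex matrix, as a matrix of smooth functions on `Σ`. -/
def constMat {ℓ : ℝ} (M : Matrix (Fin 2) (Fin 2) ℂ) :
    Matrix (Fin 2) (Fin 2) (SmoothPeriodic ℓ) :=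
  M.map (algebraMap ℂ (SmoothPeriodic ℓ))

/-- The component `t_j` of the unit tangent `𝐭 = γ'`, as a smooth function on `Σ`. -/
def Shell.tangent (S : Shell) (j : Fin 2) : SmoothPeriodic S.ℓ :=
  ⟨fun s => ((deriv S.γ s j : ℝ) : ℂ), by
    refine ⟨?_, ?_⟩
    · have h1 : ContDiff ℝ ∞ (deriv S.γ) := (contDiff_infty_iff_deriv.1 S.smooth).2
      exact Complex.ofRealCLM.contDiff.comp
        ((EuclideanSpace.proj (𝕜 := ℝ) j : Plane →L[ℝ] ℝ).contDiff.comp h1)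
    · intro s
      have h : deriv S.γ (s + S.ℓ) = deriv S.γ s := by
        rw [← deriv_comp_add_const]
        congr 1
        funext x
        exact S.periodic x
      simp only [h]⟩

/-- The component `n_j` of the outer unit normal `𝐧 = (t₂, -t₁)`, as a smooth function on `Σ`. -/
def Shell.normal (S : Shell) : Fin 2 → SmoothPeriodic S.ℓ :=
  ![S.tangent 1, -S.tangent 0]

/-- `σ · A = A₁ σ₁ + A₂ σ₂` for a vector field `A` along `Σ`. -/
def sigmaDot {ℓ : ℝ} (A : Fin 2 → SmoothPeriodic ℓ) :
    Matrix (Fin 2) (Fin 2) (SmoothPeriodic ℓ) :=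
  Matrix.of fun i j => pauli₁ i j • A 0 + pauli₂ i j • A 1

/-! ### Dirichlet traces of functions in `H(σ, U)` -/

/-- The functional `ψ ↦ ∫_Σ u_j ψ ds` given by the `j`-th component of the boundary values
of a spinor field `u` that is continuous on `ℝ²`. -/
def Shell.boundaryPairing (S : Shell) (u : Plane → Spinor) (j : Fin 2)
    (ψ : SmoothPeriodic S.ℓ) : ℂ :=
  ∫ s in (0 : ℝ)..S.ℓ, u (S.γ s) j * (ψ : ℝ → ℂ) s

/-- `φ ∈ H^{-1/2}(Σ; ℂ²)` is the Dirichlet trace on `Σ` of `f ∈ H(σ, U)`, where `U` is `Ω` or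
its exterior and `h = σ · ∇ f` on `U`.

The Dirichlet trace operator is the continuous extension of `u ↦ u|_Σ`
from the dense space of restrictions to `U` of functions in `C_c^∞(ℝ²; ℂ²)` to an operator
from `H(σ, U)`, with the norm `(‖f‖² + ‖σ · ∇ f‖²)^{1/2}`, to `H^{-1/2}(Σ; ℂ²)`;
so its graph is the closure of the graph of this restriction map. -/
def Shell.IsTrace (S : Shell) (U : Set Plane) (f h : Plane → Spinor)
    (φ : Fin 2 → BoundaryFunctional S.ℓ) : Prop :=
  (∀ j, negHalfNorm (φ j) < ⊤) ∧
  ∃ u : ℕ → Plane → Spinor,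
    (∀ k, ContDiff ℝ ∞ (u k) ∧ HasCompactSupport (u k)) ∧
    Tendsto (fun k => eLpNorm (u k - f) 2 (volume.restrict U)) atTop (𝓝 0) ∧
    Tendsto (fun k => eLpNorm (sigmaGrad (u k) - h) 2 (volume.restrict U)) atTop (𝓝 0) ∧
    ∀ j, Tendsto (fun k => negHalfNorm fun ψ => S.boundaryPairing (u k) j ψ - φ j ψ)
      atTop (𝓝 0)

/-! ### Elementary facts that make the operator below well defined -/

lemma sigmaGrad_add {u v : Plane → Spinor} (hu : ContDiff ℝ ∞ u) (hv : ContDiff ℝ ∞ v) :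
    sigmaGrad (u + v) = sigmaGrad u + sigmaGrad v := by
  funext x
  have h1 : DifferentiableAt ℝ u x := (hu.differentiable (by simp)) x
  have h2 : DifferentiableAt ℝ v x := (hv.differentiable (by simp)) x
  simp only [sigmaGrad, Pi.add_apply, fderiv_add h1 h2, add_apply, map_add]
  abel

lemma sigmaGrad_smul (c : ℂ) {u : Plane → Spinor} (hu : ContDiff ℝ ∞ u) :
    sigmaGrad (c • u) = c • sigmaGrad u := by
  funext x
  have h1 : DifferentiableAt ℝ u x := (hu.differentiable (by simp)) x
  simp only [sigmaGrad, Pi.smul_apply, fderiv_const_smul h1 c, smul_apply, map_smul, smul_add]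

lemma continuous_sigmaGrad {u : Plane → Spinor} (hu : ContDiff ℝ ∞ u) :
    Continuous (sigmaGrad u) := by
  have h := hu.continuous_fderiv (by simp)
  unfold sigmaGrad
  fun_prop

lemma hasCompactSupport_sigmaGrad {u : Plane → Spinor} (hu : HasCompactSupport u) :
    HasCompactSupport (sigmaGrad u) := by
  refine (hu.fderiv (𝕜 := ℝ)).mono ?_
  intro x hx
  contrapose! hx
  have h0 : fderiv ℝ u x = 0 := by simpa using hx
  simp [sigmaGrad, h0]

lemma integrable_inner {U : Set Plane} {u f : Plane → Spinor} (hu : Continuous u)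
    (hc : HasCompactSupport u) (hf : MemLp f 2 volume) :
    Integrable (fun x => inner ℂ (u x) (f x)) (volume.restrict U) := by
  have h1 : MemLp u 2 (volume.restrict U) := (hu.memLp_of_hasCompactSupport hc).restrict U
  have h2 : MemLp f 2 (volume.restrict U) := hf.restrict U
  refine (L2.integrable_inner (𝕜 := ℂ) h1.toLp h2.toLp).congr ?_
  filter_upwards [h1.coeFn_toLp, h2.coeFn_toLp] with x hx1 hx2
  rw [hx1, hx2]

lemma IsWeakSigmaGrad.congr {U : Set Plane} {f h f' h' : Plane → Spinor}
    (H : IsWeakSigmaGrad U f h) (hf : f =ᵐ[volume] f') (hh : h =ᵐ[volume] h') :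
    IsWeakSigmaGrad U f' h' := by
  intro φ h1 h2 h3
  have e1 : ∫ x in U, inner ℂ (sigmaGrad φ x) (f' x) =
      ∫ x in U, inner ℂ (sigmaGrad φ x) (f x) := by
    refine integral_congr_ae ?_
    filter_upwards [ae_restrict_of_ae hf] with x hx
    rw [hx]
  have e2 : ∫ x in U, inner ℂ (φ x) (h' x) = ∫ x in U, inner ℂ (φ x) (h x) := by
    refine integral_congr_ae ?_
    filter_upwards [ae_restrict_of_ae hh] with x hx
    rw [hx]
  rw [e1, e2]
  exact H φ h1 h2 h3

lemma IsWeakSigmaGrad.add {U : Set Plane} {f h f' h' : SpinorL2}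
    (H : IsWeakSigmaGrad U f h) (H' : IsWeakSigmaGrad U f' h') :
    IsWeakSigmaGrad U (f + f' : SpinorL2) (h + h' : SpinorL2) := by
  refine IsWeakSigmaGrad.congr (f := (f : Plane → Spinor) + f') (h := (h : Plane → Spinor) + h')
    ?_ (Lp.coeFn_add f f').symm (Lp.coeFn_add h h').symm
  intro φ h1 h2 h3
  have c1 := continuous_sigmaGrad h1
  have c2 := hasCompactSupport_sigmaGrad h2
  simp only [Pi.add_apply, inner_add_right]
  rw [integral_add (integrable_inner c1 c2 (Lp.memLp f)) (integrable_inner c1 c2 (Lp.memLp f')),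
    integral_add (integrable_inner h1.continuous h2 (Lp.memLp h))
      (integrable_inner h1.continuous h2 (Lp.memLp h')), H φ h1 h2 h3, H' φ h1 h2 h3]
  ring

lemma IsWeakSigmaGrad.smul {U : Set Plane} {f h : SpinorL2} (c : ℂ)
    (H : IsWeakSigmaGrad U f h) :
    IsWeakSigmaGrad U (c • f : SpinorL2) (c • h : SpinorL2) := by
  refine IsWeakSigmaGrad.congr (f := c • (f : Plane → Spinor)) (h := c • (h : Plane → Spinor))
    ?_ (Lp.coeFn_smul c f).symm (Lp.coeFn_smul c h).symm
  intro φ h1 h2 h3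
  simp only [Pi.smul_apply, inner_smul_right, integral_const_mul]
  rw [H φ h1 h2 h3]
  ring

lemma IsWeakSigmaGrad.ae_eq_zero {U : Set Plane} (hU : IsOpen U) {h : SpinorL2}
    (H : IsWeakSigmaGrad U (0 : SpinorL2) h) : ∀ᵐ x, x ∈ U → h x = 0 := by
  have hloc : LocallyIntegrable (h : Plane → Spinor) volume :=
    (Lp.memLp h).locallyIntegrable (by norm_num)
  refine hU.ae_eq_zero_of_integral_contDiff_smul_eq_zero (hloc.locallyIntegrableOn U) ?_
  intro g g1 g2 g3
  have hint : Integrable (fun x => g x • h x) volume :=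
    hloc.integrable_smul_left_of_hasCompactSupport g1.continuous g2
  refine ext_inner_left ℂ fun v => ?_
  rw [inner_zero_right, ← integral_inner hint]
  set φ : Plane → Spinor := fun x => g x • v with hφ
  have p1 : ContDiff ℝ ∞ φ := g1.smul contDiff_const
  have p2 : HasCompactSupport φ := g2.smul_right
  have p3 : tsupport φ ⊆ U := (closure_mono (Function.support_smul_subset_left g _)).trans g3
  have key := H φ p1 p2 p3
  have z : ∫ x in U, inner ℂ (sigmaGrad φ x) ((0 : SpinorL2) x) = 0 := by
    refine integral_eq_zero_of_ae ?_
    filter_upwards [ae_restrict_of_ae (Lp.coeFn_zero Spinor 2 (volume : Measure Plane))] with x _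
    simp
  rw [z] at key
  have e : ∀ x, inner ℂ v (g x • h x) = inner ℂ (φ x) (h x) := by
    intro x
    simp only [hφ, RCLike.real_smul_eq_coe_smul (K := ℂ), inner_smul_left, inner_smul_right]
    simp
  simp only [e]
  rw [← setIntegral_eq_integral_of_forall_compl_eq_zero (s := U)]
  · simpa using key.symm
  · intro x hx
    have : φ x = 0 := image_eq_zero_of_notMem_tsupport fun hx' => hx (p3 hx')
    simp [this]

lemma Shell.volume_frontier (S : Shell) : volume (frontier S.Ω) = 0 := by
  rw [← S.range_eq]
  have h1 : dimH (Set.range S.γ) ≤ Module.finrank ℝ ℝ :=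
    (S.smooth.of_le (by exact_mod_cast le_top)).dimH_range_le
  have h2 : dimH (Set.range S.γ) < ((2 : NNReal) : ℝ≥0∞) := by
    refine h1.trans_lt ?_
    simp
  refine measure_zero_of_dimH_lt (d := 2) ?_ h2
  have e : ((2 : NNReal) : ℝ) = ((Module.finrank ℝ Plane : ℕ) : ℝ) := by simp
  rw [e, Measure.isAddLeftInvariant_eq_smul (volume : Measure Plane)
    (Measure.hausdorffMeasure ((Module.finrank ℝ Plane : ℕ) : ℝ))]
  exact Measure.smul_absolutelyContinuous

lemma negHalfNorm_add_le {ℓ : ℝ} (F G : SmoothPeriodic ℓ → ℂ) :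
    negHalfNorm (F + G) ≤ negHalfNorm F + negHalfNorm G := by
  refine iSup₂_le fun ψ hψ => (enorm_add_le _ _).trans ?_
  exact add_le_add (le_iSup₂ (f := fun ψ _ => ‖F ψ‖ₑ) ψ hψ)
    (le_iSup₂ (f := fun ψ _ => ‖G ψ‖ₑ) ψ hψ)

lemma negHalfNorm_smul_le {ℓ : ℝ} (c : ℂ) (F : SmoothPeriodic ℓ → ℂ) :
    negHalfNorm (c • F) ≤ ‖c‖ₑ * negHalfNorm F := by
  refine iSup₂_le fun ψ hψ => ?_
  rw [Pi.smul_apply, enorm_smul]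
  gcongr
  exact le_iSup₂ (f := fun ψ _ => ‖F ψ‖ₑ) ψ hψ

lemma Shell.intervalIntegrable_boundary (S : Shell) {u : Plane → Spinor} (hu : Continuous u)
    (j : Fin 2) (ψ : SmoothPeriodic S.ℓ) :
    IntervalIntegrable (fun s => u (S.γ s) j * (ψ : ℝ → ℂ) s) volume 0 S.ℓ := by
  have h1 : Continuous (ψ : ℝ → ℂ) := ψ.2.1.continuous
  have h2 : Continuous S.γ := S.smooth.continuous
  exact Continuous.intervalIntegrable (by fun_prop) _ _

lemma Shell.IsTrace.congr {S : Shell} {U : Set Plane} {f h f' h' : Plane → Spinor}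
    {φ : Fin 2 → BoundaryFunctional S.ℓ} (H : S.IsTrace U f h φ)
    (hf : f =ᵐ[volume] f') (hh : h =ᵐ[volume] h') : S.IsTrace U f' h' φ := by
  obtain ⟨H0, u, H1, H2, H3, H4⟩ := H
  refine ⟨H0, u, H1, ?_, ?_, H4⟩
  · refine H2.congr fun k => eLpNorm_congr_ae ?_
    filter_upwards [ae_restrict_of_ae hf] with x hx
    simp [hx]
  · refine H3.congr fun k => eLpNorm_congr_ae ?_
    filter_upwards [ae_restrict_of_ae hh] with x hx
    simp [hx]

lemma Shell.IsTrace.add {S : Shell} {U : Set Plane} {f h f' h' : SpinorL2}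
    {φ φ' : Fin 2 → BoundaryFunctional S.ℓ} (H : S.IsTrace U f h φ) (H' : S.IsTrace U f' h' φ') :
    S.IsTrace U (f + f' : SpinorL2) (h + h' : SpinorL2) (φ + φ') := by
  refine Shell.IsTrace.congr (f := (f : Plane → Spinor) + f') (h := (h : Plane → Spinor) + h')
    ?_ (Lp.coeFn_add f f').symm (Lp.coeFn_add h h').symm
  obtain ⟨H0, u, H1, H2, H3, H4⟩ := H
  obtain ⟨H0', u', H1', H2', H3', H4'⟩ := H'
  have aux : ∀ (a a' : ℕ → Plane → Spinor) (g g' : SpinorL2), (∀ k, Continuous (a k)) →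
      (∀ k, Continuous (a' k)) →
      Tendsto (fun k => eLpNorm (a k - (g : Plane → Spinor)) 2 (volume.restrict U)) atTop (𝓝 0) →
      Tendsto (fun k => eLpNorm (a' k - (g' : Plane → Spinor)) 2 (volume.restrict U)) atTop (𝓝 0) →
      Tendsto (fun k => eLpNorm (a k + a' k - ((g : Plane → Spinor) + (g' : Plane → Spinor))) 2
        (volume.restrict U)) atTop (𝓝 0) := by
    intro a a' g g' ha ha' t t'
    have tt := t.add t'
    rw [add_zero] at tt
    refine tendsto_of_tendsto_of_tendsto_of_le_of_le tendsto_const_nhds tt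
      (fun _ => zero_le) fun k => ?_
    have e : a k + a' k - ((g : Plane → Spinor) + (g' : Plane → Spinor)) =
        (a k - (g : Plane → Spinor)) + (a' k - (g' : Plane → Spinor)) := by abel
    simp only [e]
    refine eLpNorm_add_le ?_ ?_ (by norm_num)
    · exact (ha k).aestronglyMeasurable.sub (Lp.aestronglyMeasurable g).restrict
    · exact (ha' k).aestronglyMeasurable.sub (Lp.aestronglyMeasurable g').restrict
  refine ⟨fun j => ?_, u + u', fun k => ⟨(H1 k).1.add (H1' k).1, (H1 k).2.add (H1' k).2⟩, ?_, ?_,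
    fun j => ?_⟩
  · refine lt_of_le_of_lt ?_ (ENNReal.add_lt_top.2 ⟨H0 j, H0' j⟩)
    exact negHalfNorm_add_le _ _
  · exact aux u u' f f' (fun k => (H1 k).1.continuous) (fun k => (H1' k).1.continuous) H2 H2'
  · have := aux (fun k => sigmaGrad (u k)) (fun k => sigmaGrad (u' k)) h h'
      (fun k => continuous_sigmaGrad (H1 k).1) (fun k => continuous_sigmaGrad (H1' k).1) H3 H3'
    refine this.congr fun k => ?_
    rw [Pi.add_apply, sigmaGrad_add (H1 k).1 (H1' k).1]
  · have tt := (H4 j).add (H4' j)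
    rw [add_zero] at tt
    refine tendsto_of_tendsto_of_tendsto_of_le_of_le tendsto_const_nhds tt
      (fun _ => zero_le) fun k => ?_
    refine le_trans (le_of_eq ?_) (negHalfNorm_add_le _ _)
    congr 1
    funext ψ
    have e : S.boundaryPairing ((u + u') k) j ψ =
        S.boundaryPairing (u k) j ψ + S.boundaryPairing (u' k) j ψ := by
      unfold Shell.boundaryPairing
      rw [← intervalIntegral.integral_add
        (S.intervalIntegrable_boundary (H1 k).1.continuous j ψ)
        (S.intervalIntegrable_boundary (H1' k).1.continuous j ψ)]
      congr 1
      funext s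
      simp [add_mul]
    simp only [Pi.add_apply, LinearMap.add_apply] at e ⊢
    rw [e]
    ring

lemma Shell.IsTrace.smul {S : Shell} {U : Set Plane} {f h : SpinorL2} (c : ℂ)
    {φ : Fin 2 → BoundaryFunctional S.ℓ} (H : S.IsTrace U f h φ) :
    S.IsTrace U (c • f : SpinorL2) (c • h : SpinorL2) (c • φ) := by
  refine Shell.IsTrace.congr (f := c • (f : Plane → Spinor)) (h := c • (h : Plane → Spinor))
    ?_ (Lp.coeFn_smul c f).symm (Lp.coeFn_smul c h).symm
  obtain ⟨H0, u, H1, H2, H3, H4⟩ := H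
  have lim : ∀ {x : ℕ → ℝ≥0∞}, Tendsto x atTop (𝓝 0) →
      Tendsto (fun k => ‖c‖ₑ * x k) atTop (𝓝 0) := by
    intro x hx
    simpa using ENNReal.Tendsto.const_mul hx (Or.inr enorm_ne_top)
  refine ⟨fun j => ?_, fun k => c • u k, fun k => ⟨(H1 k).1.const_smul c, ?_⟩, ?_, ?_,
    fun j => ?_⟩
  · refine lt_of_le_of_lt (negHalfNorm_smul_le c (φ j)) ?_
    exact ENNReal.mul_lt_top enorm_lt_top (H0 j)
  · exact (H1 k).2.smul_left (f := fun _ => c)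
  · refine (lim H2).congr fun k => ?_
    rw [← smul_sub, eLpNorm_const_smul]
  · refine (lim H3).congr fun k => ?_
    rw [sigmaGrad_smul c (H1 k).1, ← smul_sub, eLpNorm_const_smul]
  · refine tendsto_of_tendsto_of_tendsto_of_le_of_le tendsto_const_nhds (lim (H4 j))
      (fun _ => zero_le) fun k => ?_
    refine le_trans (le_of_eq ?_) (negHalfNorm_smul_le _ _)
    congr 1
    funext ψ
    have e : S.boundaryPairing (c • u k) j ψ = c * S.boundaryPairing (u k) j ψ := by
      unfold Shell.boundaryPairing
      rw [← intervalIntegral.integral_const_mul]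
      congr 1
      funext s
      simp [mul_assoc]
    simp only [Pi.smul_apply, LinearMap.smul_apply, smul_eq_mul] at e ⊢
    rw [e]
    ring

lemma Shell.isTrace_zero (S : Shell) (U : Set Plane) :
    S.IsTrace U (0 : SpinorL2) (0 : SpinorL2) 0 := by
  refine Shell.IsTrace.congr (f := 0) (h := 0) ?_ (Lp.coeFn_zero _ _ _).symm
    (Lp.coeFn_zero _ _ _).symm
  have z : negHalfNorm (fun _ : SmoothPeriodic S.ℓ => (0 : ℂ)) = 0 := by simp [negHalfNorm]
  refine ⟨fun j => ?_, fun _ => 0, fun k => ⟨contDiff_const, HasCompactSupport.zero⟩, ?_, ?_,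
    fun j => ?_⟩
  · refine lt_of_le_of_lt (le_of_eq ?_) ENNReal.zero_lt_top
    exact z
  · simp
  · have : sigmaGrad (0 : Plane → Spinor) = 0 := by
      funext x
      simp [sigmaGrad]
    simp [this]
  · refine Tendsto.congr (fun k => ?_) tendsto_const_nhds
    simpa [Shell.boundaryPairing] using z.symm

lemma matFunctional_add {ℓ : ℝ} (M : Matrix (Fin 2) (Fin 2) (SmoothPeriodic ℓ))
    (φ φ' : Fin 2 → BoundaryFunctional ℓ) :
    matFunctional M (φ + φ') = matFunctional M φ + matFunctional M φ' := by
  funext i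
  simp [matFunctional, mulFunctional, LinearMap.add_comp]
  abel

lemma matFunctional_smul {ℓ : ℝ} (M : Matrix (Fin 2) (Fin 2) (SmoothPeriodic ℓ)) (c : ℂ)
    (φ : Fin 2 → BoundaryFunctional ℓ) :
    matFunctional M (c • φ) = c • matFunctional M φ := by
  funext i
  simp [matFunctional, mulFunctional, LinearMap.smul_comp]

/-! ### The Dirac operator with a `δ`-shell interaction -/

/-- The graph of `f ↦ σ · ∇ f₊ ⊕ σ · ∇ f₋` on
`H(σ, Ω₊) ⊕ H(σ, Ω₋) ⊆ L²(Ω₊; ℂ²) ⊕ L²(Ω₋; ℂ²) = L²(ℝ²; ℂ²)`. -/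
def Shell.sigmaGradGraph (S : Shell) : Submodule ℂ (SpinorL2 × SpinorL2) where
  carrier := {p | IsWeakSigmaGrad S.Ω p.1 p.2 ∧ IsWeakSigmaGrad S.ext p.1 p.2}
  add_mem' ha hb := ⟨ha.1.add hb.1, ha.2.add hb.2⟩
  zero_mem' := by
    have h : ∀ U, IsWeakSigmaGrad U (0 : SpinorL2) (0 : SpinorL2) := by
      intro U
      refine IsWeakSigmaGrad.congr (f := 0) (h := 0) ?_ (Lp.coeFn_zero _ _ _).symm
        (Lp.coeFn_zero _ _ _).symm
      intro φ _ _ _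
      simp
    exact ⟨h _, h _⟩
  smul_mem' c _ ha := ⟨ha.1.smul c, ha.2.smul c⟩

lemma Shell.sigmaGradGraph_functional (S : Shell) (p : SpinorL2 × SpinorL2)
    (hp : p ∈ S.sigmaGradGraph) (h0 : p.1 = 0) : p.2 = 0 := by
  obtain ⟨f, h⟩ := p
  obtain ⟨h1, h2⟩ := hp
  simp only at h0 h1 h2 ⊢
  subst h0
  have a1 := h1.ae_eq_zero S.isOpen
  have a2 := h2.ae_eq_zero isClosed_closure.isOpen_compl
  have a3 : ∀ᵐ x, x ∉ frontier S.Ω := measure_eq_zero_iff_ae_notMem.1 S.volume_frontier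
  refine Lp.ext ?_
  filter_upwards [a1, a2, a3, Lp.coeFn_zero Spinor 2 (volume : Measure Plane)] with x b1 b2 b3 b4
  rw [b4]
  by_cases hx : x ∈ S.Ω
  · exact b1 hx
  · refine b2 fun hx' => b3 ⟨hx', ?_⟩
    rwa [S.isOpen.interior_eq]

/-- The operator `f ↦ σ · ∇ f₊ ⊕ σ · ∇ f₋` with domain `H(σ, Ω₊) ⊕ H(σ, Ω₋)`. -/
def Shell.sigmaGradMax (S : Shell) : SpinorL2 →ₗ.[ℂ] SpinorL2 :=
  S.sigmaGradGraph.toLinearPMap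

/-- The transmission condition
`i (σ·𝐧) (φ₋ - φ₊) = ½ (η 𝕀₂ + τ σ₃ + λ (σ·𝐭)) (φ₋ + φ₊)` on `Σ`. -/
def Shell.Transmission (S : Shell) (η τ lam : ℝ) (φp φm : Fin 2 → BoundaryFunctional S.ℓ) :
    Prop :=
  Complex.I • matFunctional (sigmaDot S.normal) (φm - φp) =
    (1 / 2 : ℂ) • matFunctional
      ((η : ℂ) • (1 : Matrix (Fin 2) (Fin 2) (SmoothPeriodic S.ℓ)) + (τ : ℂ) • constMat pauli₃ +
        (lam : ℂ) • sigmaDot S.tangent) (φm + φp)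

/-- The domain of `𝒟_{η,τ,λ}`: the `f = f₊ ⊕ f₋ ∈ H(σ, Ω₊) ⊕ H(σ, Ω₋)` whose Dirichlet traces
satisfy the transmission condition in `H^{-1/2}(Σ; ℂ²)`. -/
def Shell.diracDomain (S : Shell) (η τ lam : ℝ) : Submodule ℂ SpinorL2 where
  carrier := {f | ∃ hf : f ∈ S.sigmaGradMax.domain, ∃ φp φm : Fin 2 → BoundaryFunctional S.ℓ,
    S.IsTrace S.Ω f (S.sigmaGradMax ⟨f, hf⟩) φp ∧ S.IsTrace S.ext f (S.sigmaGradMax ⟨f, hf⟩) φm ∧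
    S.Transmission η τ lam φp φm}
  add_mem' := by
    rintro f g ⟨hf, φp, φm, f1, f2, f3⟩ ⟨hg, ψp, ψm, g1, g2, g3⟩
    have e : S.sigmaGradMax ⟨f + g, add_mem hf hg⟩ =
        S.sigmaGradMax ⟨f, hf⟩ + S.sigmaGradMax ⟨g, hg⟩ :=
      S.sigmaGradMax.map_add ⟨f, hf⟩ ⟨g, hg⟩
    refine ⟨add_mem hf hg, φp + ψp, φm + ψm, ?_, ?_, ?_⟩
    · rw [e]
      exact f1.add g1
    · rw [e]
      exact f2.add g2
    · unfold Shell.Transmission at *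
      rw [add_sub_add_comm, add_add_add_comm, matFunctional_add, matFunctional_add, smul_add,
        smul_add, f3, g3]
  zero_mem' := by
    have e : S.sigmaGradMax ⟨0, zero_mem _⟩ = 0 := S.sigmaGradMax.map_zero
    refine ⟨zero_mem _, 0, 0, ?_, ?_, ?_⟩
    · rw [e]
      exact S.isTrace_zero _
    · rw [e]
      exact S.isTrace_zero _
    · unfold Shell.Transmission
      funext i
      simp [matFunctional, mulFunctional]
  smul_mem' := by
    rintro c f ⟨hf, φp, φm, f1, f2, f3⟩
    have e : S.sigmaGradMax ⟨c • f, Submodule.smul_mem _ c hf⟩ = c • S.sigmaGradMax ⟨f, hf⟩ :=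
      S.sigmaGradMax.map_smul c ⟨f, hf⟩
    refine ⟨Submodule.smul_mem _ c hf, c • φp, c • φm, ?_, ?_, ?_⟩
    · rw [e]
      exact f1.smul c
    · rw [e]
      exact f2.smul c
    · unfold Shell.Transmission at *
      rw [← smul_sub, ← smul_add, matFunctional_smul, matFunctional_smul, smul_comm, f3,
        smul_comm]

lemma Shell.diracDomain_le (S : Shell) (η τ lam : ℝ) :
    S.diracDomain η τ lam ≤ S.sigmaGradMax.domain := fun _ hf => hf.1

/-- The Dirac operator `𝒟_{η,τ,λ}` with mass `m` and a `δ`-shell interaction of constant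
strengths `η, τ, λ` on `Σ`: it acts as `D₀ = -i σ·∇ + m σ₃` on `Ω₊` and on `Ω₋`. -/
def Shell.dirac (S : Shell) (m η τ lam : ℝ) : SpinorL2 →ₗ.[ℂ] SpinorL2 where
  domain := S.diracDomain η τ lam
  toFun :=
    (-Complex.I) • (S.sigmaGradMax.toFun ∘ₗ Submodule.inclusion (S.diracDomain_le η τ lam)) +
      (m : ℂ) • ((act pauli₃).compLpₗ 2 volume ∘ₗ (S.diracDomain η τ lam).subtype)

/-- The point spectrum (set of eigenvalues) `σ_p(A)` of an unbounded operator `A`. -/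
def pointSpectrum (A : SpinorL2 →ₗ.[ℂ] SpinorL2) : Set ℂ :=
  {z | ∃ f : A.domain, (f : SpinorL2) ≠ 0 ∧ A f = z • (f : SpinorL2)}

/-- Componentwise complex conjugation `f ↦ f̄` on `L²(ℝ²; ℂ²)`. -/
def conjL2 (f : SpinorL2) : SpinorL2 :=
  LipschitzWith.compLp (c := 1) (g := fun v : Spinor => (WithLp.toLp 2 fun j => star (v j)))
    (LipschitzWith.of_dist_le_mul fun v w => by
      simp only [EuclideanSpace.dist_eq, NNReal.coe_one, one_mul]
      simp only [RCLike.star_def, dist_eq_norm, ← map_sub, RCLike.norm_conj, le_refl])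
    (by ext j; simp) f

/-- The charge conjugation `C f = σ₁ f̄` on `L²(ℝ²; ℂ²)`. -/
def chargeConj (f : SpinorL2) : SpinorL2 :=
  (act pauli₁).compLp (conjL2 f)

end

end DiracShell

/-!
The three symmetry statements are algebraic once the eigenvalues are known to be real, and the
analysis goes into that reality.

*The frame.* Multiply the second component of a trace by the conjugate `τ̄` of the complex unit
tangent `τ = t₁ + i t₂`. Then `σ · 𝐧` and `σ · 𝐭` become constant matrices, and the transmission
condition becomes two scalar equations with constant coefficients (`Shell.transmission_iff`).

*Duality.* Replacing `f₊ ⊕ f₋` by `f₊ ⊕ (-f₋)` exchanges, up to sign, the jump and twice the mean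
value of the traces. Solving the transmission condition for the mean value, which is possible
exactly for `d ≠ 0`, gives the parameters `-4 (η, τ, λ) / d` (`Shell.Transmission.flip`); as the
differential expression acts on each side separately, eigenvalues are preserved. The parameter map
is an involution, because it replaces `d` by `16 / d`.

*Charge conjugation.* `v ↦ σ₁ v̄` is an isometry that commutes with `σ · ∇` and anticommutes with
`σ₃`, and it preserves weak derivatives, the graph closure that defines traces, and the
`H^{-1/2}`-norm. Hence `𝒟_{-η,τ,-λ} C = -C 𝒟_{η,τ,λ}`, which sends an eigenvalue `z` to `-z̄`.

*Reality of eigenvalues.* It remains to see that `Re ⟨f, σ · ∇ f⟩ = 0` for `f` in the domain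
(`Shell.IsDomainPair.re_inner_eq_zero`). For smooth fields, Green's formula expresses
`Re ⟨f, σ · ∇ f⟩_U` by `Im ∫_Σ f₁ conj(τ̄ f₂) ds`, and the transmission condition makes the
contributions of the two sides cancel. For general `f` the two traces lie in `H^{-1/2}` only, so that
this boundary integral has no direct meaning. It is replaced by its Fourier truncations
`∑_{|n| ≤ N} a(n) conj(b(n))` (`truncPairing`). The transmission condition has constant coefficients
in the rotated frame, so the cancellation holds for each Fourier mode
(`Shell.Transmission.im_truncPairing_eq`), and it is enough to have Green's formula in the limit
`N → ∞` (`Shell.IsTrace.tendsto_im_truncPairing`). By density this follows from the smooth case and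
a bound of the truncated pairing by the graph norm of `σ · ∇`, uniform in `N`
(`Shell.exists_norm_truncPairing_le`).

*The uniform bound.* In tubular coordinates `(r, s)` the two components satisfy
`ϖ ∂_r w + i e ∂_s w = …` and `ϖ ∂_r z - i e ∂_s z = …` with a Jacobian `ϖ = 1 + O(r)`. Were `ϖ = 1`,
the tangential terms would cancel in `∂_r ∑_{|n| ≤ N} ŵ(n) conj(ẑ(n))`, and integration in `r` would
give the bound. The error `(ϖ - 1) ∂_s w` is of size `r |∂_s w|`, and `r ∂_s w` is controlled in
`L²` by a weighted elliptic estimate (`weighted_partialS_le`). Thus no extension or regularity theory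
for `H^{±1/2}` is needed.
-/

namespace DiracShell


/-! ### Fourier coefficients of continuous functions -/

/-- Differentiation under the integral sign for integrands that are jointly continuous together
with their derivative in the parameter. -/
lemma hasDerivAt_intervalIntegral_of_continuous {F F' : ℝ → ℝ → ℂ} (a b : ℝ)
    (hF : Continuous (Function.uncurry F)) (hF' : Continuous (Function.uncurry F'))
    (hd : ∀ r s, HasDerivAt (fun r => F r s) (F' r s) r) (r : ℝ) :
    HasDerivAt (fun r => ∫ s in a..b, F r s) (∫ s in a..b, F' r s) r := by
  have c1 : ∀ r, Continuous (F r) := fun r => hF.comp (by fun_prop : Continuous fun s => (r, s))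
  have c2 : ∀ r, Continuous (F' r) := fun r => hF'.comp (by fun_prop : Continuous fun s => (r, s))
  obtain ⟨C, hC⟩ := ((isCompact_closedBall r 1).prod
    (isCompact_uIcc (a := a) (b := b))).exists_bound_of_continuousOn
    hF'.continuousOn
  refine (intervalIntegral.hasDerivAt_integral_of_dominated_loc_of_deriv_le
    (s := Metric.closedBall r 1) (bound := fun _ => C) (Metric.closedBall_mem_nhds r one_pos)
    (.of_forall fun x => (c1 x).aestronglyMeasurable) ((c1 r).intervalIntegrable _ _)
    (c2 r).aestronglyMeasurable (.of_forall fun t ht x hx => ?_) (by simp)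
    (.of_forall fun t _ x _ => hd x t)).2
  exact hC (x, t) ⟨hx, Set.uIoc_subset_uIcc ht⟩

/-- The smooth periodic exponential `s ↦ e^{2πins/ℓ}`. -/
noncomputable def expPeriodic {ℓ : ℝ} (hℓ : 0 < ℓ) (n : ℤ) : SmoothPeriodic ℓ :=
  ⟨fun s => Complex.exp (2 * Real.pi * Complex.I * n * s / ℓ), by
    refine ⟨?_, fun s => ?_⟩
    · have : ContDiff ℝ ∞ fun s : ℝ => 2 * Real.pi * Complex.I * n * (s : ℂ) / ℓ :=
        (contDiff_const.mul Complex.ofRealCLM.contDiff).div_const _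
      exact this.cexp
    · have : (2 * Real.pi * Complex.I * n * ((s + ℓ : ℝ) : ℂ) / ℓ : ℂ) =
          2 * Real.pi * Complex.I * n * (s : ℂ) / ℓ + n * (2 * Real.pi * Complex.I) := by
        have h0 : (ℓ : ℂ) ≠ 0 := by exact_mod_cast hℓ.ne'
        push_cast
        field_simp
      simp only [this]
      exact Complex.exp_periodic.int_mul n _⟩

lemma continuous_expPeriodic {ℓ : ℝ} (hℓ : 0 < ℓ) (n : ℤ) :
    Continuous (expPeriodic hℓ n : ℝ → ℂ) := (expPeriodic hℓ n).2.1.continuous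

lemma conj_expPeriodic {ℓ : ℝ} (hℓ : 0 < ℓ) (n : ℤ) (s : ℝ) :
    star ((expPeriodic hℓ n : ℝ → ℂ) s) = (expPeriodic hℓ (-n) : ℝ → ℂ) s := by
  simp only [expPeriodic, RCLike.star_def, ← Complex.exp_conj]
  congr 1
  simp [map_div₀, Complex.conj_ofNat]

lemma hasDerivAt_expPeriodic {ℓ : ℝ} (hℓ : 0 < ℓ) (n : ℤ) (s : ℝ) :
    HasDerivAt (expPeriodic hℓ n : ℝ → ℂ)
      ((2 * Real.pi * Complex.I * n / ℓ) * (expPeriodic hℓ n : ℝ → ℂ) s) s := by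
  have h1 : HasDerivAt (fun s : ℝ => 2 * Real.pi * Complex.I * n * (s : ℂ) / ℓ)
      (2 * Real.pi * Complex.I * n * 1 / ℓ) s :=
    ((Complex.ofRealCLM.hasDerivAt (x := s)).const_mul
      (2 * Real.pi * Complex.I * (n : ℂ))).div_const _
  refine h1.cexp.congr_deriv ?_
  change _ = 2 * Real.pi * Complex.I * n / ℓ * Complex.exp (2 * Real.pi * Complex.I * n * s / ℓ)
  ring

lemma fourierCoefficient_eq_integral {ℓ : ℝ} (hℓ : 0 < ℓ) (f : ℝ → ℂ) (n : ℤ) :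
    fourierCoefficient ℓ f n =
      (1 / ℓ : ℂ) * ∫ s in (0 : ℝ)..ℓ, (expPeriodic hℓ (-n) : ℝ → ℂ) s * f s := by
  simp only [fourierCoefficient, expPeriodic]
  congr 2
  funext s
  congr 2
  push_cast
  ring

lemma fourierCoefficient_eq_fourierCoeffOn {ℓ : ℝ} (hℓ : 0 < ℓ) (f : ℝ → ℂ) (n : ℤ) :
    fourierCoefficient ℓ f n = fourierCoeffOn hℓ f n := by
  rw [fourierCoeffOn_eq_integral, fourierCoefficient]
  simp only [fourier_coe_apply, sub_zero, smul_eq_mul, Complex.real_smul]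
  push_cast
  congr 3
  funext s
  congr 2
  ring

/-- Parseval's identity. -/
lemma hasSum_sq_fourierCoefficient {ℓ : ℝ} (hℓ : 0 < ℓ) {f : ℝ → ℂ} (hf : Continuous f) :
    HasSum (fun n => ‖fourierCoefficient ℓ f n‖ ^ 2) (ℓ⁻¹ * ∫ s in (0 : ℝ)..ℓ, ‖f s‖ ^ 2) := by
  have h : MemLp f 2 (volume.restrict (Set.Ioc 0 ℓ)) := by
    obtain ⟨C, hC⟩ := (isCompact_Icc (a := 0) (b := ℓ)).exists_bound_of_continuousOn
      hf.continuousOn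
    refine MemLp.of_bound hf.aestronglyMeasurable C ?_
    filter_upwards [ae_restrict_mem measurableSet_Ioc] with x hx
    exact hC x (Set.Ioc_subset_Icc_self hx)
  have := hasSum_sq_fourierCoeffOn hℓ h
  simp only [← fourierCoefficient_eq_fourierCoeffOn, sub_zero, smul_eq_mul] at this
  exact this

lemma fourierCoefficient_add {ℓ : ℝ} (hℓ : 0 < ℓ) {f g : ℝ → ℂ} (hf : Continuous f)
    (hg : Continuous g) (n : ℤ) :
    fourierCoefficient ℓ (fun s => f s + g s) n =
      fourierCoefficient ℓ f n + fourierCoefficient ℓ g n := by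
  have h1 := continuous_expPeriodic hℓ (-n)
  simp only [fourierCoefficient_eq_integral hℓ, mul_add]
  rw [intervalIntegral.integral_add, mul_add]
  · exact (h1.mul hf).intervalIntegrable _ _
  · exact (h1.mul hg).intervalIntegrable _ _

lemma fourierCoefficient_const_mul (ℓ : ℝ) (c : ℂ) (f : ℝ → ℂ) (n : ℤ) :
    fourierCoefficient ℓ (fun s => c * f s) n = c * fourierCoefficient ℓ f n := by
  simp only [fourierCoefficient]
  rw [mul_left_comm, ← intervalIntegral.integral_const_mul c]
  congr 2
  funext s
  ring

lemma fourierCoefficient_star {ℓ : ℝ} (hℓ : 0 < ℓ) (f : ℝ → ℂ) (n : ℤ) :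
    fourierCoefficient ℓ (fun s => star (f s)) n = star (fourierCoefficient ℓ f (-n)) := by
  simp only [fourierCoefficient_eq_integral hℓ, star_mul', neg_neg]
  congr 1
  · simp
  · simp only [RCLike.star_def, intervalIntegral.integral_of_le hℓ.le]
    rw [← integral_conj]
    congr 1
    funext s
    rw [map_mul, ← RCLike.star_def, conj_expPeriodic]

/-- Fourier coefficients of a derivative. -/
lemma fourierCoefficient_deriv {ℓ : ℝ} (hℓ : 0 < ℓ) {f f' : ℝ → ℂ}
    (hf : ∀ s, HasDerivAt f (f' s) s) (hf' : Continuous f') (hp : f ℓ = f 0) (n : ℤ) :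
    fourierCoefficient ℓ f' n = (2 * Real.pi * Complex.I * n / ℓ) * fourierCoefficient ℓ f n := by
  have hc : Continuous f := continuous_iff_continuousAt.2 fun s => (hf s).continuousAt
  have h1 := continuous_expPeriodic hℓ (-n)
  simp only [fourierCoefficient_eq_integral hℓ]
  rw [intervalIntegral.integral_mul_deriv_eq_deriv_mul (u := (expPeriodic hℓ (-n) : ℝ → ℂ))
    (v := f) (fun s _ => hasDerivAt_expPeriodic hℓ (-n) s) (fun s _ => hf s)
    ((continuous_const.mul h1).intervalIntegrable _ _) (hf'.intervalIntegrable _ _)]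
  have e : (expPeriodic hℓ (-n) : ℝ → ℂ) ℓ = (expPeriodic hℓ (-n) : ℝ → ℂ) 0 := by
    simpa using (expPeriodic hℓ (-n)).2.2 0
  simp only [mul_assoc, intervalIntegral.integral_const_mul]
  rw [e, hp]
  push_cast
  ring

lemma fourierCoefficient_hasDerivAt {ℓ : ℝ} (hℓ : 0 < ℓ) {F F' : ℝ → ℝ → ℂ}
    (hF : Continuous (Function.uncurry F)) (hF' : Continuous (Function.uncurry F'))
    (hd : ∀ r s, HasDerivAt (fun r => F r s) (F' r s) r) (n : ℤ) (r : ℝ) :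
    HasDerivAt (fun r => fourierCoefficient ℓ (F r) n) (fourierCoefficient ℓ (F' r) n) r := by
  have h1 := continuous_expPeriodic hℓ (-n)
  simp only [fourierCoefficient_eq_integral hℓ]
  refine HasDerivAt.const_mul _ (hasDerivAt_intervalIntegral_of_continuous 0 ℓ
    (F := fun r s => (expPeriodic hℓ (-n) : ℝ → ℂ) s * F r s)
    (F' := fun r s => (expPeriodic hℓ (-n) : ℝ → ℂ) s * F' r s) ?_ ?_
    (fun r s => (hd r s).const_mul _) r)
  · exact (h1.comp continuous_snd).mul hF
  · exact (h1.comp continuous_snd).mul hF'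

lemma continuous_fourierCoefficient {ℓ : ℝ} (hℓ : 0 < ℓ) {F : ℝ → ℝ → ℂ}
    (hF : Continuous (Function.uncurry F)) (n : ℤ) :
    Continuous fun r => fourierCoefficient ℓ (F r) n := by
  have h1 := continuous_expPeriodic hℓ (-n)
  simp only [fourierCoefficient_eq_integral hℓ]
  refine continuous_const.mul
    (intervalIntegral.continuous_parametric_intervalIntegral_of_continuous'
    (f := fun r s => (expPeriodic hℓ (-n) : ℝ → ℂ) s * F r s) ?_ _ _)
  exact (h1.comp continuous_snd).mul hF

/-- The `L²`-pairing of two functions on `Σ` with Fourier series truncated at order `N`, written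
in terms of the Fourier coefficients. -/
noncomputable def truncPairing (N : ℕ) (a b : ℤ → ℂ) : ℂ :=
  ∑ n ∈ Finset.Icc (-N : ℤ) N, a n * star (b n)

/-- Bessel's inequality, for the truncated pairing. -/
lemma norm_truncPairing_le {ℓ : ℝ} (hℓ : 0 < ℓ) {f g : ℝ → ℂ} (hf : Continuous f)
    (hg : Continuous g) (N : ℕ) :
    ‖truncPairing N (fourierCoefficient ℓ f) (fourierCoefficient ℓ g)‖ ≤
      ℓ⁻¹ * ((∫ s in (0 : ℝ)..ℓ, ‖f s‖ ^ 2) + ∫ s in (0 : ℝ)..ℓ, ‖g s‖ ^ 2) := by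
  have h1 := sum_le_hasSum (Finset.Icc (-N : ℤ) N) (fun _ _ => sq_nonneg _)
    (hasSum_sq_fourierCoefficient hℓ hf)
  have h2 := sum_le_hasSum (Finset.Icc (-N : ℤ) N) (fun _ _ => sq_nonneg _)
    (hasSum_sq_fourierCoefficient hℓ hg)
  rw [mul_add]
  refine le_trans ?_ (add_le_add h1 h2)
  rw [← Finset.sum_add_distrib]
  refine norm_sum_le_of_le _ fun n _ => ?_
  rw [norm_mul, norm_star]
  nlinarith [sq_nonneg (‖fourierCoefficient ℓ f n‖ - ‖fourierCoefficient ℓ g n‖),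
    sq_nonneg (‖fourierCoefficient ℓ f n‖), sq_nonneg ‖fourierCoefficient ℓ g n‖]

lemma star_mul_polarization (x y : ℂ) : x * star y =
    (1 / 4) * (((‖x + y‖ ^ 2 : ℝ) : ℂ) - ((‖x + (-1) * y‖ ^ 2 : ℝ) : ℂ) +
      Complex.I * ((‖x + Complex.I * y‖ ^ 2 : ℝ) : ℂ) -
      Complex.I * ((‖x + -Complex.I * y‖ ^ 2 : ℝ) : ℂ)) := by
  simp only [← Complex.normSq_eq_norm_sq, Complex.normSq_apply]
  apply Complex.ext <;> simp <;> ring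

/-- Parseval's identity, for the pairing of two functions. -/
lemma tendsto_truncPairing {ℓ : ℝ} (hℓ : 0 < ℓ) {f g : ℝ → ℂ} (hf : Continuous f)
    (hg : Continuous g) :
    Tendsto (fun N => truncPairing N (fourierCoefficient ℓ f) (fourierCoefficient ℓ g)) atTop
      (𝓝 ((ℓ⁻¹ : ℝ) * ∫ s in (0 : ℝ)..ℓ, f s * star (g s))) := by
  have key : ∀ c : ℂ, HasSum (fun n => ((‖fourierCoefficient ℓ f n +
      c * fourierCoefficient ℓ g n‖ ^ 2 : ℝ) : ℂ))
      ((ℓ⁻¹ : ℝ) * ∫ s in (0 : ℝ)..ℓ, ((‖f s + c * g s‖ ^ 2 : ℝ) : ℂ)) := by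
    intro c
    have h := hasSum_sq_fourierCoefficient hℓ (f := fun s => f s + c * g s) (by fun_prop)
    have e : ∀ n, fourierCoefficient ℓ (fun s => f s + c * g s) n =
        fourierCoefficient ℓ f n + c * fourierCoefficient ℓ g n := by
      intro n
      rw [fourierCoefficient_add hℓ hf (by fun_prop), fourierCoefficient_const_mul]
    simp only [e] at h
    have := (Complex.hasSum_ofReal (L := .unconditional ℤ)).2 h
    rw [Complex.ofReal_mul, ← intervalIntegral.integral_ofReal] at this
    exact this
  have h1 := key 1
  simp only [one_mul] at h1
  have hs := ((((h1.sub (key (-1))).add ((key Complex.I).mul_left Complex.I)).sub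
    ((key (-Complex.I)).mul_left Complex.I)).mul_left (1 / 4))
  simp only [← star_mul_polarization] at hs
  have ii : ∀ c : ℂ, IntervalIntegrable (fun s => ((‖f s + c * g s‖ ^ 2 : ℝ) : ℂ)) volume 0 ℓ := by
    intro c
    exact Continuous.intervalIntegrable (by fun_prop) _ _
  have i1 := ii 1
  simp only [one_mul] at i1
  have e : (1 / 4 : ℂ) * (((ℓ⁻¹ : ℝ) * ∫ s in (0 : ℝ)..ℓ, ((‖f s + g s‖ ^ 2 : ℝ) : ℂ)) -
      (ℓ⁻¹ : ℝ) * (∫ s in (0 : ℝ)..ℓ, ((‖f s + -1 * g s‖ ^ 2 : ℝ) : ℂ)) +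
      Complex.I * ((ℓ⁻¹ : ℝ) * ∫ s in (0 : ℝ)..ℓ, ((‖f s + Complex.I * g s‖ ^ 2 : ℝ) : ℂ)) -
      Complex.I * ((ℓ⁻¹ : ℝ) * ∫ s in (0 : ℝ)..ℓ, ((‖f s + -Complex.I * g s‖ ^ 2 : ℝ) : ℂ))) =
      (ℓ⁻¹ : ℝ) * ∫ s in (0 : ℝ)..ℓ, f s * star (g s) := by
    simp only [star_mul_polarization, intervalIntegral.integral_const_mul]
    rw [intervalIntegral.integral_sub ((i1.sub (ii _)).add ((ii _).const_mul _))
      ((ii _).const_mul _), intervalIntegral.integral_add (i1.sub (ii _)) ((ii _).const_mul _),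
      intervalIntegral.integral_sub i1 (ii _)]
    simp only [intervalIntegral.integral_const_mul]
    ring
  rw [e] at hs
  rw [HasSum, SummationFilter.unconditional_filter] at hs
  refine hs.comp (tendsto_atTop_finset_of_monotone ?_ ?_)
  · intro a b hab
    refine Finset.Icc_subset_Icc ?_ ?_ <;> omega
  · intro n
    exact ⟨n.natAbs, by rw [Finset.mem_Icc]; omega⟩


/-! ### Cauchy-Riemann type equations on a half strip -/

/-- The partial derivative `∂_r w` of a function of `(r, s)`. -/
noncomputable def partialR (w : ℝ → ℝ → ℂ) (r s : ℝ) : ℂ :=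
  fderiv ℝ (Function.uncurry w) (r, s) (1, 0)

/-- The partial derivative `∂_s w` of a function of `(r, s)`. -/
noncomputable def partialS (w : ℝ → ℝ → ℂ) (r s : ℝ) : ℂ :=
  fderiv ℝ (Function.uncurry w) (r, s) (0, 1)

section partials

variable {w : ℝ → ℝ → ℂ}

lemma contDiff_partialR (hw : ContDiff ℝ ∞ (Function.uncurry w)) :
    ContDiff ℝ ∞ (Function.uncurry (partialR w)) :=
  ((contDiff_infty_iff_fderiv.1 hw).2).clm_apply contDiff_const

lemma contDiff_partialS (hw : ContDiff ℝ ∞ (Function.uncurry w)) :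
    ContDiff ℝ ∞ (Function.uncurry (partialS w)) :=
  ((contDiff_infty_iff_fderiv.1 hw).2).clm_apply contDiff_const

lemma hasDerivAt_partialR (hw : ContDiff ℝ ∞ (Function.uncurry w)) (r s : ℝ) :
    HasDerivAt (fun r => w r s) (partialR w r s) r := by
  have h1 := ((hw.differentiable (by simp)) (r, s)).hasFDerivAt
  have h2 : HasDerivAt (fun r : ℝ => (r, s)) ((1 : ℝ), (0 : ℝ)) r :=
    (hasDerivAt_id r).prodMk (hasDerivAt_const r s)
  exact h1.comp_hasDerivAt r h2

lemma hasDerivAt_partialS (hw : ContDiff ℝ ∞ (Function.uncurry w)) (r s : ℝ) :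
    HasDerivAt (fun s => w r s) (partialS w r s) s := by
  have h1 := ((hw.differentiable (by simp)) (r, s)).hasFDerivAt
  have h2 : HasDerivAt (fun s : ℝ => (r, s)) ((0 : ℝ), (1 : ℝ)) s :=
    (hasDerivAt_const s r).prodMk (hasDerivAt_id s)
  exact h1.comp_hasDerivAt s h2

lemma partialR_partialS (hw : ContDiff ℝ ∞ (Function.uncurry w)) (r s : ℝ) :
    partialR (partialS w) r s = partialS (partialR w) r s := by
  have hs : IsSymmSndFDerivAt ℝ (Function.uncurry w) (r, s) :=
    hw.contDiffAt.isSymmSndFDerivAt (by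
      rw [minSmoothness_of_isRCLikeNormedField]
      exact WithTop.coe_le_coe.2 (le_top : (2 : ℕ∞) ≤ ⊤))
  have hd : DifferentiableAt ℝ (fderiv ℝ (Function.uncurry w)) (r, s) :=
    ((contDiff_infty_iff_fderiv.1 hw).2.differentiable (by simp)) (r, s)
  have e : ∀ v x : ℝ × ℝ, fderiv ℝ (fun x => fderiv ℝ (Function.uncurry w) x v) (r, s) x =
      fderiv ℝ (fderiv ℝ (Function.uncurry w)) (r, s) x v := by
    intro v x
    rw [fderiv_clm_apply hd (differentiableAt_const v)]
    simp
  have h1 : Function.uncurry (partialS w) = fun x => fderiv ℝ (Function.uncurry w) x (0, 1) := rfl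
  have h2 : Function.uncurry (partialR w) = fun x => fderiv ℝ (Function.uncurry w) x (1, 0) := rfl
  rw [partialR, partialS, h1, h2, e, e]
  exact hs _ _

lemma periodic_partialR (hw : ContDiff ℝ ∞ (Function.uncurry w)) {ℓ : ℝ}
    (hp : ∀ r, Function.Periodic (w r) ℓ) (r : ℝ) : Function.Periodic (partialR w r) ℓ := by
  intro s
  have h1 := hasDerivAt_partialR hw r (s + ℓ)
  have h2 : (fun r => w r (s + ℓ)) = fun r => w r s := funext fun r => hp r s
  rw [h2] at h1
  exact h1.unique (hasDerivAt_partialR hw r s)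

end partials

/-- The expression `ϖ ∂_r w + i e ∂_s w`. In tubular coordinates, `σ · ∇` decouples into
expressions of this form, up to terms of order zero. -/
noncomputable def stripOp (e : ℝ) (ϖ : ℝ → ℝ → ℝ) (w : ℝ → ℝ → ℂ) (r s : ℝ) : ℂ :=
  ϖ r s * partialR w r s + Complex.I * e * partialS w r s

/-- The squared `L²`-norm of `f(r, ·)` over a period. -/
noncomputable def sliceSq (ℓ : ℝ) (f : ℝ → ℝ → ℂ) (r : ℝ) : ℝ := ∫ s in (0 : ℝ)..ℓ, ‖f r s‖ ^ 2

lemma continuous_slice {f : ℝ → ℝ → ℂ} (hf : Continuous (Function.uncurry f)) (r : ℝ) :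
    Continuous (f r) := hf.comp (by fun_prop : Continuous fun s => (r, s))

lemma continuous_sliceSq (ℓ : ℝ) {f : ℝ → ℝ → ℂ} (hf : Continuous (Function.uncurry f)) :
    Continuous (sliceSq ℓ f) :=
  intervalIntegral.continuous_parametric_intervalIntegral_of_continuous'
    (f := fun r s => ‖f r s‖ ^ 2) (by exact hf.norm.pow 2) _ _

lemma sliceSq_nonneg {ℓ : ℝ} (hℓ : 0 < ℓ) (f : ℝ → ℝ → ℂ) (r : ℝ) : 0 ≤ sliceSq ℓ f r :=
  intervalIntegral.integral_nonneg hℓ.le fun _ _ => sq_nonneg _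

lemma continuous_stripOp {e : ℝ} {ϖ : ℝ → ℝ → ℝ} {w : ℝ → ℝ → ℂ}
    (hϖ : Continuous (Function.uncurry ϖ)) (hw : ContDiff ℝ ∞ (Function.uncurry w)) :
    Continuous (Function.uncurry (stripOp e ϖ w)) := by
  have h1 := (contDiff_partialR hw).continuous
  have h2 := (contDiff_partialS hw).continuous
  exact ((Complex.continuous_ofReal.comp hϖ).mul h1).add (continuous_const.mul h2)

/-- Integration by parts along the closed curve: the derivative in `r` of `Im ∫ w ∂_s w̄ ds`
involves first derivatives only. -/
lemma hasDerivAt_im_integral {ℓ : ℝ} {w : ℝ → ℝ → ℂ} (hw : ContDiff ℝ ∞ (Function.uncurry w))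
    (hp : ∀ r, Function.Periodic (w r) ℓ) (r : ℝ) :
    HasDerivAt (fun r => (∫ s in (0 : ℝ)..ℓ, w r s * star (partialS w r s)).im)
      (2 * (∫ s in (0 : ℝ)..ℓ, partialR w r s * star (partialS w r s)).im) r := by
  have cR := contDiff_partialR hw
  have cS := contDiff_partialS hw
  have cSR := contDiff_partialS cR
  have c0 := hw.continuous
  have c1 := cR.continuous
  have c2 := cS.continuous
  have c3 := cSR.continuous
  have h := hasDerivAt_intervalIntegral_of_continuous
    (F := fun r s => w r s * star (partialS w r s))
    (F' := fun r s => partialR w r s * star (partialS w r s) +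
      w r s * star (partialS (partialR w) r s)) 0 ℓ (c0.mul c2.star)
    ((c1.mul c2.star).add (c0.mul c3.star)) (fun r s => by
      have h3 := (hasDerivAt_partialR cS r s)
      rw [partialR_partialS hw] at h3
      exact (hasDerivAt_partialR hw r s).mul h3.star) r
  have him := (Complex.imCLM.hasFDerivAt.comp_hasDerivAt r h)
  refine HasDerivAt.congr_deriv him ?_
  have d0 := continuous_slice c0 r
  have d1 := continuous_slice c1 r
  have d2 := continuous_slice c2 r
  have d3 := continuous_slice c3 r
  have ibp : ∫ s in (0 : ℝ)..ℓ, w r s * star (partialS (partialR w) r s) =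
      -∫ s in (0 : ℝ)..ℓ, partialS w r s * star (partialR w r s) := by
    rw [intervalIntegral.integral_mul_deriv_eq_deriv_mul (u := w r)
      (v := fun s => star (partialR w r s)) (fun s _ => hasDerivAt_partialS hw r s)
      (fun s _ => (hasDerivAt_partialS cR r s).star) (d2.intervalIntegrable _ _)
      (d3.star.intervalIntegrable _ _)]
    have e1 : w r ℓ = w r 0 := by simpa using hp r 0
    have e2 : partialR w r ℓ = partialR w r 0 := by simpa using periodic_partialR hw hp r 0
    rw [e1, e2]
    ring
  rw [intervalIntegral.integral_add (by exact (d1.mul d2.star).intervalIntegrable _ _)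
    (by exact (d0.mul d3.star).intervalIntegrable _ _), ibp]
  have ec : ∫ s in (0 : ℝ)..ℓ, partialS w r s * star (partialR w r s) =
      star (∫ s in (0 : ℝ)..ℓ, partialR w r s * star (partialS w r s)) := by
    simp only [intervalIntegral, RCLike.star_def, map_sub, ← integral_conj]
    simp [mul_comm]
  rw [ec]
  simp [two_mul]

lemma norm_sq_stripOp_identity {e ϖ : ℝ} (he : e ^ 2 = 1) (x y : ℂ) :
    ‖(ϖ : ℂ) * x + Complex.I * e * y‖ ^ 2 =
      ϖ ^ 2 * ‖x‖ ^ 2 + ‖y‖ ^ 2 + 2 * ϖ * e * (x * star y).im := by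
  simp only [← Complex.normSq_eq_norm_sq, Complex.normSq_apply]
  simp
  linear_combination (y.im * y.im + y.re * y.re) * he

/-- A weighted elliptic estimate: away from the two ends `r = 0` and `r = δ` of the strip, the
tangential derivative is controlled by `w` and `ϖ ∂_r w + i e ∂_s w`. Expand the square of the latter:
up to the factor `ϖ`, the cross term integrates over a period to the `r`-derivative of
`Im ∫ w ∂_s w̄ ds`, and integration by parts in `r` moves this derivative to the weight, which
vanishes at both ends. -/
lemma weighted_partialS_le {ℓ δ e : ℝ} (hℓ : 0 < ℓ) (hδ : 0 < δ) (he : e ^ 2 = 1)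
    {ϖ : ℝ → ℝ → ℝ} (hϖ : Continuous (Function.uncurry ϖ))
    (hϖ1 : ∀ r ∈ Set.Icc 0 δ, ∀ s, 1 / 2 ≤ ϖ r s) (hϖ2 : ∀ r ∈ Set.Icc 0 δ, ∀ s, ϖ r s ≤ 2)
    {w : ℝ → ℝ → ℂ} (hw : ContDiff ℝ ∞ (Function.uncurry w))
    (hp : ∀ r, Function.Periodic (w r) ℓ) :
    ∫ r in (0 : ℝ)..δ, (r * (δ - r)) ^ 2 * sliceSq ℓ (partialS w) r ≤
      8 * δ ^ 4 * (∫ r in (0 : ℝ)..δ, sliceSq ℓ (stripOp e ϖ w) r) +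
      16 * δ ^ 2 * ∫ r in (0 : ℝ)..δ, sliceSq ℓ w r := by
  have c0 := hw.continuous
  have c1 := (contDiff_partialR hw).continuous
  have c2 := (contDiff_partialS hw).continuous
  have cG := continuous_stripOp (e := e) hϖ hw
  set Φ : ℝ → ℝ := fun r => (∫ s in (0 : ℝ)..ℓ, w r s * star (partialS w r s)).im with hΦ
  set Φ' : ℝ → ℝ := fun r => 2 * (∫ s in (0 : ℝ)..ℓ, partialR w r s * star (partialS w r s)).im
    with hΦ'
  have hd : ∀ r, HasDerivAt Φ (Φ' r) r := hasDerivAt_im_integral hw hp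
  have cΦ : Continuous Φ := continuous_iff_continuousAt.2 fun r => (hd r).continuousAt
  have cΦ' : Continuous Φ' := continuous_const.mul (Complex.continuous_im.comp
    (intervalIntegral.continuous_parametric_intervalIntegral_of_continuous'
      (f := fun r s => partialR w r s * star (partialS w r s)) (c1.mul c2.star) _ _))
  have cSS := continuous_sliceSq ℓ c2
  have cSG := continuous_sliceSq ℓ cG
  have cS0 := continuous_sliceSq ℓ c0
  set q : ℝ → ℝ := fun r => (r * (δ - r)) ^ 2 with hq
  set q' : ℝ → ℝ := fun r => 2 * (r * (δ - r)) * (δ - 2 * r) with hq'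
  have cq : Continuous q := by fun_prop
  have cq' : Continuous q' := by fun_prop
  have hqd : ∀ r, HasDerivAt q (q' r) r := by
    intro r
    have h1 : HasDerivAt (fun r : ℝ => r * (δ - r)) (1 * (δ - r) + r * (0 - 1)) r :=
      (hasDerivAt_id r).mul ((hasDerivAt_const r δ).sub (hasDerivAt_id r))
    refine (h1.pow 2).congr_deriv ?_
    simp only [hq']
    ring
  -- the pointwise identity, integrated over a slice
  have slice1 : ∀ r ∈ Set.Icc 0 δ, sliceSq ℓ (partialS w) r / 2 ≤
      2 * sliceSq ℓ (stripOp e ϖ w) r - e * Φ' r := by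
    intro r hr
    have d1 := continuous_slice c1 r
    have d2 := continuous_slice c2 r
    have dG := continuous_slice cG r
    have e1 : Φ' r = ∫ s in (0 : ℝ)..ℓ, 2 * (partialR w r s * star (partialS w r s)).im := by
      rw [intervalIntegral.integral_const_mul]
      have := Complex.imCLM.intervalIntegral_comp_comm
        (f := fun s => partialR w r s * star (partialS w r s))
        ((d1.mul d2.star).intervalIntegrable (μ := volume) 0 ℓ)
      simp only [Complex.imCLM_apply] at this
      rw [this]
    rw [e1]
    unfold sliceSq
    rw [← intervalIntegral.integral_const_mul, ← intervalIntegral.integral_const_mul,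
      ← intervalIntegral.integral_div, ← intervalIntegral.integral_sub
      (by exact Continuous.intervalIntegrable (by fun_prop) _ _)
      (by exact Continuous.intervalIntegrable (by fun_prop) _ _)]
    refine intervalIntegral.integral_mono_on hℓ.le (Continuous.intervalIntegrable (by fun_prop) _ _)
      (Continuous.intervalIntegrable (by fun_prop) _ _) fun s _ => ?_
    have h1 := hϖ1 r hr s
    have h2 := hϖ2 r hr s
    have id := norm_sq_stripOp_identity (ϖ := ϖ r s) he (partialR w r s) (partialS w r s)
    rw [show (ϖ r s : ℂ) * partialR w r s + Complex.I * e * partialS w r s =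
      stripOp e ϖ w r s from rfl] at id
    set g := ‖stripOp e ϖ w r s‖ ^ 2
    set m := (partialR w r s * star (partialS w r s)).im
    set x := ‖partialR w r s‖ ^ 2
    set y := ‖partialS w r s‖ ^ 2
    have hx : 0 ≤ x := sq_nonneg _
    have hy : 0 ≤ y := sq_nonneg _
    have hg : 0 ≤ g := sq_nonneg _
    -- after division by `ϖ`, with `1/2 ≤ ϖ ≤ 2`
    have h3 : ϖ r s * (y / 2) ≤ ϖ r s * (2 * g - e * (2 * m)) := by
      nlinarith [mul_nonneg (sq_nonneg (ϖ r s)) hx, mul_nonneg hy (sub_nonneg.2 h2),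
        mul_nonneg hg (sub_nonneg.2 h1)]
    exact le_of_mul_le_mul_left h3 (by linarith)
  -- the term without derivative of `w` in `r`, after integration by parts
  have slice2 : ∀ r ∈ Set.Icc 0 δ, e * (q' r * Φ r) ≤
      q r * sliceSq ℓ (partialS w) r / 4 + 4 * δ ^ 2 * sliceSq ℓ w r := by
    intro r hr
    have d0 := continuous_slice c0 r
    have d2 := continuous_slice c2 r
    have e1 : e * (q' r * Φ r) =
        ∫ s in (0 : ℝ)..ℓ, e * q' r * (w r s * star (partialS w r s)).im := by
      rw [intervalIntegral.integral_const_mul]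
      have := Complex.imCLM.intervalIntegral_comp_comm
        (f := fun s => w r s * star (partialS w r s))
        ((d0.mul d2.star).intervalIntegrable (μ := volume) 0 ℓ)
      simp only [Complex.imCLM_apply] at this
      rw [this]
      exact (mul_assoc _ _ _).symm
    rw [e1]
    unfold sliceSq
    rw [← intervalIntegral.integral_const_mul, ← intervalIntegral.integral_const_mul,
      ← intervalIntegral.integral_div, ← intervalIntegral.integral_add
      (by exact Continuous.intervalIntegrable (by fun_prop) _ _)
      (by exact Continuous.intervalIntegrable (by fun_prop) _ _)]
    refine intervalIntegral.integral_mono_on hℓ.le (Continuous.intervalIntegrable (by fun_prop) _ _)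
      (Continuous.intervalIntegrable (by fun_prop) _ _) fun s _ => ?_
    have h1 : |(w r s * star (partialS w r s)).im| ≤ ‖w r s‖ * ‖partialS w r s‖ := by
      refine (Complex.abs_im_le_norm _).trans ?_
      rw [norm_mul, norm_star]
    have h2 : |e * q' r| ≤ 2 * δ * (r * (δ - r)) := by
      have he1 : |e| = 1 := by
        rcases sq_eq_one_iff.1 he with h | h <;> simp [h]
      have hr0 : 0 ≤ r * (δ - r) := mul_nonneg hr.1 (sub_nonneg.2 hr.2)
      have h3 : |δ - 2 * r| ≤ δ := abs_le.2 ⟨by linarith [hr.2], by linarith [hr.1]⟩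
      rw [abs_mul, he1, one_mul, hq']
      simp only
      rw [abs_mul, abs_of_nonneg (by positivity : (0 : ℝ) ≤ 2 * (r * (δ - r)))]
      nlinarith
    have h4 : e * q' r * (w r s * star (partialS w r s)).im ≤
        2 * δ * (r * (δ - r)) * (‖w r s‖ * ‖partialS w r s‖) := by
      refine (le_abs_self _).trans ?_
      rw [abs_mul]
      exact mul_le_mul h2 h1 (abs_nonneg _) ((abs_nonneg _).trans h2)
    refine h4.trans ?_
    simp only [hq]
    nlinarith [sq_nonneg (r * (δ - r) * ‖partialS w r s‖ / 2 - 2 * δ * ‖w r s‖)]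
  -- integration in `r`
  have ibp : ∫ r in (0 : ℝ)..δ, q r * Φ' r = -∫ r in (0 : ℝ)..δ, q' r * Φ r := by
    rw [intervalIntegral.integral_mul_deriv_eq_deriv_mul (fun r _ => hqd r) (fun r _ => hd r)
      (cq'.intervalIntegrable _ _) (cΦ'.intervalIntegrable _ _)]
    simp [hq]
  have int1 : ∫ r in (0 : ℝ)..δ, q r * sliceSq ℓ (partialS w) r / 2 ≤
      ∫ r in (0 : ℝ)..δ, (2 * δ ^ 4 * sliceSq ℓ (stripOp e ϖ w) r - e * (q r * Φ' r)) := by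
    refine intervalIntegral.integral_mono_on hδ.le (Continuous.intervalIntegrable (by fun_prop) _ _)
      (Continuous.intervalIntegrable (by fun_prop) _ _) fun r hr => ?_
    have h1 := mul_le_mul_of_nonneg_left (slice1 r hr) (sq_nonneg (r * (δ - r)))
    have h2 : (r * (δ - r)) ^ 2 ≤ δ ^ 4 := by
      have h3 : 0 ≤ r * (δ - r) := mul_nonneg hr.1 (sub_nonneg.2 hr.2)
      have h4 : r * (δ - r) ≤ δ ^ 2 := by nlinarith [hr.1, hr.2]
      calc (r * (δ - r)) ^ 2 ≤ (δ ^ 2) ^ 2 := pow_le_pow_left₀ h3 h4 2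
        _ = δ ^ 4 := by ring
    have h5 := mul_le_mul_of_nonneg_right h2 (sliceSq_nonneg hℓ (stripOp e ϖ w) r)
    simp only [hq]
    nlinarith
  have int2 : ∫ r in (0 : ℝ)..δ, e * (q' r * Φ r) ≤
      ∫ r in (0 : ℝ)..δ, (q r * sliceSq ℓ (partialS w) r / 4 + 4 * δ ^ 2 * sliceSq ℓ w r) :=
    intervalIntegral.integral_mono_on hδ.le (Continuous.intervalIntegrable (by fun_prop) _ _)
      (Continuous.intervalIntegrable (by fun_prop) _ _) slice2
  rw [intervalIntegral.integral_sub (Continuous.intervalIntegrable (by fun_prop) _ _)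
    (Continuous.intervalIntegrable (by fun_prop) _ _), intervalIntegral.integral_const_mul,
    intervalIntegral.integral_const_mul, ibp, intervalIntegral.integral_div] at int1
  rw [intervalIntegral.integral_add (Continuous.intervalIntegrable (by fun_prop) _ _)
    (Continuous.intervalIntegrable (by fun_prop) _ _), intervalIntegral.integral_const_mul,
    intervalIntegral.integral_const_mul, intervalIntegral.integral_div] at int2
  simp only [hq] at int1 int2 ⊢
  nlinarith


/-- The remainder of `∂_r w` after the constant-coefficient tangential part has been removed. The
weight `δ - r` is needed because the elliptic estimate degenerates at `r = δ`; at `r = 0` the factor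
`r` in `|ϖ - 1| ≤ K r` plays the same role. -/
lemma weighted_remainder_le {ℓ δ e K : ℝ} (hℓ : 0 < ℓ) (hδ : 0 < δ) (he : e ^ 2 = 1)
    {ϖ : ℝ → ℝ → ℝ} (hϖ : Continuous (Function.uncurry ϖ))
    (hϖ1 : ∀ r ∈ Set.Icc 0 δ, ∀ s, 1 / 2 ≤ ϖ r s) (hϖ2 : ∀ r ∈ Set.Icc 0 δ, ∀ s, ϖ r s ≤ 2)
    (hK : ∀ r ∈ Set.Icc 0 δ, ∀ s, |ϖ r s - 1| ≤ K * r)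
    {w : ℝ → ℝ → ℂ} (hw : ContDiff ℝ ∞ (Function.uncurry w))
    (hp : ∀ r, Function.Periodic (w r) ℓ) :
    ∫ r in (0 : ℝ)..δ, sliceSq ℓ (fun r s =>
        ((δ - r : ℝ) : ℂ) * (partialR w r s + Complex.I * e * partialS w r s)) r ≤
      (8 * δ ^ 2 + 64 * K ^ 2 * δ ^ 4) * (∫ r in (0 : ℝ)..δ, sliceSq ℓ (stripOp e ϖ w) r) +
      128 * K ^ 2 * δ ^ 2 * ∫ r in (0 : ℝ)..δ, sliceSq ℓ w r := by
  have c1 := (contDiff_partialR hw).continuous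
  have c2 := (contDiff_partialS hw).continuous
  have cG := continuous_stripOp (e := e) hϖ hw
  have cT : Continuous (Function.uncurry fun r s =>
      ((δ - r : ℝ) : ℂ) * (partialR w r s + Complex.I * e * partialS w r s)) := by
    refine Continuous.mul ?_ (c1.add (continuous_const.mul c2))
    fun_prop
  have cSS := continuous_sliceSq ℓ c2
  have cSG := continuous_sliceSq ℓ cG
  have cST := continuous_sliceSq ℓ cT
  have he1 : |e| = 1 := by
    rcases sq_eq_one_iff.1 he with h | h <;> simp [h]
  have hslice : ∀ r ∈ Set.Icc 0 δ, sliceSq ℓ (fun r s =>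
      ((δ - r : ℝ) : ℂ) * (partialR w r s + Complex.I * e * partialS w r s)) r ≤
      8 * δ ^ 2 * sliceSq ℓ (stripOp e ϖ w) r +
        8 * K ^ 2 * ((r * (δ - r)) ^ 2 * sliceSq ℓ (partialS w) r) := by
    intro r hr
    have d1 := continuous_slice c1 r
    have d2 := continuous_slice c2 r
    have dG := continuous_slice cG r
    unfold sliceSq
    rw [← intervalIntegral.integral_const_mul, ← intervalIntegral.integral_const_mul,
      ← intervalIntegral.integral_const_mul, ← intervalIntegral.integral_add
      (by exact Continuous.intervalIntegrable (by fun_prop) _ _)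
      (by exact Continuous.intervalIntegrable (by fun_prop) _ _)]
    refine intervalIntegral.integral_mono_on hℓ.le (Continuous.intervalIntegrable (by fun_prop) _ _)
      (Continuous.intervalIntegrable (by fun_prop) _ _) fun s _ => ?_
    have h1 := hϖ1 r hr s
    have h2 := hK r hr s
    have hr1 : 0 ≤ δ - r := sub_nonneg.2 hr.2
    -- `ϖ (∂_r w + i e ∂_s w) = (ϖ ∂_r w + i e ∂_s w) + i e (ϖ - 1) ∂_s w`
    have id : (ϖ r s : ℂ) * (partialR w r s + Complex.I * e * partialS w r s) =
        stripOp e ϖ w r s + Complex.I * e * ((ϖ r s - 1 : ℝ) : ℂ) * partialS w r s := by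
      simp only [stripOp]
      push_cast
      ring
    have hn : ϖ r s * ‖partialR w r s + Complex.I * e * partialS w r s‖ ≤
        ‖stripOp e ϖ w r s‖ + K * r * ‖partialS w r s‖ := by
      have e1 : ϖ r s * ‖partialR w r s + Complex.I * e * partialS w r s‖ =
          ‖(ϖ r s : ℂ) * (partialR w r s + Complex.I * e * partialS w r s)‖ := by
        rw [norm_mul, Complex.norm_real, Real.norm_of_nonneg (by linarith)]
      rw [e1, id]
      refine (norm_add_le _ _).trans (add_le_add le_rfl ?_)
      rw [norm_mul, norm_mul, norm_mul, Complex.norm_I, Complex.norm_real, Complex.norm_real,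
        Real.norm_eq_abs, Real.norm_eq_abs, he1, one_mul, one_mul]
      exact mul_le_mul_of_nonneg_right h2 (norm_nonneg _)
    rw [norm_mul, Complex.norm_real, Real.norm_of_nonneg hr1]
    set x := ‖partialR w r s + Complex.I * e * partialS w r s‖
    set g := ‖stripOp e ϖ w r s‖
    set y := ‖partialS w r s‖
    have hx : 0 ≤ x := norm_nonneg _
    have hg : 0 ≤ g := norm_nonneg _
    have hy : 0 ≤ y := norm_nonneg _
    have hx2 : x ≤ 2 * g + 2 * (K * r * y) := by nlinarith
    have hx3 : x ^ 2 ≤ 8 * g ^ 2 + 8 * (K * r * y) ^ 2 := by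
      have := pow_le_pow_left₀ hx hx2 2
      nlinarith [sq_nonneg (g - K * r * y)]
    have hx4 := mul_le_mul_of_nonneg_left hx3 (sq_nonneg (δ - r))
    have hx5 : (δ - r) ^ 2 ≤ δ ^ 2 := pow_le_pow_left₀ hr1 (by linarith [hr.1]) 2
    have hx6 := mul_le_mul_of_nonneg_right hx5 (sq_nonneg g)
    calc ((δ - r) * x) ^ 2 = (δ - r) ^ 2 * x ^ 2 := by ring
      _ ≤ (δ - r) ^ 2 * (8 * g ^ 2 + 8 * (K * r * y) ^ 2) := hx4
      _ = 8 * ((δ - r) ^ 2 * g ^ 2) + 8 * K ^ 2 * ((r * (δ - r)) ^ 2 * y ^ 2) := by ring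
      _ ≤ 8 * (δ ^ 2 * g ^ 2) + 8 * K ^ 2 * ((r * (δ - r)) ^ 2 * y ^ 2) := by linarith
      _ = _ := by ring
  have hint := intervalIntegral.integral_mono_on hδ.le
    (Continuous.intervalIntegrable (μ := volume) (by fun_prop) _ _)
    (Continuous.intervalIntegrable (by fun_prop) _ _) hslice
  rw [intervalIntegral.integral_add (Continuous.intervalIntegrable (by fun_prop) _ _)
    (Continuous.intervalIntegrable (by fun_prop) _ _), intervalIntegral.integral_const_mul,
    intervalIntegral.integral_const_mul] at hint
  have hW := mul_le_mul_of_nonneg_left (weighted_partialS_le hℓ hδ he hϖ hϖ1 hϖ2 hw hp)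
    (by positivity : (0 : ℝ) ≤ 8 * K ^ 2)
  nlinarith

/-- The tangential parts cancel: if `∂_r w = -i e ∂_s w + T` and `∂_r z = i e ∂_s z + T'`, then
the derivative in `r` of the truncated pairing of `w` and `z` involves `T` and `T'` only. -/
lemma hasDerivAt_truncPairing {ℓ e : ℝ} (hℓ : 0 < ℓ) {w z : ℝ → ℝ → ℂ}
    (hw : ContDiff ℝ ∞ (Function.uncurry w)) (hwp : ∀ r, Function.Periodic (w r) ℓ)
    (hz : ContDiff ℝ ∞ (Function.uncurry z)) (hzp : ∀ r, Function.Periodic (z r) ℓ)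
    (N : ℕ) (r : ℝ) :
    HasDerivAt (fun r => truncPairing N (fourierCoefficient ℓ (w r)) (fourierCoefficient ℓ (z r)))
      (truncPairing N
          (fourierCoefficient ℓ fun s => partialR w r s + Complex.I * e * partialS w r s)
          (fourierCoefficient ℓ (z r)) +
        truncPairing N (fourierCoefficient ℓ (w r))
          (fourierCoefficient ℓ
            fun s => partialR z r s + Complex.I * (-e : ℝ) * partialS z r s)) r := by
  have hd : ∀ {y : ℝ → ℝ → ℂ}, ContDiff ℝ ∞ (Function.uncurry y) → ∀ n,
      HasDerivAt (fun r => fourierCoefficient ℓ (y r) n)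
        (fourierCoefficient ℓ (partialR y r) n) r := fun hy n =>
    fourierCoefficient_hasDerivAt hℓ hy.continuous (contDiff_partialR hy).continuous
      (fun r s => hasDerivAt_partialR hy r s) n r
  have hc : ∀ (c : ℝ) {y : ℝ → ℝ → ℂ}, ContDiff ℝ ∞ (Function.uncurry y) →
      (∀ r, Function.Periodic (y r) ℓ) → ∀ n,
      fourierCoefficient ℓ (fun s => partialR y r s + Complex.I * c * partialS y r s) n =
        fourierCoefficient ℓ (partialR y r) n - (2 * Real.pi * n / ℓ : ℝ) * c *
          fourierCoefficient ℓ (y r) n := by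
    intro c y hy hyp n
    have d1 := continuous_slice (contDiff_partialR hy).continuous r
    have d2 := continuous_slice (contDiff_partialS hy).continuous r
    rw [fourierCoefficient_add hℓ d1 (by fun_prop), fourierCoefficient_const_mul,
      fourierCoefficient_deriv hℓ (fun s => hasDerivAt_partialS hy r s) d2
      (by simpa using hyp r 0)]
    push_cast
    linear_combination (2 * Real.pi * n / ℓ * c * fourierCoefficient ℓ (y r) n) * Complex.I_mul_I
  unfold truncPairing
  rw [← Finset.sum_add_distrib]
  refine HasDerivAt.fun_sum fun n _ => ?_
  refine ((hd hw n).mul (hd hz n).star).congr_deriv ?_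
  rw [hc e hw hwp, hc (-e) hz hzp, star_sub, star_mul', star_mul', RCLike.star_def,
    Complex.conj_ofReal, Complex.conj_ofReal]
  push_cast
  ring

/-- The key estimate: for two functions that satisfy conjugate equations on a half strip, the
truncated pairing of the boundary values is bounded uniformly in the order of truncation. -/
lemma norm_truncPairing_boundary_le {ℓ δ e K : ℝ} (hℓ : 0 < ℓ) (hδ : 0 < δ) (he : e ^ 2 = 1)
    {ϖ : ℝ → ℝ → ℝ} (hϖ : Continuous (Function.uncurry ϖ))
    (hϖ1 : ∀ r ∈ Set.Icc 0 δ, ∀ s, 1 / 2 ≤ ϖ r s) (hϖ2 : ∀ r ∈ Set.Icc 0 δ, ∀ s, ϖ r s ≤ 2)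
    (hK : ∀ r ∈ Set.Icc 0 δ, ∀ s, |ϖ r s - 1| ≤ K * r) :
    ∃ C : ℝ, 0 ≤ C ∧ ∀ w z : ℝ → ℝ → ℂ, ContDiff ℝ ∞ (Function.uncurry w) →
      (∀ r, Function.Periodic (w r) ℓ) → ContDiff ℝ ∞ (Function.uncurry z) →
      (∀ r, Function.Periodic (z r) ℓ) → ∀ N : ℕ,
      ‖truncPairing N (fourierCoefficient ℓ (w 0)) (fourierCoefficient ℓ (z 0))‖ ≤
        C * ((∫ r in (0 : ℝ)..δ, sliceSq ℓ w r) + (∫ r in (0 : ℝ)..δ, sliceSq ℓ z r) +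
          (∫ r in (0 : ℝ)..δ, sliceSq ℓ (stripOp e ϖ w) r) +
          ∫ r in (0 : ℝ)..δ, sliceSq ℓ (stripOp (-e) ϖ z) r) := by
  set A := 8 * δ ^ 2 + 64 * K ^ 2 * δ ^ 4 with hA
  set B := 128 * K ^ 2 * δ ^ 2 with hB
  have hA0 : 0 ≤ A := by positivity
  have hB0 : 0 ≤ B := by positivity
  refine ⟨δ⁻¹ * (ℓ⁻¹ * (2 + A + B)), by positivity, fun w z hw hwp hz hzp N => ?_⟩
  have cw := hw.continuous
  have cz := hz.continuous
  set T : ℝ → ℝ → ℂ := fun r s =>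
    ((δ - r : ℝ) : ℂ) * (partialR w r s + Complex.I * e * partialS w r s) with hT
  set T' : ℝ → ℝ → ℂ := fun r s =>
    ((δ - r : ℝ) : ℂ) * (partialR z r s + Complex.I * (-e : ℝ) * partialS z r s) with hT'
  have c1 := (contDiff_partialR hw).continuous
  have c2 := (contDiff_partialS hw).continuous
  have c3 := (contDiff_partialR hz).continuous
  have c4 := (contDiff_partialS hz).continuous
  have cr : Continuous (fun x : ℝ × ℝ => ((δ - x.1 : ℝ) : ℂ)) := by fun_prop
  have cT : Continuous (Function.uncurry T) := cr.mul (c1.add (continuous_const.mul c2))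
  have cT' : Continuous (Function.uncurry T') := cr.mul (c3.add (continuous_const.mul c4))
  -- `F` vanishes at `r = δ`, and `F 0` is `δ` times the pairing of the boundary values
  set F : ℝ → ℂ := fun r => ((δ - r : ℝ) : ℂ) *
    truncPairing N (fourierCoefficient ℓ (w r)) (fourierCoefficient ℓ (z r)) with hF
  set F' : ℝ → ℂ := fun r =>
    -truncPairing N (fourierCoefficient ℓ (w r)) (fourierCoefficient ℓ (z r)) +
      (truncPairing N (fourierCoefficient ℓ (T r)) (fourierCoefficient ℓ (z r)) +
        truncPairing N (fourierCoefficient ℓ (w r)) (fourierCoefficient ℓ (T' r))) with hF'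
  have hmul : ∀ (c : ℝ) (a b : ℤ → ℂ), (c : ℂ) * truncPairing N a b =
      truncPairing N (fun n => c * a n) b ∧ (c : ℂ) * truncPairing N a b =
      truncPairing N a (fun n => c * b n) := by
    intro c a b
    unfold truncPairing
    rw [Finset.mul_sum]
    refine ⟨Finset.sum_congr rfl fun n _ => by ring, Finset.sum_congr rfl fun n _ => ?_⟩
    rw [star_mul', RCLike.star_def, Complex.conj_ofReal]
    ring
  have hd : ∀ r, HasDerivAt F (F' r) r := by
    intro r
    have h1 : HasDerivAt (fun r : ℝ => ((δ - r : ℝ) : ℂ)) (-1) r := by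
      have := ((hasDerivAt_const r δ).sub (hasDerivAt_id r)).ofReal_comp
      simpa using this
    refine (h1.mul (hasDerivAt_truncPairing (e := e) hℓ hw hwp hz hzp N r)).congr_deriv ?_
    simp only [hF', hT, hT']
    rw [mul_add, (hmul _ _ _).1, (hmul _ _ (fourierCoefficient ℓ fun s => partialR z r s + _)).2]
    simp only [← fourierCoefficient_const_mul]
    ring
  have hcont : ∀ {f g : ℝ → ℝ → ℂ}, Continuous (Function.uncurry f) →
      Continuous (Function.uncurry g) → Continuous fun r =>
        truncPairing N (fourierCoefficient ℓ (f r)) (fourierCoefficient ℓ (g r)) := by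
    intro f g hf hg
    unfold truncPairing
    exact continuous_finsetSum _ fun n _ =>
      (continuous_fourierCoefficient hℓ hf n).mul (continuous_fourierCoefficient hℓ hg n).star
  have cF' : Continuous F' :=
    (hcont cw cz).neg.add ((hcont cT cz).add (hcont cw cT'))
  have hFTC : (δ : ℂ) * truncPairing N (fourierCoefficient ℓ (w 0)) (fourierCoefficient ℓ (z 0)) =
      -∫ r in (0 : ℝ)..δ, F' r := by
    rw [intervalIntegral.integral_eq_sub_of_hasDerivAt (fun r _ => hd r)
      (cF'.intervalIntegrable _ _)]
    simp [hF]
  have s1 := continuous_sliceSq ℓ cw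
  have s2 := continuous_sliceSq ℓ cz
  have s3 := continuous_sliceSq ℓ cT
  have s4 := continuous_sliceSq ℓ cT'
  have hbound : ‖∫ r in (0 : ℝ)..δ, F' r‖ ≤ ∫ r in (0 : ℝ)..δ,
      ℓ⁻¹ * (2 * sliceSq ℓ w r + 2 * sliceSq ℓ z r + sliceSq ℓ T r + sliceSq ℓ T' r) := by
    refine (intervalIntegral.norm_integral_le_integral_norm hδ.le).trans ?_
    refine intervalIntegral.integral_mono_on hδ.le (cF'.norm.intervalIntegrable _ _)
      (Continuous.intervalIntegrable (by fun_prop) _ _) fun r _ => ?_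
    have b1 := norm_truncPairing_le hℓ (continuous_slice cw r) (continuous_slice cz r) N
    have b2 := norm_truncPairing_le hℓ (continuous_slice cT r) (continuous_slice cz r) N
    have b3 := norm_truncPairing_le hℓ (continuous_slice cw r) (continuous_slice cT' r) N
    refine (norm_add_le _ _).trans ?_
    rw [norm_neg]
    refine (add_le_add b1 ((norm_add_le _ _).trans (add_le_add b2 b3))).trans (le_of_eq ?_)
    simp only [sliceSq]
    ring
  have hsplit : (∫ r in (0 : ℝ)..δ,
      ℓ⁻¹ * (2 * sliceSq ℓ w r + 2 * sliceSq ℓ z r + sliceSq ℓ T r + sliceSq ℓ T' r)) =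
      ℓ⁻¹ * (2 * (∫ r in (0 : ℝ)..δ, sliceSq ℓ w r) + 2 * (∫ r in (0 : ℝ)..δ, sliceSq ℓ z r) +
        (∫ r in (0 : ℝ)..δ, sliceSq ℓ T r) + ∫ r in (0 : ℝ)..δ, sliceSq ℓ T' r) := by
    have i1 : IntervalIntegrable (sliceSq ℓ T) volume 0 δ := s3.intervalIntegrable _ _
    have i2 : IntervalIntegrable (sliceSq ℓ T') volume 0 δ := s4.intervalIntegrable _ _
    have i3 : IntervalIntegrable (fun r => 2 * sliceSq ℓ w r) volume 0 δ :=
      (s1.const_mul 2).intervalIntegrable _ _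
    have i4 : IntervalIntegrable (fun r => 2 * sliceSq ℓ z r) volume 0 δ :=
      (s2.const_mul 2).intervalIntegrable _ _
    rw [intervalIntegral.integral_const_mul, intervalIntegral.integral_add ((i3.add i4).add i1) i2,
      intervalIntegral.integral_add (i3.add i4) i1, intervalIntegral.integral_add i3 i4,
      intervalIntegral.integral_const_mul, intervalIntegral.integral_const_mul]
  rw [hsplit] at hbound
  have rw1 := weighted_remainder_le hℓ hδ he hϖ hϖ1 hϖ2 hK hw hwp
  have rw2 := weighted_remainder_le (e := -e) hℓ hδ (by rwa [neg_sq]) hϖ hϖ1 hϖ2 hK hz hzp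
  have nn : ∀ f : ℝ → ℝ → ℂ, 0 ≤ ∫ r in (0 : ℝ)..δ, sliceSq ℓ f r := fun f =>
    intervalIntegral.integral_nonneg hδ.le fun r _ => sliceSq_nonneg hℓ f r
  have n1 := nn w
  have n2 := nn z
  have n3 := nn (stripOp e ϖ w)
  have n4 := nn (stripOp (-e) ϖ z)
  have hnorm : δ * ‖truncPairing N (fourierCoefficient ℓ (w 0)) (fourierCoefficient ℓ (z 0))‖ =
      ‖∫ r in (0 : ℝ)..δ, F' r‖ := by
    rw [← norm_neg (∫ r in (0 : ℝ)..δ, F' r), ← hFTC, norm_mul, Complex.norm_real,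
      Real.norm_of_nonneg hδ.le]
  rw [← hnorm] at hbound
  rw [mul_assoc, le_inv_mul_iff₀ hδ, mul_assoc]
  refine hbound.trans (mul_le_mul_of_nonneg_left ?_ (by positivity))
  nlinarith [mul_nonneg hA0 n1, mul_nonneg hA0 n2, mul_nonneg hB0 n1, mul_nonneg hB0 n2,
    mul_nonneg hA0 n3, mul_nonneg hA0 n4, mul_nonneg hB0 n3, mul_nonneg hB0 n4]


/-! ### Tubular coordinates around the boundary curve -/

lemma Shell.contDiff_deriv (S : Shell) : ContDiff ℝ ∞ (deriv S.γ) :=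
  (contDiff_infty_iff_deriv.1 S.smooth).2

lemma Shell.contDiff_deriv2 (S : Shell) : ContDiff ℝ ∞ (deriv (deriv S.γ)) :=
  (contDiff_infty_iff_deriv.1 S.contDiff_deriv).2

lemma contDiff_coord {f : ℝ → Plane} (hf : ContDiff ℝ ∞ f) (j : Fin 2) :
    ContDiff ℝ ∞ fun s => f s j :=
  (EuclideanSpace.proj (𝕜 := ℝ) j : Plane →L[ℝ] ℝ).contDiff.comp hf

lemma hasDerivAt_coord {f : ℝ → Plane} (hf : ContDiff ℝ ∞ f) (j : Fin 2) (s : ℝ) :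
    HasDerivAt (fun s => f s j) (deriv f s j) s :=
  (EuclideanSpace.proj (𝕜 := ℝ) j : Plane →L[ℝ] ℝ).hasFDerivAt.comp_hasDerivAt s
    ((hf.differentiable (by simp)) s).hasDerivAt

lemma Shell.periodic_deriv (S : Shell) : Function.Periodic (deriv S.γ) S.ℓ := by
  intro s
  rw [← deriv_comp_add_const]
  congr 1
  funext x
  exact S.periodic x

lemma Shell.periodic_deriv2 (S : Shell) : Function.Periodic (deriv (deriv S.γ)) S.ℓ := by
  intro s
  rw [← deriv_comp_add_const]
  congr 1
  funext x
  exact S.periodic_deriv x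

lemma Shell.deriv_sq_add_sq (S : Shell) (s : ℝ) : deriv S.γ s 0 ^ 2 + deriv S.γ s 1 ^ 2 = 1 := by
  have h := S.unitSpeed s
  rw [EuclideanSpace.norm_eq, Real.sqrt_eq_one] at h
  simpa [Fin.sum_univ_two] using h

/-- The outer unit normal `ν = (γ₂', -γ₁')`. -/
noncomputable def Shell.nu (S : Shell) (s : ℝ) : Plane := !₂[deriv S.γ s 1, -deriv S.γ s 0]

/-- The signed curvature `κ = γ₁' γ₂'' - γ₂' γ₁''`; thus `ν' = κ γ'`. -/
noncomputable def Shell.curv (S : Shell) (s : ℝ) : ℝ :=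
  deriv S.γ s 0 * deriv (deriv S.γ) s 1 - deriv S.γ s 1 * deriv (deriv S.γ) s 0

lemma Shell.contDiff_curv (S : Shell) : ContDiff ℝ ∞ S.curv :=
  ((contDiff_coord S.contDiff_deriv 0).mul (contDiff_coord S.contDiff_deriv2 1)).sub
    ((contDiff_coord S.contDiff_deriv 1).mul (contDiff_coord S.contDiff_deriv2 0))

lemma Shell.periodic_curv (S : Shell) : Function.Periodic S.curv S.ℓ := by
  intro s
  simp only [Shell.curv, S.periodic_deriv s, S.periodic_deriv2 s]

/-- The Frenet equation `γ'' = -κ ν`, in coordinates. -/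
lemma Shell.deriv2_eq (S : Shell) (s : ℝ) :
    deriv (deriv S.γ) s 0 = -S.curv s * deriv S.γ s 1 ∧
      deriv (deriv S.γ) s 1 = S.curv s * deriv S.γ s 0 := by
  have h1 := S.deriv_sq_add_sq s
  have h2 : deriv S.γ s 0 * deriv (deriv S.γ) s 0 + deriv S.γ s 1 * deriv (deriv S.γ) s 1 = 0 := by
    have hd := ((hasDerivAt_coord S.contDiff_deriv 0 s).pow 2).add
      ((hasDerivAt_coord S.contDiff_deriv 1 s).pow 2)
    have hc : (fun s => deriv S.γ s 0) ^ 2 + (fun s => deriv S.γ s 1) ^ 2 = fun _ => (1 : ℝ) :=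
      funext S.deriv_sq_add_sq
    rw [hc] at hd
    have := hd.unique (hasDerivAt_const s (1 : ℝ))
    simp at this
    linarith
  unfold Shell.curv
  constructor
  · linear_combination (-deriv (deriv S.γ) s 0) * h1 + deriv S.γ s 0 * h2
  · linear_combination (-deriv (deriv S.γ) s 1) * h1 + deriv S.γ s 1 * h2

/-- Tubular coordinates: `(p, s) ↦ γ(s) + p ν(s)`. -/
noncomputable def Shell.tube (S : Shell) (x : ℝ × ℝ) : Plane := S.γ x.2 + x.1 • S.nu x.2

lemma Shell.tube_zero (S : Shell) (s : ℝ) : S.tube (0, s) = S.γ s := by simp [Shell.tube]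

lemma Shell.tube_apply_zero (S : Shell) (x : ℝ × ℝ) :
    S.tube x 0 = S.γ x.2 0 + x.1 * deriv S.γ x.2 1 := by simp [Shell.tube, Shell.nu]

lemma Shell.tube_apply_one (S : Shell) (x : ℝ × ℝ) :
    S.tube x 1 = S.γ x.2 1 + x.1 * -deriv S.γ x.2 0 := by simp [Shell.tube, Shell.nu]

lemma Shell.contDiff_tube (S : Shell) : ContDiff ℝ ∞ S.tube := by
  rw [contDiff_euclidean]
  intro j
  have h1 := (contDiff_coord S.smooth j).comp (contDiff_snd (𝕜 := ℝ) (E := ℝ) (F := ℝ))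
  have h2 := (contDiff_coord S.contDiff_deriv 0).comp (contDiff_snd (𝕜 := ℝ) (E := ℝ) (F := ℝ))
  have h3 := (contDiff_coord S.contDiff_deriv 1).comp (contDiff_snd (𝕜 := ℝ) (E := ℝ) (F := ℝ))
  fin_cases j
  · simp only [Fin.zero_eta, Shell.tube_apply_zero]
    exact h1.add (contDiff_fst.mul h3)
  · simp only [Fin.mk_one, Shell.tube_apply_one]
    exact h1.add (contDiff_fst.mul h2.neg)

lemma Shell.periodic_tube (S : Shell) (p : ℝ) :
    Function.Periodic (fun s => S.tube (p, s)) S.ℓ := by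
  intro s
  simp only [Shell.tube, Shell.nu, S.periodic s, S.periodic_deriv s]

/-- The identification of the plane with `ℝ × ℝ`. -/
noncomputable def planeEquiv : Plane ≃L[ℝ] ℝ × ℝ :=
  (EuclideanSpace.equiv (Fin 2) ℝ).trans (ContinuousLinearEquiv.finTwoArrow ℝ ℝ)

lemma planeEquiv_apply (x : Plane) : planeEquiv x = (x 0, x 1) := rfl

lemma measurePreserving_planeEquiv : MeasurePreserving planeEquiv :=
  (volume_preserving_finTwoArrow ℝ).comp (PiLp.volume_preserving_ofLp (Fin 2))

/-- The derivative of the tubular coordinates, with values in `ℝ × ℝ`. -/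
noncomputable def Shell.tubeDeriv (S : Shell) (x : ℝ × ℝ) : ℝ × ℝ →L[ℝ] ℝ × ℝ :=
  (Matrix.toLin (.finTwoProd ℝ) (.finTwoProd ℝ)
    !![deriv S.γ x.2 1, (1 + x.1 * S.curv x.2) * deriv S.γ x.2 0;
       -deriv S.γ x.2 0, (1 + x.1 * S.curv x.2) * deriv S.γ x.2 1]).toContinuousLinearMap

lemma Shell.det_tubeDeriv (S : Shell) (x : ℝ × ℝ) :
    (S.tubeDeriv x).det = 1 + x.1 * S.curv x.2 := by
  unfold Shell.tubeDeriv
  simp only [LinearMap.det_toContinuousLinearMap, LinearMap.det_toLin, Matrix.det_fin_two_of]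
  linear_combination (1 + x.1 * S.curv x.2) * S.deriv_sq_add_sq x.2

lemma Shell.hasFDerivAt_tube (S : Shell) (x : ℝ × ℝ) :
    HasFDerivAt (fun x => planeEquiv (S.tube x)) (S.tubeDeriv x) x := by
  have e : (fun x => planeEquiv (S.tube x)) = fun x : ℝ × ℝ =>
      (S.γ x.2 0 + x.1 * deriv S.γ x.2 1, S.γ x.2 1 + x.1 * -deriv S.γ x.2 0) := by
    funext x
    rw [planeEquiv_apply, S.tube_apply_zero, S.tube_apply_one]
  rw [e]
  unfold Shell.tubeDeriv
  rw [Matrix.toLin_finTwoProd_toContinuousLinearMap]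
  have hs : HasFDerivAt (fun x : ℝ × ℝ => x.2) (ContinuousLinearMap.snd ℝ ℝ ℝ) x := hasFDerivAt_snd
  have hf : HasFDerivAt (fun x : ℝ × ℝ => x.1) (ContinuousLinearMap.fst ℝ ℝ ℝ) x := hasFDerivAt_fst
  have g0 := (hasDerivAt_coord S.smooth 0 x.2).comp_hasFDerivAt x hs
  have g1 := (hasDerivAt_coord S.smooth 1 x.2).comp_hasFDerivAt x hs
  have d0 := (hasDerivAt_coord S.contDiff_deriv 0 x.2).comp_hasFDerivAt x hs
  have d1 := (hasDerivAt_coord S.contDiff_deriv 1 x.2).comp_hasFDerivAt x hs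
  obtain ⟨f0, f1⟩ := S.deriv2_eq x.2
  refine ((g0.add (hf.mul d1)).prodMk (g1.add (hf.mul d0.neg))).congr_fderiv ?_
  ext <;> simp [f0, f1] <;> ring

lemma Shell.fderiv_tube (S : Shell) (x : ℝ × ℝ) :
    fderiv ℝ S.tube x (1, 0) = S.nu x.2 ∧
      fderiv ℝ S.tube x (0, 1) = (1 + x.1 * S.curv x.2) • deriv S.γ x.2 := by
  have h1 : HasFDerivAt S.tube (fderiv ℝ S.tube x) x :=
    (S.contDiff_tube.differentiable (by simp) x).hasFDerivAt
  have h2 := (planeEquiv.toContinuousLinearMap.hasFDerivAt.comp x h1).unique (S.hasFDerivAt_tube x)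
  have h3 : ∀ v, planeEquiv (fderiv ℝ S.tube x v) = S.tubeDeriv x v := fun v => by
    rw [← h2]
    rfl
  constructor <;>
  · apply planeEquiv.injective
    rw [h3, planeEquiv_apply]
    unfold Shell.tubeDeriv
    rw [Matrix.toLin_finTwoProd_toContinuousLinearMap]
    simp [Shell.nu]

/-- Where the Jacobian does not vanish, tubular coordinates are a local diffeomorphism. -/
lemma Shell.tube_local (S : Shell) {x : ℝ × ℝ} (hx : 1 + x.1 * S.curv x.2 ≠ 0) :
    map S.tube (𝓝 x) = 𝓝 (S.tube x) ∧ ∃ u ∈ 𝓝 x, Set.InjOn S.tube u := by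
  set f : ℝ × ℝ → ℝ × ℝ := fun x => planeEquiv (S.tube x) with hf
  have hc : ContDiff ℝ ∞ f := planeEquiv.toContinuousLinearMap.contDiff.comp S.contDiff_tube
  have hst : HasStrictFDerivAt f (S.tubeDeriv x) x :=
    hc.contDiffAt.hasStrictFDerivAt' (S.hasFDerivAt_tube x) (by simp)
  have hdet : (S.tubeDeriv x).det ≠ 0 := by rwa [S.det_tubeDeriv]
  rw [← ContinuousLinearMap.coe_toContinuousLinearEquivOfDetNeZero _ hdet] at hst
  constructor
  · have h1 := hst.map_nhds_eq_of_equiv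
    have h2 : S.tube = planeEquiv.symm ∘ f := by
      funext y
      simp [hf]
    rw [h2, ← Filter.map_map, h1]
    exact planeEquiv.symm.toHomeomorph.map_nhds_eq (f x)
  · refine ⟨_, hst.toOpenPartialHomeomorph.open_source.mem_nhds
      hst.mem_toOpenPartialHomeomorph_source, ?_⟩
    intro a ha b hb hab
    exact hst.toOpenPartialHomeomorph.injOn ha hb (congrArg planeEquiv hab)

/-- Near `p = 0`, tubular coordinates are injective up to periods: on `ℝ × (ℝ/ℓℤ)` they are locally
injective along the compact circle `p = 0` and injective on it, hence injective near it. -/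
lemma Shell.exists_tube_injective (S : Shell) : ∃ δ > 0,
    Set.InjOn S.tube (Set.Ioo (-δ) δ ×ˢ Set.Ico 0 S.ℓ) := by
  have : Fact (0 < S.ℓ) := ⟨S.ℓ_pos⟩
  let q : ℝ × ℝ → ℝ × AddCircle S.ℓ := Prod.map id (fun s : ℝ => (s : AddCircle S.ℓ))
  let Ψ : ℝ × AddCircle S.ℓ → Plane := fun x => (S.periodic_tube x.1).lift x.2
  have hΨ : ∀ x, Ψ (q x) = S.tube x := fun x => rfl
  have hq : ∀ x, map q (𝓝 x) = 𝓝 (q x) := by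
    intro x
    have h1 : map (fun s : ℝ => (s : AddCircle S.ℓ)) (𝓝 x.2) = 𝓝 (x.2 : AddCircle S.ℓ) :=
      QuotientAddGroup.isOpenQuotientMap_mk.map_nhds_eq x.2
    have h2 : map q (𝓝 x) = map id (𝓝 x.1) ×ˢ map (fun s : ℝ => (s : AddCircle S.ℓ)) (𝓝 x.2) := by
      rw [← Prod.mk.eta (p := x), nhds_prod_eq]
      exact (Filter.prod_map_map_eq' _ _ _ _).symm
    rw [h2, h1, Filter.map_id]
    exact nhds_prod_eq.symm
  have hsurj : ∀ p (θ : AddCircle S.ℓ), ∃ s ∈ Set.Ico 0 S.ℓ, q (p, s) = (p, θ) := by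
    intro p θ
    obtain ⟨s, hs, hs'⟩ := AddCircle.eq_coe_Ico θ
    exact ⟨s, hs, by simp [q, hs']⟩
  have hcont : Continuous Ψ := by
    refine continuous_iff_continuousAt.2 fun ⟨p, θ⟩ => ?_
    obtain ⟨s, -, hs⟩ := hsurj p θ
    rw [← hs, ContinuousAt, ← hq, tendsto_map'_iff]
    exact S.contDiff_tube.continuous.continuousAt
  have hinj : Set.InjOn Ψ ({(0 : ℝ)} ×ˢ Set.univ) := by
    rintro ⟨p, θ⟩ ⟨hp, -⟩ ⟨p', θ'⟩ ⟨hp', -⟩ h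
    simp only [Set.mem_singleton_iff] at hp hp'
    subst hp hp'
    obtain ⟨s, hs, e⟩ := hsurj 0 θ
    obtain ⟨s', hs', e'⟩ := hsurj 0 θ'
    rw [← e, ← e', hΨ, hΨ, S.tube_zero, S.tube_zero] at h
    rw [← e, ← e', S.injOn hs hs' h]
  obtain ⟨t, ht, htinj⟩ := hinj.exists_mem_nhdsSet (isCompact_singleton.prod isCompact_univ)
    (fun x _ => hcont.continuousAt) (by
      rintro ⟨p, θ⟩ ⟨hp, -⟩
      obtain ⟨s, -, hs⟩ := hsurj p θ
      simp only [Set.mem_singleton_iff] at hp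
      obtain ⟨u, hu, hui⟩ := (S.tube_local (x := (p, s)) (by simp [hp])).2
      refine ⟨q '' u, ?_, ?_⟩
      · rw [← hs, ← hq]
        exact image_mem_map hu
      · rintro _ ⟨a, ha, rfl⟩ _ ⟨b, hb, rfl⟩ hab
        rw [hΨ, hΨ] at hab
        rw [hui ha hb hab])
  rw [mem_nhdsSet_iff_exists] at ht
  obtain ⟨t', ht'o, ht's, ht't⟩ := ht
  obtain ⟨u, v, hu, hv, h0u, huv, hsub⟩ := generalized_tube_lemma isCompact_singleton isCompact_univ
    ht'o ht's
  obtain ⟨δ, hδ, hball⟩ := Metric.isOpen_iff.1 hu 0 (h0u rfl)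
  refine ⟨δ, hδ, ?_⟩
  rintro ⟨p, s⟩ ⟨hp, hs⟩ ⟨p', s'⟩ ⟨hp', hs'⟩ h
  have mem : ∀ p ∈ Set.Ioo (-δ) δ, ∀ s, q (p, s) ∈ t := by
    intro p hp s
    refine ht't (hsub ⟨hball ?_, huv trivial⟩)
    rw [Metric.mem_ball, dist_zero_right, Real.norm_eq_abs]
    exact abs_lt.2 hp
  have h2 := htinj (mem p hp s) (mem p' hp' s') h
  simp only [q, Prod.map, id, Prod.mk.injEq] at h2
  have h3 := (AddCircle.coe_eq_coe_iff_of_mem_Ico (a := 0) (by simpa using hs)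
    (by simpa using hs')).1 h2.2
  simp [h2.1, h3]

/-- A tubular neighbourhood of `Σ` of half-width `δ`: the Jacobian `1 + p κ` lies between `1/2`
and `3/2`, the coordinates are injective up to periods, and the two sides of `Σ` are mapped into
`Ω` and into the exterior. -/
structure Shell.IsTube (S : Shell) (δ : ℝ) : Prop where
  pos : 0 < δ
  curv_le : ∀ s, |S.curv s| * δ ≤ 1 / 2
  injOn : Set.InjOn S.tube (Set.Ioo (-δ) δ ×ˢ Set.Ico 0 S.ℓ)
  inner : ∀ p ∈ Set.Ioo 0 δ, ∀ s, S.tube (-p, s) ∈ S.Ω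
  outer : ∀ p ∈ Set.Ioo 0 δ, ∀ s, S.tube (p, s) ∈ S.ext

lemma Shell.exists_Ico_tube (S : Shell) (p s : ℝ) :
    ∃ s' ∈ Set.Ico 0 S.ℓ, S.tube (p, s') = S.tube (p, s) := by
  obtain ⟨s', hs', h⟩ := (S.periodic_tube p).exists_mem_Ico₀ S.ℓ_pos s
  exact ⟨s', hs', h.symm⟩

/-- Each open half tube is connected and does not meet `Σ`, so it lies on one side of `Σ`; which one
is read off from the orientation at a single point. -/
lemma Shell.exists_isTube (S : Shell) : ∃ δ, S.IsTube δ := by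
  obtain ⟨δ₀, hδ₀, hinj⟩ := S.exists_tube_injective
  obtain ⟨K, hK⟩ := (isCompact_Icc (a := 0) (b := S.ℓ)).exists_bound_of_continuousOn
    S.contDiff_curv.continuous.continuousOn
  have hK' : ∀ s, |S.curv s| ≤ K := by
    intro s
    obtain ⟨s', hs', h⟩ := S.periodic_curv.exists_mem_Ico₀ S.ℓ_pos s
    rw [h]
    exact hK s' (Set.Ico_subset_Icc_self hs')
  have hK0 : 0 ≤ K := (abs_nonneg _).trans (hK' 0)
  set δ := min δ₀ (1 / (2 * (K + 1))) with hδ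
  have hδpos : 0 < δ := lt_min hδ₀ (by positivity)
  have hδ1 : δ ≤ δ₀ := min_le_left _ _
  have hδ2 : (K + 1) * δ ≤ 1 / 2 := by
    have := min_le_right δ₀ (1 / (2 * (K + 1)))
    rw [← hδ, le_div_iff₀ (by positivity)] at this
    linarith
  have hinj' : Set.InjOn S.tube (Set.Ioo (-δ) δ ×ˢ Set.Ico 0 S.ℓ) :=
    hinj.mono (Set.prod_mono (Set.Ioo_subset_Ioo (by linarith) hδ1) le_rfl)
  -- the two open half tubes do not meet `Σ`
  have hfront : ∀ p ∈ Set.Ioo (-δ) δ, p ≠ 0 → ∀ s, S.tube (p, s) ∉ frontier S.Ω := by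
    intro p hp hp0 s hs
    rw [← S.range_eq] at hs
    obtain ⟨s₁, hs₁⟩ := hs
    rw [← S.tube_zero] at hs₁
    obtain ⟨a, ha, ea⟩ := S.exists_Ico_tube p s
    obtain ⟨b, hb, eb⟩ := S.exists_Ico_tube 0 s₁
    rw [← ea, ← eb] at hs₁
    have := hinj' ⟨⟨by linarith, hδpos⟩, hb⟩ ⟨hp, ha⟩ hs₁
    simp only [Prod.mk.injEq] at this
    exact hp0 this.1.symm
  have hcompl : ∀ x, x ∉ frontier S.Ω → x ∈ S.Ω ∪ S.ext := by
    intro x hx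
    by_cases h : x ∈ closure S.Ω
    · left
      by_contra h'
      exact hx ⟨h, by rwa [S.isOpen.interior_eq]⟩
    · right
      exact h
  have hdisj : Disjoint S.Ω S.ext :=
    Set.disjoint_left.2 fun x hx hx' => hx' (subset_closure hx)
  have hext : IsOpen S.ext := isClosed_closure.isOpen_compl
  have hside : ∀ I : Set ℝ, I ⊆ Set.Ioo (-δ) δ → Convex ℝ I → 0 ∉ I →
      IsPreconnected (S.tube '' (I ×ˢ Set.univ)) ∧ S.tube '' (I ×ˢ Set.univ) ⊆ S.Ω ∪ S.ext := by
    intro I hI hconv h0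
    refine ⟨((hconv.prod convex_univ).isPreconnected).image _
      S.contDiff_tube.continuous.continuousOn, ?_⟩
    rintro _ ⟨⟨p, s⟩, ⟨hp, -⟩, rfl⟩
    exact hcompl _ (hfront p (hI hp) (fun h => h0 (h ▸ hp)) s)
  have hev : ∀ᶠ p in 𝓝[>] (0 : ℝ), p ∈ Set.Ioo 0 δ := Ioo_mem_nhdsGT hδpos
  obtain ⟨p₀, hp₀, hout, hin⟩ := (hev.and (S.outward 0)).exists
  refine ⟨δ, hδpos, fun s => ?_, hinj', fun p hp s => ?_, fun p hp s => ?_⟩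
  · nlinarith [hK' s]
  · obtain ⟨h1, h2⟩ := hside (Set.Ioo (-δ) 0) (Set.Ioo_subset_Ioo le_rfl hδpos.le)
      (convex_Ioo _ _) (by simp)
    refine h1.subset_left_of_subset_union S.isOpen hext hdisj h2 ?_
      ⟨(-p, s), ⟨⟨by linarith [hp.2], by linarith [hp.1]⟩, trivial⟩, rfl⟩
    refine ⟨S.tube (-p₀, 0),
      ⟨(-p₀, 0), ⟨⟨by linarith [hp₀.2], by linarith [hp₀.1]⟩, trivial⟩, rfl⟩, ?_⟩
    simpa [Shell.tube, Shell.nu, sub_eq_add_neg] using hin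
  · obtain ⟨h1, h2⟩ := hside (Set.Ioo 0 δ) (Set.Ioo_subset_Ioo (by linarith) le_rfl)
      (convex_Ioo _ _) (by simp)
    refine h1.subset_right_of_subset_union S.isOpen hext hdisj h2 ?_
      ⟨(p, s), ⟨hp, trivial⟩, rfl⟩
    refine ⟨S.tube (p₀, 0), ⟨(p₀, 0), ⟨hp₀, trivial⟩, rfl⟩, ?_⟩
    rw [Shell.ext, Set.mem_compl_iff]
    simpa [Shell.tube, Shell.nu] using hout


/-! ### The equation `σ · ∇ u = h` in tubular coordinates -/

lemma act_pauli₁ (v : Spinor) : act pauli₁ v 0 = v 1 ∧ act pauli₁ v 1 = v 0 := by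
  constructor <;> simp [act, pauli₁, Matrix.ofLp_toEuclideanCLM, Matrix.mulVec, dotProduct,
    Fin.sum_univ_two]

lemma act_pauli₂ (v : Spinor) :
    act pauli₂ v 0 = -Complex.I * v 1 ∧ act pauli₂ v 1 = Complex.I * v 0 := by
  constructor <;> simp [act, pauli₂, Matrix.ofLp_toEuclideanCLM, Matrix.mulVec, dotProduct,
    Fin.sum_univ_two]

lemma act_pauli₃ (v : Spinor) : act pauli₃ v 0 = v 0 ∧ act pauli₃ v 1 = -v 1 := by
  constructor <;> simp [act, pauli₃, Matrix.ofLp_toEuclideanCLM, Matrix.mulVec, dotProduct,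
    Fin.sum_univ_two]

lemma sigmaGrad_apply_zero (u : Plane → Spinor) (x : Plane) :
    sigmaGrad u x 0 = fderiv ℝ u x (EuclideanSpace.single 0 1) 1 -
      Complex.I * fderiv ℝ u x (EuclideanSpace.single 1 1) 1 := by
  simp only [sigmaGrad, PiLp.add_apply, (act_pauli₁ _).1, (act_pauli₂ _).1]
  ring

lemma sigmaGrad_apply_one (u : Plane → Spinor) (x : Plane) :
    sigmaGrad u x 1 = fderiv ℝ u x (EuclideanSpace.single 0 1) 0 +
      Complex.I * fderiv ℝ u x (EuclideanSpace.single 1 1) 0 := by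
  simp only [sigmaGrad, PiLp.add_apply, (act_pauli₁ _).2, (act_pauli₂ _).2]

lemma fderiv_apply_plane (u : Plane → Spinor) (x v : Plane) (j : Fin 2) :
    fderiv ℝ u x v j = v 0 * fderiv ℝ u x (EuclideanSpace.single 0 1) j +
      v 1 * fderiv ℝ u x (EuclideanSpace.single 1 1) j := by
  have h : v = v 0 • EuclideanSpace.single 0 1 + v 1 • EuclideanSpace.single 1 1 := by
    ext i
    fin_cases i <;> simp
  conv_lhs => rw [h]
  simp only [map_add, map_smul, PiLp.add_apply, PiLp.smul_apply, Complex.real_smul]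

/-- The unit tangent as a complex number of modulus one. -/
noncomputable def Shell.tau (S : Shell) (s : ℝ) : ℂ := deriv S.γ s 0 + Complex.I * deriv S.γ s 1

lemma Shell.contDiff_tau (S : Shell) : ContDiff ℝ ∞ S.tau :=
  (Complex.ofRealCLM.contDiff.comp (contDiff_coord S.contDiff_deriv 0)).add
    (contDiff_const.mul (Complex.ofRealCLM.contDiff.comp (contDiff_coord S.contDiff_deriv 1)))

lemma Shell.periodic_tau (S : Shell) : Function.Periodic S.tau S.ℓ := by
  intro s
  simp only [Shell.tau, S.periodic_deriv s]

lemma Shell.star_tau (S : Shell) (s : ℝ) :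
    star (S.tau s) = deriv S.γ s 0 - Complex.I * deriv S.γ s 1 := by
  simp [Shell.tau, sub_eq_add_neg]

lemma Shell.tau_mul_star (S : Shell) (s : ℝ) : S.tau s * star (S.tau s) = 1 := by
  have h : ((deriv S.γ s 0 : ℝ) : ℂ) ^ 2 + ((deriv S.γ s 1 : ℝ) : ℂ) ^ 2 = 1 := by
    rw [← Complex.ofReal_pow, ← Complex.ofReal_pow, ← Complex.ofReal_add, S.deriv_sq_add_sq,
      Complex.ofReal_one]
  rw [S.star_tau, Shell.tau]
  linear_combination h - ((deriv S.γ s 1 : ℝ) : ℂ) ^ 2 * Complex.I_mul_I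

lemma Shell.norm_tau (S : Shell) (s : ℝ) : ‖S.tau s‖ = 1 := by
  have h := congrArg norm (S.tau_mul_star s)
  rw [norm_mul, norm_star, norm_one] at h
  nlinarith [norm_nonneg (S.tau s)]

/-- The Frenet equation `τ' = i κ τ`, conjugated. -/
lemma Shell.hasDerivAt_star_tau (S : Shell) (s : ℝ) :
    HasDerivAt (fun s => star (S.tau s)) (-Complex.I * S.curv s * star (S.tau s)) s := by
  obtain ⟨f0, f1⟩ := S.deriv2_eq s
  have h0 := (hasDerivAt_coord S.contDiff_deriv 0 s).ofReal_comp
  have h1 := (hasDerivAt_coord S.contDiff_deriv 1 s).ofReal_comp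
  refine (h0.add (h1.const_mul Complex.I)).star.congr_deriv ?_
  rw [S.star_tau, f0, f1]
  simp
  linear_combination -((S.curv s : ℂ) * (deriv S.γ s 1 : ℝ)) * Complex.I_mul_I

/-- The first component of a spinor field on the side `e = ±1` of `Σ`, in tubular coordinates. -/
noncomputable def Shell.comp0 (S : Shell) (e : ℝ) (u : Plane → Spinor) (r s : ℝ) : ℂ :=
  u (S.tube (e * r, s)) 0

/-- The second component of a spinor field on the side `e = ±1` of `Σ`, in tubular coordinates,
and rotated by the conjugate of the unit tangent. -/
noncomputable def Shell.comp1 (S : Shell) (e : ℝ) (u : Plane → Spinor) (r s : ℝ) : ℂ :=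
  star (S.tau s) * u (S.tube (e * r, s)) 1

/-- The Jacobian of the tubular coordinates on the side `e = ±1`. -/
noncomputable def Shell.jac (S : Shell) (e r s : ℝ) : ℝ := 1 + e * r * S.curv s

section pullback

variable (S : Shell) (e : ℝ) {u : Plane → Spinor}

lemma Shell.contDiff_tubeSide : ContDiff ℝ ∞ fun x : ℝ × ℝ => S.tube (e * x.1, x.2) :=
  S.contDiff_tube.comp ((contDiff_const.mul contDiff_fst).prodMk contDiff_snd)

lemma contDiff_spinor_coord {E : Type*} [NormedAddCommGroup E] [NormedSpace ℝ E] {f : E → Spinor}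
    (hf : ContDiff ℝ ∞ f) (j : Fin 2) : ContDiff ℝ ∞ fun x => f x j :=
  ((EuclideanSpace.proj (𝕜 := ℂ) j : Spinor →L[ℂ] ℂ).restrictScalars ℝ).contDiff.comp hf

lemma Shell.contDiff_comp0 (hu : ContDiff ℝ ∞ u) :
    ContDiff ℝ ∞ (Function.uncurry (S.comp0 e u)) :=
  contDiff_spinor_coord (hu.comp (S.contDiff_tubeSide e)) 0

lemma contDiff_star_comp {E : Type*} [NormedAddCommGroup E] [NormedSpace ℝ E] {f : E → ℂ}
    (hf : ContDiff ℝ ∞ f) : ContDiff ℝ ∞ fun x => star (f x) :=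
  (Complex.conjCLE.toContinuousLinearMap).contDiff.comp hf

lemma Shell.contDiff_comp1 (hu : ContDiff ℝ ∞ u) :
    ContDiff ℝ ∞ (Function.uncurry (S.comp1 e u)) :=
  (contDiff_star_comp (S.contDiff_tau.comp contDiff_snd)).mul
    (contDiff_spinor_coord (hu.comp (S.contDiff_tubeSide e)) 1)

lemma Shell.periodic_comp0 (u : Plane → Spinor) (r : ℝ) :
    Function.Periodic (S.comp0 e u r) S.ℓ := by
  intro s
  have := S.periodic_tube (e * r) s
  simp only at this
  simp only [Shell.comp0, this]

lemma Shell.periodic_comp1 (u : Plane → Spinor) (r : ℝ) :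
    Function.Periodic (S.comp1 e u r) S.ℓ := by
  intro s
  have := S.periodic_tube (e * r) s
  simp only at this
  simp only [Shell.comp1, this, S.periodic_tau s]

lemma Shell.continuous_jac : Continuous (Function.uncurry (S.jac e)) := by
  have := S.contDiff_curv.continuous
  unfold Shell.jac
  exact continuous_const.add ((continuous_const.mul continuous_fst).mul (this.comp continuous_snd))

lemma Shell.hasDerivAt_tube_r (r s : ℝ) :
    HasDerivAt (fun r => S.tube (e * r, s)) (e • S.nu s) r := by
  have h1 := (S.contDiff_tube.differentiable (by simp) (e * r, s)).hasFDerivAt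
  have h2 : HasDerivAt (fun r : ℝ => (e * r, s)) (e * 1, 0) r :=
    ((hasDerivAt_id r).const_mul e).prodMk (hasDerivAt_const r s)
  refine (h1.comp_hasDerivAt r h2).congr_deriv ?_
  rw [show ((e * 1, 0) : ℝ × ℝ) = e • (1, 0) by simp, map_smul, (S.fderiv_tube _).1]

lemma Shell.hasDerivAt_tube_s (r s : ℝ) :
    HasDerivAt (fun s => S.tube (e * r, s)) (S.jac e r s • deriv S.γ s) s := by
  have h1 := (S.contDiff_tube.differentiable (by simp) (e * r, s)).hasFDerivAt
  have h2 : HasDerivAt (fun s : ℝ => (e * r, s)) (0, 1) s :=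
    (hasDerivAt_const s (e * r)).prodMk (hasDerivAt_id s)
  refine (h1.comp_hasDerivAt s h2).congr_deriv ?_
  rw [(S.fderiv_tube _).2]
  rfl

lemma Shell.hasDerivAt_pull_r (hu : ContDiff ℝ ∞ u) (j : Fin 2) (r s : ℝ) :
    HasDerivAt (fun r => u (S.tube (e * r, s)) j)
      (e * (deriv S.γ s 1 * fderiv ℝ u (S.tube (e * r, s)) (EuclideanSpace.single 0 1) j -
        deriv S.γ s 0 * fderiv ℝ u (S.tube (e * r, s)) (EuclideanSpace.single 1 1) j)) r := by
  have h1 := (hu.differentiable (by simp) (S.tube (e * r, s))).hasFDerivAt.comp_hasDerivAt r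
    (S.hasDerivAt_tube_r e r s)
  have h2 := ((EuclideanSpace.proj (𝕜 := ℂ) j :
    Spinor →L[ℂ] ℂ).restrictScalars ℝ).hasFDerivAt.comp_hasDerivAt r h1
  refine h2.congr_deriv ?_
  change (fderiv ℝ u (S.tube (e * r, s)) (e • S.nu s)) j = _
  rw [map_smul, PiLp.smul_apply, fderiv_apply_plane, Complex.real_smul]
  simp [Shell.nu, sub_eq_add_neg]

lemma Shell.hasDerivAt_pull_s (hu : ContDiff ℝ ∞ u) (j : Fin 2) (r s : ℝ) :
    HasDerivAt (fun s => u (S.tube (e * r, s)) j)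
      (S.jac e r s *
        (deriv S.γ s 0 * fderiv ℝ u (S.tube (e * r, s)) (EuclideanSpace.single 0 1) j +
        deriv S.γ s 1 * fderiv ℝ u (S.tube (e * r, s)) (EuclideanSpace.single 1 1) j)) s := by
  have h1 := (hu.differentiable (by simp) (S.tube (e * r, s))).hasFDerivAt.comp_hasDerivAt s
    (S.hasDerivAt_tube_s e r s)
  have h2 := ((EuclideanSpace.proj (𝕜 := ℂ) j :
    Spinor →L[ℂ] ℂ).restrictScalars ℝ).hasFDerivAt.comp_hasDerivAt s h1
  refine h2.congr_deriv ?_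
  change (fderiv ℝ u (S.tube (e * r, s)) (S.jac e r s • deriv S.γ s)) j = _
  rw [map_smul, PiLp.smul_apply, fderiv_apply_plane, Complex.real_smul]

/-- The equation for the first component in tubular coordinates. -/
lemma Shell.stripOp_comp0 (hu : ContDiff ℝ ∞ u) (r s : ℝ) :
    stripOp e (S.jac e) (S.comp0 e u) r s =
      Complex.I * e * S.jac e r s * (star (S.tau s) * sigmaGrad u (S.tube (e * r, s)) 1) := by
  have h1 := (hasDerivAt_partialR (S.contDiff_comp0 e hu) r s).unique
    (S.hasDerivAt_pull_r e hu 0 r s)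
  have h2 := (hasDerivAt_partialS (S.contDiff_comp0 e hu) r s).unique
    (S.hasDerivAt_pull_s e hu 0 r s)
  rw [stripOp, h1, h2, sigmaGrad_apply_one, S.star_tau]
  set A := fderiv ℝ u (S.tube (e * r, s)) (EuclideanSpace.single 0 1) 0
  set B := fderiv ℝ u (S.tube (e * r, s)) (EuclideanSpace.single 1 1) 0
  linear_combination (S.jac e r s * e * (deriv S.γ s 1 * A + deriv S.γ s 1 * B * Complex.I -
    deriv S.γ s 0 * B)) * Complex.I_mul_I

/-- The equation for the second component in tubular coordinates. The term of order zero is the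
derivative of the rotating frame. -/
lemma Shell.stripOp_comp1 (hu : ContDiff ℝ ∞ u) (r s : ℝ) :
    stripOp (-e) (S.jac e) (S.comp1 e u) r s =
      -Complex.I * e * S.jac e r s * sigmaGrad u (S.tube (e * r, s)) 0 -
        e * S.curv s * S.comp1 e u r s := by
  have h1 := (hasDerivAt_partialR (S.contDiff_comp1 e hu) r s).unique
    ((S.hasDerivAt_pull_r e hu 1 r s).const_mul (star (S.tau s)))
  have h2 := (hasDerivAt_partialS (S.contDiff_comp1 e hu) r s).unique
    ((S.hasDerivAt_star_tau s).mul (S.hasDerivAt_pull_s e hu 1 r s))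
  have hn : ((deriv S.γ s 0 : ℝ) : ℂ) ^ 2 + ((deriv S.γ s 1 : ℝ) : ℂ) ^ 2 = 1 := by
    rw [← Complex.ofReal_pow, ← Complex.ofReal_pow, ← Complex.ofReal_add, S.deriv_sq_add_sq,
      Complex.ofReal_one]
  rw [stripOp, h1, h2, sigmaGrad_apply_zero, Shell.comp1, S.star_tau]
  set A := fderiv ℝ u (S.tube (e * r, s)) (EuclideanSpace.single 0 1) 1
  set B := fderiv ℝ u (S.tube (e * r, s)) (EuclideanSpace.single 1 1) 1
  set t₀ : ℂ := Complex.ofReal (deriv S.γ s 0)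
  set t₁ : ℂ := Complex.ofReal (deriv S.γ s 1)
  push_cast
  linear_combination (e * S.curv s * (t₀ - Complex.I * t₁) * u (S.tube (e * r, s)) 1 +
    S.jac e r s * e * A * t₀ * t₁ + S.jac e r s * e * B * (t₁ ^ 2 - 1)) * Complex.I_mul_I -
    (Complex.I * S.jac e r s * e * A + S.jac e r s * e * B) * hn

end pullback


/-! ### The two sides of the curve and the boundary estimate -/

/-- One of the two sides of `Σ`: the exterior, with `e = 1`, or `Ω`, with `e = -1`; in both cases
`e ν` points into `U`. -/
def Shell.IsSide (S : Shell) (e : ℝ) (U : Set Plane) : Prop :=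
  (e = 1 ∧ U = S.ext) ∨ (e = -1 ∧ U = S.Ω)

section side

variable {S : Shell} {e δ : ℝ} {U : Set Plane}

lemma Shell.IsSide.sq (h : S.IsSide e U) : e ^ 2 = 1 := by
  rcases h with ⟨rfl, -⟩ | ⟨rfl, -⟩ <;> norm_num

lemma Shell.IsSide.abs (h : S.IsSide e U) : |e| = 1 := by
  rcases h with ⟨rfl, -⟩ | ⟨rfl, -⟩ <;> norm_num

lemma Shell.IsSide.isOpen (h : S.IsSide e U) : IsOpen U := by
  rcases h with ⟨-, rfl⟩ | ⟨-, rfl⟩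
  · exact isClosed_closure.isOpen_compl
  · exact S.isOpen

lemma Shell.disjoint_ext (S : Shell) : Disjoint S.Ω S.ext :=
  Set.disjoint_left.2 fun _ hx hx' => hx' (subset_closure hx)

lemma Shell.IsSide.tube_mem (h : S.IsSide e U) (hδ : S.IsTube δ) {r : ℝ} (hr : r ∈ Set.Ioo 0 δ)
    (s : ℝ) : S.tube (e * r, s) ∈ U := by
  rcases h with ⟨rfl, rfl⟩ | ⟨rfl, rfl⟩
  · rw [one_mul]
    exact hδ.outer r hr s
  · rw [neg_one_mul]
    exact hδ.inner r hr s

lemma Shell.IsSide.tube_neg_notMem (h : S.IsSide e U) (hδ : S.IsTube δ) {r : ℝ}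
    (hr : r ∈ Set.Ioo 0 δ) (s : ℝ) : S.tube (-e * r, s) ∉ U := by
  have hd := Set.disjoint_left.1 S.disjoint_ext
  rcases h with ⟨rfl, rfl⟩ | ⟨rfl, rfl⟩
  · rw [neg_one_mul]
    exact hd (hδ.inner r hr s)
  · rw [neg_neg, one_mul]
    exact fun h => hd h (hδ.outer r hr s)

lemma Shell.IsSide.frontier_subset (h : S.IsSide e U) : frontier U ⊆ frontier S.Ω := by
  rcases h with ⟨-, rfl⟩ | ⟨-, rfl⟩
  · rw [Shell.ext, frontier_compl]
    exact frontier_closure_subset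
  · exact le_rfl

lemma Shell.IsSide.curve_notMem (h : S.IsSide e U) (s : ℝ) : S.γ s ∉ U := by
  have hs : S.γ s ∈ frontier S.Ω := S.range_eq ▸ Set.mem_range_self s
  rcases h with ⟨-, rfl⟩ | ⟨-, rfl⟩
  · exact fun h => h (frontier_subset_closure hs)
  · intro h
    have := hs.2
    rw [S.isOpen.interior_eq] at this
    exact this h

lemma Shell.abs_jac_sub_one (hδ : S.IsTube δ) (h : S.IsSide e U) {r : ℝ} (hr : r ∈ Set.Icc 0 δ)
    (s : ℝ) : |S.jac e r s - 1| ≤ 1 / 2 := by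
  have h1 : S.jac e r s - 1 = e * r * S.curv s := by
    rw [Shell.jac]
    ring
  rw [h1, abs_mul, abs_mul, h.abs, one_mul, abs_of_nonneg hr.1]
  nlinarith [hδ.curv_le s, abs_nonneg (S.curv s), hr.2]

lemma Shell.jac_bounds (hδ : S.IsTube δ) (h : S.IsSide e U) {r : ℝ} (hr : r ∈ Set.Icc 0 δ)
    (s : ℝ) : 1 / 2 ≤ S.jac e r s ∧ S.jac e r s ≤ 2 := by
  have := abs_le.1 (Shell.abs_jac_sub_one hδ h hr s)
  constructor <;> linarith [this.1, this.2]

/-- The part of the tube of half-width `δ` that lies on the side `e` of `Σ`. -/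
def Shell.halfTube (S : Shell) (e δ : ℝ) : Set Plane :=
  (fun x : ℝ × ℝ => S.tube (e * x.1, x.2)) '' (Set.Ioo 0 δ ×ˢ Set.Ico 0 S.ℓ)

lemma Shell.halfTube_subset (hδ : S.IsTube δ) (h : S.IsSide e U) : S.halfTube e δ ⊆ U := by
  rintro _ ⟨⟨r, s⟩, ⟨hr, -⟩, rfl⟩
  exact h.tube_mem hδ hr s

lemma integral_rect {E : Type*} [NormedAddCommGroup E] [NormedSpace ℝ E] {f : ℝ × ℝ → E}
    (hf : Continuous f) {δ ℓ : ℝ} (hδ : 0 ≤ δ) (hℓ : 0 ≤ ℓ) :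
    ∫ x in Set.Ioo 0 δ ×ˢ Set.Ico 0 ℓ, f x = ∫ r in (0 : ℝ)..δ, ∫ s in (0 : ℝ)..ℓ, f (r, s) := by
  have hi : IntegrableOn f (Set.Ioo 0 δ ×ˢ Set.Ico 0 ℓ) (volume.prod volume) :=
    (hf.continuousOn.integrableOn_compact (isCompact_Icc.prod isCompact_Icc)).mono_set
      (Set.prod_mono Set.Ioo_subset_Icc_self Set.Ico_subset_Icc_self)
  rw [Measure.volume_eq_prod, setIntegral_prod _ hi, intervalIntegral.integral_of_le hδ,
    integral_Ioc_eq_integral_Ioo]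
  congr 1
  funext r
  rw [intervalIntegral.integral_of_le hℓ, ← integral_Icc_eq_integral_Ioc,
    integral_Icc_eq_integral_Ico]

/-- Change of variables to tubular coordinates on one side of `Σ`. -/
lemma Shell.integral_halfTube {E : Type*} [NormedAddCommGroup E] [NormedSpace ℝ E]
    (hδ : S.IsTube δ) (h : S.IsSide e U) {g : Plane → E} (hg : Continuous g) :
    ∫ x in S.halfTube e δ, g x =
      ∫ r in (0 : ℝ)..δ, ∫ s in (0 : ℝ)..S.ℓ, S.jac e r s • g (S.tube (e * r, s)) := by
  set Θ : ℝ × ℝ → ℝ × ℝ := fun x => planeEquiv (S.tube (e * x.1, x.2)) with hΘ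
  set R : Set (ℝ × ℝ) := Set.Ioo 0 δ ×ˢ Set.Ico 0 S.ℓ with hR
  have hmeas : MeasurableSet R := measurableSet_Ioo.prod measurableSet_Ico
  let M : ℝ × ℝ →L[ℝ] ℝ × ℝ :=
    (e • ContinuousLinearMap.fst ℝ ℝ ℝ).prod (ContinuousLinearMap.snd ℝ ℝ ℝ)
  have hM : M.det = e := by
    have : M = (Matrix.toLin (.finTwoProd ℝ) (.finTwoProd ℝ)
        !![e, 0; 0, 1]).toContinuousLinearMap := by
      rw [Matrix.toLin_finTwoProd_toContinuousLinearMap]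
      ext <;> simp [M]
    rw [this, LinearMap.det_toContinuousLinearMap, LinearMap.det_toLin, Matrix.det_fin_two_of]
    ring
  have hΘd : ∀ x ∈ R, HasFDerivWithinAt Θ ((S.tubeDeriv (e * x.1, x.2)).comp M) R x := by
    intro x _
    have hl : HasFDerivAt (fun x : ℝ × ℝ => (e * x.1, x.2)) M x := M.hasFDerivAt
    exact ((S.hasFDerivAt_tube (e * x.1, x.2)).comp x hl).hasFDerivWithinAt
  have hdet : ∀ x : ℝ × ℝ, ((S.tubeDeriv (e * x.1, x.2)).comp M).det = S.jac e x.1 x.2 * e := by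
    intro x
    have h1 : ((S.tubeDeriv (e * x.1, x.2)).comp M).det =
        (S.tubeDeriv (e * x.1, x.2)).det * M.det := by
      simp only [ContinuousLinearMap.det, ContinuousLinearMap.toLinearMap_comp, LinearMap.det_comp]
    rw [h1, S.det_tubeDeriv, hM, Shell.jac]
  have he0 : e ≠ 0 := by
    intro h0
    have := h.sq
    norm_num [h0] at this
  have hinj : Set.InjOn Θ R := by
    rintro ⟨r, s⟩ ⟨hr, hs⟩ ⟨r', s'⟩ ⟨hr', hs'⟩ hab
    have h1 := planeEquiv.injective hab
    have hmem : ∀ r ∈ Set.Ioo 0 δ, e * r ∈ Set.Ioo (-δ) δ := by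
      intro r hr
      refine abs_lt.1 ?_
      rw [abs_mul, h.abs, one_mul, abs_of_pos hr.1]
      exact hr.2
    have h2 := hδ.injOn (x₁ := (e * r, s)) (x₂ := (e * r', s')) ⟨hmem r hr, hs⟩
      ⟨hmem r' hr', hs'⟩ h1
    simp only [Prod.mk.injEq] at h2 ⊢
    exact ⟨mul_left_cancel₀ he0 h2.1, h2.2⟩
  have e1 : ∫ x in S.halfTube e δ, g x = ∫ y in Θ '' R, g (planeEquiv.symm y) := by
    have himg : Θ '' R = planeEquiv '' S.halfTube e δ := by
      rw [Shell.halfTube, Set.image_image]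
    rw [himg, measurePreserving_planeEquiv.setIntegral_image_emb
      planeEquiv.toHomeomorph.measurableEmbedding]
    simp
  rw [e1, integral_image_eq_integral_abs_det_fderiv_smul volume hmeas hΘd hinj]
  have e2 : ∀ x ∈ R, |((S.tubeDeriv (e * x.1, x.2)).comp M).det| • g (planeEquiv.symm (Θ x)) =
      S.jac e x.1 x.2 • g (S.tube (e * x.1, x.2)) := by
    intro x hx
    have hj := (Shell.jac_bounds hδ h (Set.Ioo_subset_Icc_self hx.1) x.2).1
    rw [hdet, abs_mul, h.abs, mul_one, abs_of_pos (by linarith)]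
    simp [hΘ]
  rw [setIntegral_congr_fun hmeas e2, integral_rect
    (f := fun x : ℝ × ℝ => S.jac e x.1 x.2 • g (S.tube (e * x.1, x.2))) ?_ hδ.pos.le S.ℓ_pos.le]
  exact (S.continuous_jac e).smul (hg.comp (S.contDiff_tubeSide e).continuous)

/-- The squared graph norm of `σ · ∇` on `U`. -/
noncomputable def graphSq (U : Set Plane) (u : Plane → Spinor) : ℝ :=
  (∫ x in U, ‖u x‖ ^ 2) + ∫ x in U, ‖sigmaGrad u x‖ ^ 2

lemma integral_sq_nonneg (U : Set Plane) (u : Plane → Spinor) : 0 ≤ ∫ x in U, ‖u x‖ ^ 2 :=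
  integral_nonneg fun _ => sq_nonneg _

lemma graphSq_nonneg (U : Set Plane) (u : Plane → Spinor) : 0 ≤ graphSq U u :=
  add_nonneg (integral_sq_nonneg U u) (integral_sq_nonneg U (sigmaGrad u))

lemma integrable_norm_sq {u : Plane → Spinor} (hu : Continuous u) (hc : HasCompactSupport u) :
    Integrable (fun x => ‖u x‖ ^ 2) := by
  have h : HasCompactSupport fun x => ‖u x‖ ^ 2 := by
    refine hc.mono fun x hx => ?_
    contrapose! hx
    have : u x = 0 := by simpa using hx
    simp [this]
  exact Continuous.integrable_of_hasCompactSupport (by fun_prop) h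

/-- The `L²`-norm over the coordinate rectangle is controlled by the `L²`-norm over `U`. -/
lemma Shell.integral_strip_le (hδ : S.IsTube δ) (h : S.IsSide e U) {u : Plane → Spinor}
    (hu : Continuous u) (hc : HasCompactSupport u) :
    ∫ r in (0 : ℝ)..δ, ∫ s in (0 : ℝ)..S.ℓ, ‖u (S.tube (e * r, s))‖ ^ 2 ≤
      2 * ∫ x in U, ‖u x‖ ^ 2 := by
  have hcu : Continuous (Function.uncurry fun r s => ‖u (S.tube (e * r, s))‖ ^ 2) :=
    ((hu.comp (S.contDiff_tubeSide e).continuous).norm).pow 2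
  have hcj : Continuous (Function.uncurry fun r s => S.jac e r s * ‖u (S.tube (e * r, s))‖ ^ 2) :=
    (S.continuous_jac e).mul hcu
  have hint := integrable_norm_sq hu hc
  have hg : Continuous fun x => ‖u x‖ ^ 2 := hu.norm.pow 2
  have h1 : ∫ x in S.halfTube e δ, ‖u x‖ ^ 2 ≤ ∫ x in U, ‖u x‖ ^ 2 :=
    setIntegral_mono_set hint.integrableOn (.of_forall fun _ => sq_nonneg _)
      (Shell.halfTube_subset hδ h).eventuallyLE
  rw [Shell.integral_halfTube hδ h hg] at h1
  simp only [smul_eq_mul] at h1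
  have cont1 := intervalIntegral.continuous_parametric_intervalIntegral_of_continuous'
    (μ := volume) (f := fun r s => ‖u (S.tube (e * r, s))‖ ^ 2) hcu 0 S.ℓ
  have cont2 := intervalIntegral.continuous_parametric_intervalIntegral_of_continuous'
    (μ := volume) (f := fun r s => S.jac e r s * ‖u (S.tube (e * r, s))‖ ^ 2) hcj 0 S.ℓ
  have h2 : ∫ r in (0 : ℝ)..δ, ∫ s in (0 : ℝ)..S.ℓ, ‖u (S.tube (e * r, s))‖ ^ 2 ≤
      ∫ r in (0 : ℝ)..δ, 2 * ∫ s in (0 : ℝ)..S.ℓ, S.jac e r s * ‖u (S.tube (e * r, s))‖ ^ 2 := by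
    refine intervalIntegral.integral_mono_on hδ.pos.le (cont1.intervalIntegrable _ _)
      ((cont2.const_mul 2).intervalIntegrable _ _) fun r hr => ?_
    rw [← intervalIntegral.integral_const_mul]
    have hct : Continuous fun s => S.tube (e * r, s) :=
      S.contDiff_tube.continuous.comp (by fun_prop)
    have c3 : Continuous fun s => ‖u (S.tube (e * r, s))‖ ^ 2 := by fun_prop
    have c4 : Continuous fun s => S.jac e r s * ‖u (S.tube (e * r, s))‖ ^ 2 := by
      have hk := S.contDiff_curv.continuous
      unfold Shell.jac
      fun_prop
    have c5 : IntervalIntegrable (fun s => 2 * (S.jac e r s * ‖u (S.tube (e * r, s))‖ ^ 2))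
        volume 0 S.ℓ := (c4.const_mul 2).intervalIntegrable _ _
    refine intervalIntegral.integral_mono_on S.ℓ_pos.le (c3.intervalIntegrable _ _) c5 fun s _ => ?_
    have hj := (Shell.jac_bounds hδ h hr s).1
    have hs := sq_nonneg ‖u (S.tube (e * r, s))‖
    generalize ‖u (S.tube (e * r, s))‖ ^ 2 = y at hs ⊢
    nlinarith
  rw [intervalIntegral.integral_const_mul] at h2
  linarith

lemma norm_coord_sq_le (v : Spinor) (j : Fin 2) : ‖v j‖ ^ 2 ≤ ‖v‖ ^ 2 := by
  rw [EuclideanSpace.norm_sq_eq, Fin.sum_univ_two]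
  fin_cases j
  · simp
  · simp

/-- `∫∫ |f|²` over the coordinate rectangle, for `f` dominated pointwise by spinor fields. -/
lemma Shell.integral_sliceSq_le (hδ : S.IsTube δ) (h : S.IsSide e U) {u v : Plane → Spinor}
    (hu : Continuous u) (hcu : HasCompactSupport u) (hv : Continuous v) (hcv : HasCompactSupport v)
    {f : ℝ → ℝ → ℂ} (hf : Continuous (Function.uncurry f)) {A B : ℝ} (hA : 0 ≤ A) (hB : 0 ≤ B)
    (hle : ∀ r ∈ Set.Icc 0 δ, ∀ s, ‖f r s‖ ^ 2 ≤
      A * ‖u (S.tube (e * r, s))‖ ^ 2 + B * ‖v (S.tube (e * r, s))‖ ^ 2) :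
    ∫ r in (0 : ℝ)..δ, sliceSq S.ℓ f r ≤
      2 * A * (∫ x in U, ‖u x‖ ^ 2) + 2 * B * ∫ x in U, ‖v x‖ ^ 2 := by
  have hc : ∀ {u : Plane → Spinor}, Continuous u → Continuous (Function.uncurry
      fun r s => ‖u (S.tube (e * r, s))‖ ^ 2) := fun hu =>
    ((hu.comp (S.contDiff_tubeSide e).continuous).norm).pow 2
  have cont : ∀ {u : Plane → Spinor}, Continuous u → Continuous fun r =>
      ∫ s in (0 : ℝ)..S.ℓ, ‖u (S.tube (e * r, s))‖ ^ 2 := fun hu =>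
    intervalIntegral.continuous_parametric_intervalIntegral_of_continuous' (hc hu) 0 S.ℓ
  have h1 : ∫ r in (0 : ℝ)..δ, sliceSq S.ℓ f r ≤ ∫ r in (0 : ℝ)..δ,
      (A * (∫ s in (0 : ℝ)..S.ℓ, ‖u (S.tube (e * r, s))‖ ^ 2) +
        B * ∫ s in (0 : ℝ)..S.ℓ, ‖v (S.tube (e * r, s))‖ ^ 2) := by
    refine intervalIntegral.integral_mono_on hδ.pos.le
      ((continuous_sliceSq _ hf).intervalIntegrable _ _)
      ((((cont hu).const_mul A).add ((cont hv).const_mul B)).intervalIntegrable _ _) fun r hr => ?_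
    have c3 : ∀ {u : Plane → Spinor}, Continuous u → IntervalIntegrable
        (fun s => ‖u (S.tube (e * r, s))‖ ^ 2) volume 0 S.ℓ := fun hu =>
      ((hc hu).comp (by fun_prop : Continuous fun s : ℝ => (r, s))).intervalIntegrable _ _
    rw [← intervalIntegral.integral_const_mul, ← intervalIntegral.integral_const_mul,
      ← intervalIntegral.integral_add ((c3 hu).const_mul A) ((c3 hv).const_mul B)]
    exact intervalIntegral.integral_mono_on S.ℓ_pos.le
      (((continuous_slice hf r).norm.pow 2).intervalIntegrable _ _)
      (((c3 hu).const_mul A).add ((c3 hv).const_mul B)) fun s _ => hle r hr s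
  rw [intervalIntegral.integral_add (((cont hu).const_mul A).intervalIntegrable _ _)
    (((cont hv).const_mul B).intervalIntegrable _ _), intervalIntegral.integral_const_mul,
    intervalIntegral.integral_const_mul] at h1
  have h2 := mul_le_mul_of_nonneg_left (Shell.integral_strip_le hδ h hu hcu) hA
  have h3 := mul_le_mul_of_nonneg_left (Shell.integral_strip_le hδ h hv hcv) hB
  linarith

/-- The Fourier coefficients of the boundary values of the first component. -/
noncomputable def Shell.bdry0 (S : Shell) (u : Plane → Spinor) : ℤ → ℂ :=
  fourierCoefficient S.ℓ fun s => u (S.γ s) 0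

/-- The Fourier coefficients of the boundary values of the second component, rotated by the
conjugate of the unit tangent. -/
noncomputable def Shell.bdry1 (S : Shell) (u : Plane → Spinor) : ℤ → ℂ :=
  fourierCoefficient S.ℓ fun s => star (S.tau s) * u (S.γ s) 1

/-- The truncated boundary pairing of the two components is bounded by the graph norm of `σ · ∇`
on one side of `Σ`, uniformly in the order of truncation. -/
lemma Shell.exists_norm_truncPairing_le (S : Shell) (h : S.IsSide e U) :
    ∃ C : ℝ, 0 ≤ C ∧ ∀ u v : Plane → Spinor, ContDiff ℝ ∞ u → HasCompactSupport u →
      ContDiff ℝ ∞ v → HasCompactSupport v → ∀ N : ℕ,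
      ‖truncPairing N (S.bdry0 u) (S.bdry1 v)‖ ≤ C * (graphSq U u + graphSq U v) := by
  obtain ⟨δ, hδ⟩ := S.exists_isTube
  have hδ0 := hδ.pos
  have hK : ∀ r ∈ Set.Icc 0 δ, ∀ s, |S.jac e r s - 1| ≤ 1 / (2 * δ) * r := by
    intro r hr s
    have h1 : S.jac e r s - 1 = e * r * S.curv s := by
      rw [Shell.jac]
      ring
    rw [h1, abs_mul, abs_mul, h.abs, one_mul, abs_of_nonneg hr.1, mul_comm]
    refine mul_le_mul_of_nonneg_right ?_ hr.1
    rw [le_div_iff₀ (by positivity)]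
    linarith [hδ.curv_le s]
  obtain ⟨C, hC0, hC⟩ := norm_truncPairing_boundary_le (e := e) S.ℓ_pos hδ0 h.sq
    (S.continuous_jac e) (fun r hr s => (Shell.jac_bounds hδ h hr s).1)
    (fun r hr s => (Shell.jac_bounds hδ h hr s).2) hK
  set κ := 1 / (2 * δ) with hκ
  refine ⟨C * (20 + 4 * κ ^ 2), by positivity, fun u v hu hcu hv hcv N => ?_⟩
  have hw0 : S.bdry0 u = fourierCoefficient S.ℓ (S.comp0 e u 0) := by
    unfold Shell.bdry0 Shell.comp0
    simp only [mul_zero, S.tube_zero]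
  have hz0 : S.bdry1 v = fourierCoefficient S.ℓ (S.comp1 e v 0) := by
    unfold Shell.bdry1 Shell.comp1
    simp only [mul_zero, S.tube_zero]
  rw [hw0, hz0]
  have key := hC (S.comp0 e u) (S.comp1 e v) (S.contDiff_comp0 e hu) (S.periodic_comp0 e u)
    (S.contDiff_comp1 e hv) (S.periodic_comp1 e v) N
  have su := continuous_sigmaGrad hu
  have suc := hasCompactSupport_sigmaGrad hcu
  have sv := continuous_sigmaGrad hv
  have svc := hasCompactSupport_sigmaGrad hcv
  have n1 : ∀ (r s : ℝ), ‖S.comp1 e v r s‖ ^ 2 ≤ ‖v (S.tube (e * r, s))‖ ^ 2 := by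
    intro r s
    rw [Shell.comp1, norm_mul, norm_star, S.norm_tau, one_mul]
    exact norm_coord_sq_le _ 1
  have b1 := Shell.integral_sliceSq_le hδ h hu.continuous hcu su suc (A := 1) (B := 0)
    (S.contDiff_comp0 e hu).continuous zero_le_one le_rfl (fun r _ s => by
      simpa [Shell.comp0] using norm_coord_sq_le (u (S.tube (e * r, s))) 0)
  have b2 := Shell.integral_sliceSq_le hδ h hv.continuous hcv sv svc (A := 1) (B := 0)
    (S.contDiff_comp1 e hv).continuous zero_le_one le_rfl (fun r _ s => by simpa using n1 r s)
  have b3 := Shell.integral_sliceSq_le hδ h hu.continuous hcu su suc (A := 0) (B := 4)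
    (continuous_stripOp (S.continuous_jac e) (S.contDiff_comp0 e hu)) le_rfl (by norm_num)
    (fun r hr s => by
      have hj := Shell.jac_bounds hδ h hr s
      rw [S.stripOp_comp0 e hu, norm_mul, norm_mul, norm_mul, norm_mul, norm_star, S.norm_tau,
        Complex.norm_I, Complex.norm_real, Complex.norm_real, Real.norm_eq_abs, h.abs,
        Real.norm_of_nonneg (by linarith [hj.1]), one_mul, one_mul, one_mul, mul_pow, zero_mul,
        zero_add]
      have h1 := norm_coord_sq_le (sigmaGrad u (S.tube (e * r, s))) 1
      have h2 : S.jac e r s ^ 2 ≤ 4 := by nlinarith [hj.1, hj.2]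
      exact mul_le_mul h2 h1 (sq_nonneg _) (by norm_num))
  have b4 := Shell.integral_sliceSq_le hδ h hv.continuous hcv sv svc (A := 2 * κ ^ 2) (B := 8)
    (continuous_stripOp (e := -e) (S.continuous_jac e) (S.contDiff_comp1 e hv)) (by positivity)
    (by norm_num)
    (fun r hr s => by
      have hj := Shell.jac_bounds hδ h hr s
      have hκ1 : |S.curv s| ≤ κ := by
        rw [hκ, le_div_iff₀ (by positivity)]
        linarith [hδ.curv_le s]
      rw [S.stripOp_comp1 e hv]
      have h1 := norm_coord_sq_le (sigmaGrad v (S.tube (e * r, s))) 0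
      have h2 := n1 r s
      have h3 : ‖-Complex.I * e * S.jac e r s * sigmaGrad v (S.tube (e * r, s)) 0 -
          e * S.curv s * S.comp1 e v r s‖ ≤ 2 * ‖sigmaGrad v (S.tube (e * r, s)) 0‖ +
          κ * ‖S.comp1 e v r s‖ := by
        refine (norm_sub_le _ _).trans (add_le_add ?_ ?_)
        · rw [norm_mul, norm_mul, norm_mul, norm_neg, Complex.norm_I, Complex.norm_real,
            Complex.norm_real, Real.norm_eq_abs, h.abs, Real.norm_of_nonneg (by linarith [hj.1]),
            one_mul, one_mul]
          exact mul_le_mul_of_nonneg_right hj.2 (norm_nonneg _)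
        · rw [norm_mul, norm_mul, Complex.norm_real, Complex.norm_real, Real.norm_eq_abs, h.abs,
            one_mul, Real.norm_eq_abs]
          exact mul_le_mul_of_nonneg_right hκ1 (norm_nonneg _)
      have h4 := pow_le_pow_left₀ (norm_nonneg _) h3 2
      have h5 := mul_le_mul_of_nonneg_left h2 (sq_nonneg κ)
      refine h4.trans ?_
      nlinarith [sq_nonneg (2 * ‖sigmaGrad v (S.tube (e * r, s)) 0‖ - κ * ‖S.comp1 e v r s‖)])
  refine key.trans ?_
  rw [mul_assoc]
  refine mul_le_mul_of_nonneg_left ?_ hC0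
  have p1 := integral_sq_nonneg U u
  have p2 := integral_sq_nonneg U v
  have p3 := integral_sq_nonneg U (sigmaGrad u)
  have p4 := integral_sq_nonneg U (sigmaGrad v)
  unfold graphSq
  nlinarith [mul_nonneg (sq_nonneg κ) p1, mul_nonneg (sq_nonneg κ) p2,
    mul_nonneg (sq_nonneg κ) p3, mul_nonneg (sq_nonneg κ) p4]

end side


/-! ### Green's formula for `σ · ∇` on the two sides of the curve -/

/-- One half of the density `⟨u, σ·∇v⟩ + ⟨σ·∇u, v⟩` in Green's formula; the other half is the
complex conjugate of the same expression with `u` and `v` interchanged. -/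
noncomputable def crossDensity (u v : Plane → Spinor) (x : Plane) : ℂ :=
  star (u x 0) * sigmaGrad v x 0 + v x 1 * star (sigmaGrad u x 1)

lemma continuous_spinor_coord {u : Plane → Spinor} (hu : Continuous u) (j : Fin 2) :
    Continuous fun x => u x j :=
  (EuclideanSpace.proj (𝕜 := ℂ) j : Spinor →L[ℂ] ℂ).continuous.comp hu

lemma continuous_crossDensity {u v : Plane → Spinor} (hu : ContDiff ℝ ∞ u)
    (hv : ContDiff ℝ ∞ v) : Continuous (crossDensity u v) :=
  ((continuous_spinor_coord hu.continuous 0).star.mul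
    (continuous_spinor_coord (continuous_sigmaGrad hv) 0)).add
    ((continuous_spinor_coord hv.continuous 1).mul
      (continuous_spinor_coord (continuous_sigmaGrad hu) 1).star)

lemma integrable_crossDensity {u v : Plane → Spinor} (hu : ContDiff ℝ ∞ u)
    (hv : ContDiff ℝ ∞ v) (hcv : HasCompactSupport v) :
    Integrable (crossDensity u v) := by
  refine (continuous_crossDensity hu hv).integrable_of_hasCompactSupport ?_
  refine HasCompactSupport.intro hcv.isCompact fun x hx => ?_
  have h1 : v x = 0 := image_eq_zero_of_notMem_tsupport hx
  have h2 : sigmaGrad v x = 0 := by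
    have : fderiv ℝ v x = 0 := image_eq_zero_of_notMem_tsupport
      (fun h => hx (tsupport_fderiv_subset ℝ h))
    simp [sigmaGrad, this]
  simp [crossDensity, h1, h2]

/-- Green's formula in tubular coordinates, for `u` that vanishes at the far end of the strip. -/
lemma Shell.integral_strip_crossDensity (S : Shell) {e δ : ℝ} (he : e ^ 2 = 1)
    {u v : Plane → Spinor} (hu : ContDiff ℝ ∞ u) (hv : ContDiff ℝ ∞ v)
    (h0 : ∀ s, u (S.tube (e * δ, s)) = 0) :
    ∫ r in (0 : ℝ)..δ, ∫ s in (0 : ℝ)..S.ℓ,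
      (S.jac e r s : ℂ) * crossDensity u v (S.tube (e * r, s)) =
      -Complex.I * e * ∫ s in (0 : ℝ)..S.ℓ,
        star (u (S.γ s) 0) * (star (S.tau s) * v (S.γ s) 1) := by
  set a := S.comp0 e u with ha
  set b := S.comp1 e v with hb
  have ca := S.contDiff_comp0 e hu
  have cb := S.contDiff_comp1 e hv
  set P : ℝ → ℝ → ℂ := fun r s => b r s * star (a r s) with hP
  have cP : ContDiff ℝ ∞ (Function.uncurry P) := cb.mul (contDiff_star_comp ca)
  have pP : ∀ r, Function.Periodic (P r) S.ℓ := by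
    intro r s
    simp only [hP, ha, hb, S.periodic_comp0 e u r s, S.periodic_comp1 e v r s]
  have dR : ∀ r s, partialR P r s = partialR b r s * star (a r s) + b r s * star (partialR a r s) :=
    fun r s => (hasDerivAt_partialR cP r s).unique
      ((hasDerivAt_partialR cb r s).mul (hasDerivAt_partialR ca r s).star)
  have dS : ∀ r s, partialS P r s = partialS b r s * star (a r s) + b r s * star (partialS a r s) :=
    fun r s => (hasDerivAt_partialS cP r s).unique
      ((hasDerivAt_partialS cb r s).mul (hasDerivAt_partialS ca r s).star)
  have cj := S.continuous_jac e
  have cj' : Continuous fun x : ℝ × ℝ => ((S.jac e x.1 x.2 : ℝ) : ℂ) :=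
    Complex.continuous_ofReal.comp cj
  have ck : Continuous fun x : ℝ × ℝ => ((e * S.curv x.2 : ℝ) : ℂ) :=
    Complex.continuous_ofReal.comp
      (continuous_const.mul (S.contDiff_curv.continuous.comp continuous_snd))
  set X' : ℝ → ℝ → ℂ := fun r s =>
    ((e * S.curv s : ℝ) : ℂ) * P r s + (S.jac e r s : ℂ) * partialR P r s with hX'
  have cX' : Continuous (Function.uncurry X') :=
    (ck.mul cP.continuous).add (cj'.mul (contDiff_partialR cP).continuous)
  have dX : ∀ r s, HasDerivAt (fun r => (S.jac e r s : ℂ) * P r s) (X' r s) r := by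
    intro r s
    have h1 : HasDerivAt (fun r => S.jac e r s) (e * S.curv s) r := by
      have := (((hasDerivAt_id r).const_mul e).mul_const (S.curv s)).const_add 1
      simpa [Shell.jac] using this
    exact h1.ofReal_comp.mul (hasDerivAt_partialR cP r s)
  have he' : (e : ℂ) ^ 2 = 1 := by
    rw [← Complex.ofReal_pow, he, Complex.ofReal_one]
  -- the density times the Jacobian `ϖ` is the divergence `i e ∂_r (ϖ P) + ∂_s P`
  have id : ∀ r s, (S.jac e r s : ℂ) * crossDensity u v (S.tube (e * r, s)) =
      Complex.I * e * X' r s + partialS P r s := by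
    intro r s
    have s1 := S.stripOp_comp1 e hv r s
    have s2 := congrArg star (S.stripOp_comp0 e hu r s)
    have ht := S.tau_mul_star s
    simp only [stripOp, ← ha, ← hb, star_add, star_mul', RCLike.star_def,
      Complex.conj_ofReal, Complex.conj_I, Complex.conj_conj] at s1 s2
    push_cast at s1
    have hv1 : v (S.tube (e * r, s)) 1 = S.tau s * b r s := by
      rw [hb, Shell.comp1, ← mul_assoc, ht, one_mul]
    rw [crossDensity, hv1]
    simp only [hX', dR, dS]
    simp only [hP]
    rw [show u (S.tube (e * r, s)) 0 = a r s from rfl]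
    simp only [RCLike.star_def] at *
    set A := (starRingEnd ℂ) (a r s)
    set AR := (starRingEnd ℂ) (partialR a r s)
    set AS := (starRingEnd ℂ) (partialS a r s)
    push_cast
    linear_combination (-Complex.I * e * A) * s1 - Complex.I * e * b r s * s2 +
      (S.jac e r s * A * sigmaGrad v (S.tube (e * r, s)) 0 +
        S.jac e r s * b r s * S.tau s * (starRingEnd ℂ) (sigmaGrad u (S.tube (e * r, s)) 1) -
        A * partialS b r s - b r s * AS) * ((e : ℂ) ^ 2 * Complex.I_mul_I - he')
  have inner : ∀ r, ∫ s in (0 : ℝ)..S.ℓ, (S.jac e r s : ℂ) * crossDensity u v (S.tube (e * r, s)) =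
      Complex.I * e * ∫ s in (0 : ℝ)..S.ℓ, X' r s := by
    intro r
    have d1 := continuous_slice cX' r
    have d2 := continuous_slice (contDiff_partialS cP).continuous r
    simp only [id]
    rw [intervalIntegral.integral_add (by exact (continuous_const.mul d1).intervalIntegrable _ _)
      (d2.intervalIntegrable _ _), intervalIntegral.integral_const_mul,
      intervalIntegral.integral_eq_sub_of_hasDerivAt (fun s _ => hasDerivAt_partialS cP r s)
      (d2.intervalIntegrable _ _)]
    have : P r S.ℓ = P r 0 := by simpa using pP r 0
    rw [this, sub_self, add_zero]
  have dI : ∀ r, HasDerivAt (fun r => ∫ s in (0 : ℝ)..S.ℓ, (S.jac e r s : ℂ) * P r s)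
      (∫ s in (0 : ℝ)..S.ℓ, X' r s) r :=
    hasDerivAt_intervalIntegral_of_continuous 0 S.ℓ (F := fun r s => (S.jac e r s : ℂ) * P r s)
      (cj'.mul cP.continuous) cX' dX
  simp only [inner]
  rw [intervalIntegral.integral_const_mul, intervalIntegral.integral_eq_sub_of_hasDerivAt
    (fun r _ => dI r) ((intervalIntegral.continuous_parametric_intervalIntegral_of_continuous'
      cX' 0 S.ℓ).intervalIntegrable _ _)]
  have z1 : ∀ s, P δ s = 0 := by
    intro s
    simp [hP, ha, Shell.comp0, h0 s]
  have z2 : ∀ s, (S.jac e 0 s : ℂ) * P 0 s =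
      star (u (S.γ s) 0) * (star (S.tau s) * v (S.γ s) 1) := by
    intro s
    simp only [hP, ha, hb, Shell.comp0, Shell.comp1, Shell.jac, mul_zero, zero_mul, add_zero,
      S.tube_zero, Complex.ofReal_one]
    ring
  simp only [z1, z2, mul_zero, intervalIntegral.integral_zero, zero_sub]
  ring

/-- Integration by parts against a field with compact support in `U`. -/
lemma integral_crossDensity_eq_zero {U : Set Plane} {u v : Plane → Spinor} (hu : ContDiff ℝ ∞ u)
    (hcu : HasCompactSupport u) (hU : tsupport u ⊆ U) (hv : ContDiff ℝ ∞ v)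
    (hcv : HasCompactSupport v) : ∫ x in U, crossDensity u v x = 0 := by
  have hz : ∀ x ∉ U, crossDensity u v x = 0 := by
    intro x hx
    have h1 : u x = 0 := image_eq_zero_of_notMem_tsupport fun h => hx (hU h)
    have h2 : fderiv ℝ u x = 0 := image_eq_zero_of_notMem_tsupport
      (fun h => hx (hU (tsupport_fderiv_subset ℝ h)))
    simp [crossDensity, h1, sigmaGrad, h2]
  rw [setIntegral_eq_integral_of_forall_compl_eq_zero hz]
  set f : Plane → ℂ := fun x => star (u x 0) with hf
  set g : Plane → ℂ := fun x => v x 1 with hg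
  have cf : ContDiff ℝ ∞ f := contDiff_star_comp (contDiff_spinor_coord hu 0)
  have cg : ContDiff ℝ ∞ g := contDiff_spinor_coord hv 1
  have sf : HasCompactSupport f := hcu.comp_left (g := fun w : Spinor => star (w 0)) (by simp)
  have sg : HasCompactSupport g := hcv.comp_left (g := fun w : Spinor => w 1) (by simp)
  have df : ∀ x w, fderiv ℝ f x w = star (fderiv ℝ u x w 0) := by
    intro x w
    have h1 := (((EuclideanSpace.proj (𝕜 := ℂ) 0 :
      Spinor →L[ℂ] ℂ).restrictScalars ℝ).hasFDerivAt.comp x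
        (hu.differentiable (by simp) x).hasFDerivAt)
    have h2 := (Complex.conjCLE.toContinuousLinearMap.hasFDerivAt.comp x h1).fderiv
    have h3 := congrArg (fun L : Plane →L[ℝ] ℂ => L w) h2
    exact h3
  have dg : ∀ x w, fderiv ℝ g x w = fderiv ℝ v x w 1 := by
    intro x w
    have h1 := (((EuclideanSpace.proj (𝕜 := ℂ) 1 :
      Spinor →L[ℂ] ℂ).restrictScalars ℝ).hasFDerivAt.comp x
        (hv.differentiable (by simp) x).hasFDerivAt).fderiv
    exact congrArg (fun L : Plane →L[ℝ] ℂ => L w) h1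
  have cdf : ∀ w, Continuous fun x => fderiv ℝ f x w := fun w =>
    (cf.continuous_fderiv (by simp)).clm_apply continuous_const
  have cdg : ∀ w, Continuous fun x => fderiv ℝ g x w := fun w =>
    (cg.continuous_fderiv (by simp)).clm_apply continuous_const
  have i1 : ∀ w, Integrable fun x => f x * fderiv ℝ g x w := fun w =>
    (cf.continuous.mul (cdg w)).integrable_of_hasCompactSupport sf.mul_right
  have i2 : ∀ w, Integrable fun x => fderiv ℝ f x w * g x := fun w =>
    ((cdf w).mul cg.continuous).integrable_of_hasCompactSupport sg.mul_left
  have ibp : ∀ w, ∫ x, (f x * fderiv ℝ g x w + fderiv ℝ f x w * g x) = 0 := by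
    intro w
    rw [integral_add (i1 w) (i2 w),
      integral_mul_fderiv_eq_neg_fderiv_mul_of_integrable (i2 w) (i1 w)
        ((cf.continuous.mul cg.continuous).integrable_of_hasCompactSupport sf.mul_right)
      (fun x _ => cf.differentiable (by simp) x) (fun x _ => cg.differentiable (by simp) x)]
    ring
  have e : ∀ x, crossDensity u v x =
      (f x * fderiv ℝ g x (EuclideanSpace.single 0 1) +
        fderiv ℝ f x (EuclideanSpace.single 0 1) * g x) -
      Complex.I * (f x * fderiv ℝ g x (EuclideanSpace.single 1 1) +
        fderiv ℝ f x (EuclideanSpace.single 1 1) * g x) := by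
    intro x
    rw [crossDensity, sigmaGrad_apply_zero, sigmaGrad_apply_one, df, df, dg, dg]
    simp only [hf, hg, star_add, star_mul', RCLike.star_def, Complex.conj_I]
    ring
  simp only [e]
  rw [integral_sub (by exact (i1 _).add (i2 _))
    (by exact ((i1 _).add (i2 _)).const_mul _), integral_const_mul, ibp, ibp]
  simp


section green

variable {S : Shell} {e δ : ℝ} {U : Set Plane}

lemma Shell.IsTube.mono (hδ : S.IsTube δ) {δ' : ℝ} (h0 : 0 < δ') (h : δ' ≤ δ) :
    S.IsTube δ' where
  pos := h0
  curv_le s := (mul_le_mul_of_nonneg_left h (abs_nonneg _)).trans (hδ.curv_le s)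
  injOn := hδ.injOn.mono (Set.prod_mono (Set.Ioo_subset_Ioo (neg_le_neg h) h) le_rfl)
  inner p hp := hδ.inner p ⟨hp.1, hp.2.trans_le h⟩
  outer p hp := hδ.outer p ⟨hp.1, hp.2.trans_le h⟩

lemma Shell.isOpen_image_tube (hδ : S.IsTube δ) :
    IsOpen (S.tube '' (Set.Ioo (-δ) δ ×ˢ Set.univ)) := by
  rw [isOpen_iff_mem_nhds]
  rintro _ ⟨x, hx, rfl⟩
  have hne : 1 + x.1 * S.curv x.2 ≠ 0 := by
    intro h
    have h1 : |x.1 * S.curv x.2| = 1 := by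
      rw [show x.1 * S.curv x.2 = -1 by linarith]
      simp
    rw [abs_mul] at h1
    have h2 : |x.1| < δ := abs_lt.2 hx.1
    nlinarith [hδ.curv_le x.2, abs_nonneg (S.curv x.2)]
  rw [← (S.tube_local hne).1]
  exact image_mem_map ((isOpen_Ioo.prod isOpen_univ).mem_nhds hx)

/-- The closed tube of half-width `δ` around `Σ`. -/
def Shell.closedTube (S : Shell) (δ : ℝ) : Set Plane :=
  S.tube '' (Set.Icc (-δ) δ ×ˢ Set.Icc 0 S.ℓ)

/-- A cut-off function that is `1` near the curve and supported in a thin closed tube. -/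
lemma Shell.exists_cutoff (hδ : S.IsTube δ) :
    ∃ χ : Plane → ℝ, ContDiff ℝ ∞ χ ∧ (∀ x ∈ frontier S.Ω, ∀ᶠ y in 𝓝 x, χ y = 1) ∧
      tsupport χ ⊆ S.closedTube δ := by
  set t := S.closedTube δ with ht
  have htc : IsClosed t :=
    ((isCompact_Icc.prod isCompact_Icc).image S.contDiff_tube.continuous).isClosed
  have hsub : S.tube '' (Set.Ioo (-δ) δ ×ˢ Set.univ) ⊆ t := by
    rintro _ ⟨⟨p, s⟩, ⟨hp, -⟩, rfl⟩
    obtain ⟨s', hs', h⟩ := S.exists_Ico_tube p s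
    exact ⟨(p, s'), ⟨Set.Ioo_subset_Icc_self hp, Set.Ico_subset_Icc_self hs'⟩, h⟩
  have hfr : frontier S.Ω ⊆ interior t := by
    rw [← S.range_eq]
    rintro _ ⟨s, rfl⟩
    refine interior_maximal hsub (S.isOpen_image_tube hδ)
      ⟨(0, s), ⟨⟨?_, hδ.pos⟩, trivial⟩, S.tube_zero s⟩
    simpa using hδ.pos
  obtain ⟨f, h1, h0, -⟩ := exists_contMDiffMap_one_nhds_of_subset_interior
    (n := (⊤ : ℕ∞)) (modelWithCornersSelf ℝ Plane) isClosed_frontier hfr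
  refine ⟨f, contMDiff_iff_contDiff.1 f.contMDiff, fun x hx => ?_, ?_⟩
  · exact (eventually_nhdsSet_iff_forall.1 h1) x hx
  · refine closure_minimal (fun x hx => ?_) htc
    by_contra hxt
    exact hx (h0 x hxt)

lemma Shell.IsSide.eq_or (h : S.IsSide e U) : e = 1 ∨ e = -1 := by
  rcases h with ⟨h, -⟩ | ⟨h, -⟩
  · exact Or.inl h
  · exact Or.inr h

lemma Shell.notMem_closedTube (hδ : S.IsTube δ) (h : S.IsSide e U) {δ' : ℝ} (hlt : δ' < δ)
    {x : Plane} (hxU : x ∈ U) (hx : x ∉ S.halfTube e δ) : x ∉ S.closedTube δ' := by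
  rintro ⟨⟨p, s⟩, ⟨hp, hs⟩, rfl⟩
  have hp0 : p ≠ 0 := by
    rintro rfl
    rw [S.tube_zero] at hxU
    exact h.curve_notMem s hxU
  have hpe : p = e * (e * p) := by
    rw [← mul_assoc, ← sq, h.sq, one_mul]
  have hlt : |e * p| < δ := by
    rw [abs_mul, h.abs, one_mul]
    exact (abs_le.2 hp).trans_lt hlt
  rcases lt_or_ge 0 (e * p) with hpos | hneg
  · obtain ⟨s', hs', h'⟩ := S.exists_Ico_tube p s
    refine hx ⟨(e * p, s'), ⟨⟨hpos, (abs_lt.1 hlt).2⟩, hs'⟩, ?_⟩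
    simpa only [← hpe] using h'
  · have hne : e * p ≠ 0 := by
      rcases h.eq_or with rfl | rfl <;> simpa using hp0
    have hpos : 0 < -(e * p) := by
      have := lt_of_le_of_ne hneg hne
      linarith
    refine h.tube_neg_notMem (r := -(e * p)) hδ ⟨hpos, by linarith [(abs_lt.1 hlt).1]⟩ s ?_
    rwa [neg_mul_neg, ← hpe]

lemma Shell.tube_notMem_closedTube (hδ : S.IsTube δ) {p δ' : ℝ} (hp : |p| < δ) (h' : δ' < |p|)
    (s : ℝ) : S.tube (p, s) ∉ S.closedTube δ' := by
  rintro ⟨⟨q, s₁⟩, ⟨hq, -⟩, heq⟩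
  have hq' : |q| ≤ δ' := abs_le.2 hq
  obtain ⟨s', hs', e1⟩ := S.exists_Ico_tube q s₁
  obtain ⟨s'', hs'', e2⟩ := S.exists_Ico_tube p s
  have := hδ.injOn (x₁ := (q, s')) (x₂ := (p, s''))
    ⟨abs_lt.1 (by linarith), hs'⟩ ⟨abs_lt.1 hp, hs''⟩ (e1.trans (heq.trans e2.symm))
  have hpp : q = p := congrArg Prod.fst this
  rw [hpp] at hq'
  linarith

/-- Cutting `u` off outside a thin tube does not change the integral in Green's formula, since the
part that is removed has compact support in `U`. -/
lemma Shell.exists_localized (hδ : S.IsTube δ) (h : S.IsSide e U) {u : Plane → Spinor}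
    (hu : ContDiff ℝ ∞ u) (hcu : HasCompactSupport u) :
    ∃ w : Plane → Spinor, ContDiff ℝ ∞ w ∧ (∀ s, w (S.γ s) = u (S.γ s)) ∧
      (∀ x ∉ S.closedTube δ, w =ᶠ[𝓝 x] 0) ∧
      ∀ v : Plane → Spinor, ContDiff ℝ ∞ v → HasCompactSupport v →
        ∫ x in U, crossDensity u v x = ∫ x in U, crossDensity w v x := by
  obtain ⟨χ, cχ, χ1, χs⟩ := S.exists_cutoff hδ
  set w : Plane → Spinor := fun x => χ x • u x with hw
  set q : Plane → Spinor := fun x => (1 - χ x) • u x with hq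
  have cw : ContDiff ℝ ∞ w := cχ.smul hu
  have cq : ContDiff ℝ ∞ q := (contDiff_const.sub cχ).smul hu
  have cpq : HasCompactSupport q := hcu.mono fun x hx hx' => hx (by simp [hq, hx'])
  have hsum : u = w + q := by
    funext x
    simp [hw, hq, sub_smul]
  have hdens : ∀ v x, crossDensity u v x = crossDensity w v x + crossDensity q v x := by
    intro v x
    have e1 : sigmaGrad u x = sigmaGrad w x + sigmaGrad q x := by
      conv_lhs => rw [hsum]
      rw [sigmaGrad_add cw cq, Pi.add_apply]
    have e2 : u x = w x + q x := congrFun hsum x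
    simp only [crossDensity, e1, e2, PiLp.add_apply, star_add]
    ring
  -- the part away from the curve has compact support inside `U`
  set φ : Plane → Spinor := U.indicator q with hφ
  have φout : ∀ x ∉ U, φ =ᶠ[𝓝 x] 0 := by
    intro x hx
    by_cases hxc : x ∈ closure U
    · have hxf : x ∈ frontier S.Ω := h.frontier_subset ⟨hxc, by rwa [h.isOpen.interior_eq]⟩
      filter_upwards [χ1 x hxf] with y hy
      by_cases hyU : y ∈ U
      · simp [hφ, hyU, hq, hy]
      · simp [hφ, hyU]
    · filter_upwards [isClosed_closure.isOpen_compl.mem_nhds hxc] with y hy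
      have : y ∉ U := fun hyU => hy (subset_closure hyU)
      simp [hφ, this]
  have φin : ∀ x ∈ U, φ =ᶠ[𝓝 x] q := by
    intro x hx
    filter_upwards [h.isOpen.mem_nhds hx] with y hy
    simp [hφ, hy]
  have cφ : ContDiff ℝ ∞ φ := by
    rw [contDiff_iff_contDiffAt]
    intro x
    by_cases hx : x ∈ U
    · exact cq.contDiffAt.congr_of_eventuallyEq (φin x hx)
    · exact contDiffAt_const.congr_of_eventuallyEq (φout x hx)
  have φU : tsupport φ ⊆ U := by
    intro x hx
    by_contra hxU
    exact (notMem_tsupport_iff_eventuallyEq.2 (φout x hxU)) hx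
  have cpφ : HasCompactSupport φ :=
    cpq.mono (Set.support_indicator.trans_subset Set.inter_subset_right)
  refine ⟨w, cw, fun s => ?_, fun x hx => ?_, fun v hv hcv => ?_⟩
  · have : χ (S.γ s) = 1 := (χ1 _ (S.range_eq ▸ Set.mem_range_self s)).self_of_nhds
    simp [hw, this]
  · have := notMem_tsupport_iff_eventuallyEq.1 fun hx' => hx (χs hx')
    filter_upwards [this] with y hy
    simp [hw, hy]
  · have zero : ∫ x in U, crossDensity q v x = 0 := by
      rw [← integral_crossDensity_eq_zero cφ cpφ φU hv hcv]
      refine setIntegral_congr_fun h.isOpen.measurableSet fun x hx => ?_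
      simp only [crossDensity, sigmaGrad, (φin x hx).fderiv_eq, (φin x hx).eq_of_nhds]
    simp only [hdens]
    rw [integral_add (by exact (integrable_crossDensity cw hv hcv).integrableOn)
      (by exact (integrable_crossDensity cq hv hcv).integrableOn), zero, add_zero]

/-- Green's formula for `σ · ∇` on one side of `Σ`, by localization to the tube. -/
lemma Shell.integral_crossDensity (h : S.IsSide e U) {u v : Plane → Spinor}
    (hu : ContDiff ℝ ∞ u) (hcu : HasCompactSupport u) (hv : ContDiff ℝ ∞ v)
    (hcv : HasCompactSupport v) :
    ∫ x in U, crossDensity u v x = -Complex.I * e * ∫ s in (0 : ℝ)..S.ℓ,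
      star (u (S.γ s) 0) * (star (S.tau s) * v (S.γ s) 1) := by
  obtain ⟨δ, hδ⟩ := S.exists_isTube
  have hδ0 := hδ.pos
  have hδ2 : S.IsTube (δ / 2) := hδ.mono (by positivity) (by linarith)
  have hδ4 : S.IsTube (δ / 4) := hδ.mono (by positivity) (by linarith)
  obtain ⟨w, cw, bd, wt, hint⟩ := Shell.exists_localized hδ4 h hu hcu
  have he : |e * (δ / 2)| = δ / 2 := by
    rw [abs_mul, h.abs, one_mul, abs_of_pos (by positivity)]
  have h0 : ∀ s, w (S.tube (e * (δ / 2), s)) = 0 := fun s =>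
    (wt _ (Shell.tube_notMem_closedTube hδ (by rw [he]; linarith) (by rw [he]; linarith)
      s)).eq_of_nhds
  have near : ∫ x in U, crossDensity w v x = ∫ x in S.halfTube e (δ / 2), crossDensity w v x := by
    refine setIntegral_eq_of_subset_of_forall_sdiff_eq_zero h.isOpen.measurableSet
      (Shell.halfTube_subset hδ2 h) fun x hx => ?_
    have := wt x (Shell.notMem_closedTube hδ2 h (by linarith) hx.1 hx.2)
    simp [crossDensity, sigmaGrad, this.fderiv_eq, this.eq_of_nhds]
  rw [hint v hv hcv, near, Shell.integral_halfTube hδ2 h (continuous_crossDensity cw hv)]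
  simp only [Complex.real_smul]
  rw [S.integral_strip_crossDensity h.sq cw hv h0]
  simp only [bd]

end green


/-! ### Convergence in `H^{-1/2}` and Fourier coefficients of traces -/

lemma summable_weighted_fourierCoefficient {ℓ : ℝ} (hℓ : 0 < ℓ) (ψ : SmoothPeriodic ℓ) :
    Summable fun n : ℤ => (1 + |(n : ℝ)|) * ‖fourierCoefficient ℓ ψ n‖ ^ 2 := by
  have hψ : ContDiff ℝ ∞ (ψ : ℝ → ℂ) := ψ.2.1
  have hd : ∀ s, HasDerivAt (ψ : ℝ → ℂ) (deriv ψ s) s := fun s =>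
    (hψ.differentiable (by simp) s).hasDerivAt
  have hdc : Continuous (deriv (ψ : ℝ → ℂ)) := (contDiff_infty_iff_deriv.1 hψ).2.continuous
  have hper : (ψ : ℝ → ℂ) ℓ = (ψ : ℝ → ℂ) 0 := by simpa using ψ.2.2 0
  have s0 := (hasSum_sq_fourierCoefficient hℓ hψ.continuous).summable
  have s1 := (hasSum_sq_fourierCoefficient hℓ hdc).summable
  set κ : ℝ := (ℓ / (2 * Real.pi)) ^ 2
  refine Summable.of_nonneg_of_le (fun n => by positivity) (fun n => ?_)
    ((s0.mul_left 2).add (s1.mul_left κ))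
  rw [fourierCoefficient_deriv hℓ hd hdc hper]
  have e : ‖(2 * Real.pi * Complex.I * n / ℓ : ℂ) * fourierCoefficient ℓ ψ n‖ ^ 2 =
      (2 * Real.pi / ℓ) ^ 2 * |(n : ℝ)| ^ 2 * ‖fourierCoefficient ℓ ψ n‖ ^ 2 := by
    simp only [norm_mul, norm_div, Complex.norm_I, Complex.norm_real, Complex.norm_ofNat,
      Complex.norm_intCast, Real.norm_of_nonneg Real.pi_pos.le, Real.norm_of_nonneg hℓ.le]
    ring
  have hκ : κ * (2 * Real.pi / ℓ) ^ 2 = 1 := by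
    have := Real.pi_pos
    simp only [κ]
    field_simp
  rw [e, ← mul_assoc, ← mul_assoc, hκ, one_mul, ← add_mul]
  refine mul_le_mul_of_nonneg_right ?_ (sq_nonneg _)
  nlinarith [sq_nonneg (|(n : ℝ)| - 1)]

/-- Smooth functions lie in `H^{1/2}`. -/
lemma halfNorm_lt_top {ℓ : ℝ} (hℓ : 0 < ℓ) (ψ : SmoothPeriodic ℓ) : halfNorm ψ < ⊤ := by
  refine ENNReal.rpow_lt_top_of_nonneg (by norm_num) ?_
  have h := (summable_weighted_fourierCoefficient hℓ ψ).tsum_ofReal_ne_top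
  convert h using 3 with n
  rw [ENNReal.ofReal_mul (by positivity), ENNReal.ofReal_pow (norm_nonneg _), ofReal_norm]

lemma halfNorm_smul {ℓ : ℝ} (c : ℂ) (ψ : SmoothPeriodic ℓ) :
    halfNorm (c • ψ) = ‖c‖ₑ * halfNorm ψ := by
  have h : ∀ n, fourierCoefficient ℓ (c • ψ : SmoothPeriodic ℓ) n =
      c * fourierCoefficient ℓ ψ n := fun n =>
    fourierCoefficient_const_mul ℓ c ψ n
  simp only [halfNorm, h, enorm_mul, mul_pow, mul_left_comm _ (‖c‖ₑ ^ 2)]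
  rw [ENNReal.tsum_mul_left, ENNReal.mul_rpow_of_nonneg _ _ (by norm_num),
    ← ENNReal.rpow_natCast, ← ENNReal.rpow_mul]
  norm_num

/-- Convergence in the dual norm of `H^{1/2}` implies pointwise convergence of functionals. -/
lemma tendsto_zero_of_negHalfNorm {ℓ : ℝ} (hℓ : 0 < ℓ) {F : ℕ → BoundaryFunctional ℓ}
    (hF : Tendsto (fun k => negHalfNorm (F k)) atTop (𝓝 0)) (ψ : SmoothPeriodic ℓ) :
    Tendsto (fun k => F k ψ) atTop (𝓝 0) := by
  have hψ := (halfNorm_lt_top hℓ ψ).ne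
  -- scale `ψ` into the unit ball
  set t : ℝ := (1 + (halfNorm ψ).toReal)⁻¹ with ht
  have hpos : 0 < 1 + (halfNorm ψ).toReal := by positivity
  have ht0 : 0 < t := by positivity
  have hle : halfNorm ((t : ℂ) • ψ) ≤ 1 := by
    rw [halfNorm_smul, ← ofReal_norm, Complex.norm_real, Real.norm_of_nonneg ht0.le,
      ← ENNReal.ofReal_toReal hψ, ← ENNReal.ofReal_mul ht0.le, ENNReal.ofReal_le_one, ht,
      inv_mul_le_iff₀ hpos]
    linarith
  have h1 : Tendsto (fun k => F k ((t : ℂ) • ψ)) atTop (𝓝 0) := by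
    rw [tendsto_zero_iff_enorm_tendsto_zero]
    exact tendsto_of_tendsto_of_tendsto_of_le_of_le tendsto_const_nhds hF (fun _ => zero_le)
      fun k => le_iSup₂ (f := fun ψ (_ : halfNorm ψ ≤ 1) => ‖F k ψ‖ₑ) _ hle
  have h2 := h1.const_mul (t : ℂ)⁻¹
  rw [mul_zero] at h2
  refine h2.congr fun k => ?_
  rw [map_smul, smul_eq_mul, inv_mul_cancel_left₀]
  exact_mod_cast ht0.ne'

/-- The boundary values of a continuous spinor field, as functionals. -/
noncomputable def Shell.bdryFunctional (S : Shell) {u : Plane → Spinor} (hu : Continuous u)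
    (j : Fin 2) : BoundaryFunctional S.ℓ where
  toFun := S.boundaryPairing u j
  map_add' ψ ψ' := by
    unfold Shell.boundaryPairing
    rw [← intervalIntegral.integral_add (S.intervalIntegrable_boundary hu j ψ)
      (S.intervalIntegrable_boundary hu j ψ')]
    congr 1
    funext s
    simp [mul_add]
  map_smul' c ψ := by
    unfold Shell.boundaryPairing
    rw [RingHom.id_apply, smul_eq_mul, ← intervalIntegral.integral_const_mul]
    congr 1
    funext s
    simp only [SetLike.val_smul, Pi.smul_apply, smul_eq_mul]
    ring

/-- The conjugate of the complex unit tangent, as a smooth function on `Σ`. -/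
noncomputable def Shell.tauBar (S : Shell) : SmoothPeriodic S.ℓ :=
  ⟨fun s => star (S.tau s), contDiff_star_comp S.contDiff_tau, fun s => by
    simp only [S.periodic_tau s]⟩

/-- The Fourier coefficients of the first component of a trace. -/
noncomputable def Shell.coef0 (S : Shell) (φ : Fin 2 → BoundaryFunctional S.ℓ) (n : ℤ) : ℂ :=
  (1 / S.ℓ : ℂ) * φ 0 (expPeriodic S.ℓ_pos (-n))

/-- The Fourier coefficients of the second component of a trace, rotated by the conjugate of
the unit tangent. -/
noncomputable def Shell.coef1 (S : Shell) (φ : Fin 2 → BoundaryFunctional S.ℓ) (n : ℤ) : ℂ :=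
  (1 / S.ℓ : ℂ) * φ 1 (S.tauBar * expPeriodic S.ℓ_pos (-n))

lemma Shell.bdry0_eq_coef0 (S : Shell) {u : Plane → Spinor} (hu : Continuous u) :
    S.bdry0 u = S.coef0 (S.bdryFunctional hu) := by
  funext n
  rw [Shell.bdry0, fourierCoefficient_eq_integral S.ℓ_pos, Shell.coef0]
  congr 1
  exact intervalIntegral.integral_congr fun s _ => mul_comm _ _

lemma Shell.bdry1_eq_coef1 (S : Shell) {u : Plane → Spinor} (hu : Continuous u) :
    S.bdry1 u = S.coef1 (S.bdryFunctional hu) := by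
  funext n
  rw [Shell.bdry1, fourierCoefficient_eq_integral S.ℓ_pos, Shell.coef1]
  congr 1
  refine intervalIntegral.integral_congr fun s _ => ?_
  change _ = u (S.γ s) 1 * (star (S.tau s) * (expPeriodic S.ℓ_pos (-n) : ℝ → ℂ) s)
  ring

section trace

variable {S : Shell} {U : Set Plane} {φ : Fin 2 → BoundaryFunctional S.ℓ}
  {u : ℕ → Plane → Spinor}

lemma Shell.tendsto_bdryFunctional (hu : ∀ k, Continuous (u k)) {j : Fin 2}
    (h : Tendsto (fun k => negHalfNorm fun ψ => S.boundaryPairing (u k) j ψ - φ j ψ) atTop (𝓝 0))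
    (ψ : SmoothPeriodic S.ℓ) :
    Tendsto (fun k => S.bdryFunctional (hu k) j ψ) atTop (𝓝 (φ j ψ)) := by
  have h1 := tendsto_zero_of_negHalfNorm S.ℓ_pos
    (F := fun k => S.bdryFunctional (hu k) j - φ j) h ψ
  have h2 := h1.add_const (φ j ψ)
  rw [zero_add] at h2
  exact h2.congr fun k => by simp

lemma Shell.tendsto_truncPairing_bdry (hu : ∀ k, Continuous (u k))
    (h : ∀ j, Tendsto (fun k => negHalfNorm fun ψ => S.boundaryPairing (u k) j ψ - φ j ψ) atTop
      (𝓝 0)) (N : ℕ) :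
    Tendsto (fun k => truncPairing N (S.bdry0 (u k)) (S.bdry1 (u k))) atTop
      (𝓝 (truncPairing N (S.coef0 φ) (S.coef1 φ))) := by
  simp only [S.bdry0_eq_coef0 (hu _), S.bdry1_eq_coef1 (hu _)]
  refine tendsto_finsetSum _ fun n _ => ?_
  exact ((Shell.tendsto_bdryFunctional hu (h 0) _).const_mul _).mul
    ((Shell.tendsto_bdryFunctional hu (h 1) _).const_mul _).star

end trace


/-! ### Green's formula for traces -/

/-- Optimization over `t` in `t A + B / t`; the shift by `ε` covers `A = 0` and `B = 0`. -/
lemma le_mul_sqrt_of_forall_scale {X C A B : ℝ} (hC : 0 ≤ C) (hA : 0 ≤ A) (hB : 0 ≤ B)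
    (h : ∀ t : ℝ, 0 < t → X ≤ C * (t * A + t⁻¹ * B)) : X ≤ 2 * C * √A * √B := by
  have h1 : ∀ ε : ℝ, 0 < ε → X ≤ C * ((√B + ε) * √A + (√A + ε) * √B) := by
    intro ε hε
    have hx : 0 < √B + ε := by positivity
    have hy : 0 < √A + ε := by positivity
    have e1 : (√B + ε) / (√A + ε) * A ≤ (√B + ε) * √A := by
      rw [div_mul_eq_mul_div, div_le_iff₀ hy, mul_assoc]
      refine mul_le_mul_of_nonneg_left ?_ hx.le
      nlinarith [Real.mul_self_sqrt hA, Real.sqrt_nonneg A]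
    have e2 : ((√B + ε) / (√A + ε))⁻¹ * B ≤ (√A + ε) * √B := by
      rw [inv_div, div_mul_eq_mul_div, div_le_iff₀ hx, mul_assoc]
      refine mul_le_mul_of_nonneg_left ?_ hy.le
      nlinarith [Real.mul_self_sqrt hB, Real.sqrt_nonneg B]
    exact (h _ (div_pos hx hy)).trans (mul_le_mul_of_nonneg_left (add_le_add e1 e2) hC)
  have h2 : Tendsto (fun ε : ℝ => C * ((√B + ε) * √A + (√A + ε) * √B)) (𝓝[>] 0)
      (𝓝 (C * ((√B + 0) * √A + (√A + 0) * √B))) := by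
    refine Tendsto.mono_left ?_ nhdsWithin_le_nhds
    exact Continuous.tendsto (by fun_prop) 0
  have h3 := ge_of_tendsto h2 (eventually_mem_nhdsWithin.mono fun ε hε => h1 ε hε)
  linarith

lemma graphSq_smul (U : Set Plane) (c : ℂ) {u : Plane → Spinor} (hu : ContDiff ℝ ∞ u) :
    graphSq U (c • u) = ‖c‖ ^ 2 * graphSq U u := by
  simp only [graphSq, sigmaGrad_smul c hu, Pi.smul_apply, norm_smul, mul_pow, integral_const_mul]
  ring

section trace

variable {S : Shell} {e : ℝ} {U : Set Plane}

lemma truncPairing_mul_mul (N : ℕ) (a b : ℤ → ℂ) (c d : ℂ) :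
    truncPairing N (fun n => c * a n) (fun n => d * b n) = c * star d * truncPairing N a b := by
  simp only [truncPairing, Finset.mul_sum, star_mul']
  refine Finset.sum_congr rfl fun n _ => ?_
  ring

lemma Shell.bdry0_smul (S : Shell) (c : ℂ) (u : Plane → Spinor) :
    S.bdry0 (c • u) = fun n => c * S.bdry0 u n := by
  funext n
  exact fourierCoefficient_const_mul _ _ _ _

lemma Shell.bdry1_smul (S : Shell) (c : ℂ) (u : Plane → Spinor) :
    S.bdry1 (c • u) = fun n => c * S.bdry1 u n := by
  funext n
  rw [Shell.bdry1, Shell.bdry1, ← fourierCoefficient_const_mul]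
  congr 1
  funext s
  simp only [Pi.smul_apply, PiLp.smul_apply, smul_eq_mul]
  ring

lemma Shell.bdry0_add (S : Shell) {u v : Plane → Spinor} (hu : Continuous u) (hv : Continuous v) :
    S.bdry0 (u + v) = S.bdry0 u + S.bdry0 v := by
  have hγ := S.smooth.continuous
  funext n
  exact fourierCoefficient_add S.ℓ_pos ((continuous_spinor_coord hu 0).comp hγ)
    ((continuous_spinor_coord hv 0).comp hγ) n

lemma Shell.bdry1_add (S : Shell) {u v : Plane → Spinor} (hu : Continuous u) (hv : Continuous v) :
    S.bdry1 (u + v) = S.bdry1 u + S.bdry1 v := by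
  have hγ := S.smooth.continuous
  have hτ := S.contDiff_tau.continuous.star
  funext n
  refine Eq.trans ?_ (fourierCoefficient_add S.ℓ_pos
    (f := fun s => star (S.tau s) * u (S.γ s) 1) (g := fun s => star (S.tau s) * v (S.γ s) 1)
    (hτ.mul ((continuous_spinor_coord hu 1).comp hγ))
    (hτ.mul ((continuous_spinor_coord hv 1).comp hγ)) n)
  rw [Shell.bdry1]
  congr 1
  funext s
  simp only [Pi.add_apply, PiLp.add_apply]
  ring

/-- The truncated boundary pairing is bounded by the product of the graph norms. -/
lemma Shell.exists_norm_truncPairing_le_mul (S : Shell) (h : S.IsSide e U) :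
    ∃ C : ℝ, 0 ≤ C ∧ ∀ u v : Plane → Spinor, ContDiff ℝ ∞ u → HasCompactSupport u →
      ContDiff ℝ ∞ v → HasCompactSupport v → ∀ N : ℕ,
      ‖truncPairing N (S.bdry0 u) (S.bdry1 v)‖ ≤ C * √(graphSq U u) * √(graphSq U v) := by
  obtain ⟨C, hC0, hC⟩ := S.exists_norm_truncPairing_le h
  refine ⟨2 * C, by positivity, fun u v hu hcu hv hcv N => ?_⟩
  refine le_mul_sqrt_of_forall_scale hC0 (graphSq_nonneg _ _) (graphSq_nonneg _ _) fun t ht => ?_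
  have hs : 0 < √t := Real.sqrt_pos.2 ht
  have hsq : √t ^ 2 = t := Real.sq_sqrt ht.le
  have key := hC ((√t : ℂ) • u) ((((√t)⁻¹ : ℝ) : ℂ) • v) (hu.const_smul (√t : ℂ))
    (hcu.mono fun x hx hx' => hx (by simp [hx'])) (hv.const_smul (((√t)⁻¹ : ℝ) : ℂ))
    (hcv.mono fun x hx hx' => hx (by simp [hx'])) N
  rw [graphSq_smul _ _ hu, graphSq_smul _ _ hv, S.bdry0_smul, S.bdry1_smul,
    truncPairing_mul_mul, Complex.norm_real, Complex.norm_real, Real.norm_of_nonneg hs.le,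
    Real.norm_of_nonneg (inv_nonneg.2 hs.le), inv_pow, hsq] at key
  have e2 : (√t : ℂ) * star (((√t)⁻¹ : ℝ) : ℂ) = 1 := by
    rw [RCLike.star_def, Complex.conj_ofReal, ← Complex.ofReal_mul, mul_inv_cancel₀ hs.ne',
      Complex.ofReal_one]
  rwa [e2, one_mul] at key

lemma memLp_restrict {u : Plane → Spinor} (hu : Continuous u) (hc : HasCompactSupport u)
    (U : Set Plane) : MemLp u 2 (volume.restrict U) :=
  (hu.memLp_of_hasCompactSupport hc).restrict U

lemma norm_toLp_sq {u : Plane → Spinor} {U : Set Plane} (hu : MemLp u 2 (volume.restrict U)) :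
    ‖hu.toLp u‖ ^ 2 = ∫ x in U, ‖u x‖ ^ 2 := by
  have h := inner_self_eq_norm_sq_to_K (𝕜 := ℂ) (hu.toLp u)
  rw [L2.inner_def] at h
  have e : ∫ x in U, inner ℂ (hu.toLp u x) (hu.toLp u x) =
      ((∫ x in U, ‖u x‖ ^ 2 : ℝ) : ℂ) := by
    rw [← integral_complex_ofReal]
    refine integral_congr_ae ?_
    filter_upwards [hu.coeFn_toLp] with x hx
    rw [hx, inner_self_eq_norm_sq_to_K]
    simp
  rw [e] at h
  refine Complex.ofReal_injective ?_
  rw [Complex.ofReal_pow]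
  exact h.symm

/-- A smooth compactly supported field, as an element of the graph of `σ · ∇` over `U`. -/
noncomputable def graphPoint (U : Set Plane) {u : Plane → Spinor} (hu : ContDiff ℝ ∞ u)
    (hc : HasCompactSupport u) :
    WithLp 2 (Lp Spinor 2 (volume.restrict U) × Lp Spinor 2 (volume.restrict U)) :=
  WithLp.toLp 2 ((memLp_restrict hu.continuous hc U).toLp u,
    (memLp_restrict (continuous_sigmaGrad hu)
      (hasCompactSupport_sigmaGrad hc) U).toLp (sigmaGrad u))

lemma norm_graphPoint (U : Set Plane) {u : Plane → Spinor} (hu : ContDiff ℝ ∞ u)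
    (hc : HasCompactSupport u) : ‖graphPoint U hu hc‖ = √(graphSq U u) := by
  rw [← Real.sqrt_sq (norm_nonneg _), WithLp.prod_norm_sq_eq_of_L2, graphSq]
  rw [← norm_toLp_sq (memLp_restrict hu.continuous hc U), ← norm_toLp_sq
    (memLp_restrict (continuous_sigmaGrad hu) (hasCompactSupport_sigmaGrad hc) U)]
  rfl

lemma graphPoint_sub (U : Set Plane) {u v : Plane → Spinor} (hu : ContDiff ℝ ∞ u)
    (hc : HasCompactSupport u) (hv : ContDiff ℝ ∞ v) (hcv : HasCompactSupport v) :
    graphPoint U hu hc - graphPoint U hv hcv =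
      graphPoint U (u := u - v) (hu.sub hv) (hc.sub hcv) := by
  have e : sigmaGrad (u - v) = sigmaGrad u - sigmaGrad v := by
    have := sigmaGrad_add hu (hv.const_smul (-1 : ℂ))
    have h2 := sigmaGrad_smul (-1) hv
    have h3 : u - v = u + (-1 : ℂ) • v := by simp [sub_eq_add_neg]
    rw [h3]
    refine this.trans ?_
    rw [show sigmaGrad (fun x => (-1 : ℂ) • v x) = (-1 : ℂ) • sigmaGrad v from h2]
    simp [sub_eq_add_neg]
  simp only [graphPoint, e]
  rfl

/-- Green's formula for smooth fields: the boundary term as a limit of truncated pairings. -/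
lemma Shell.tendsto_im_truncPairing_bdry (h : S.IsSide e U) {u : Plane → Spinor}
    (hu : ContDiff ℝ ∞ u) (hc : HasCompactSupport u) :
    Tendsto (fun N => -(e * S.ℓ) * (truncPairing N (S.bdry0 u) (S.bdry1 u)).im) atTop
      (𝓝 (∫ x in U, inner ℂ (u x) (sigmaGrad u x)).re) := by
  have hγ := S.smooth.continuous
  set f : ℝ → ℂ := fun s => u (S.γ s) 0 with hf
  set g : ℝ → ℂ := fun s => star (S.tau s) * u (S.γ s) 1 with hg
  have cf : Continuous f := (continuous_spinor_coord hu.continuous 0).comp hγ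
  have cg : Continuous g :=
    S.contDiff_tau.continuous.star.mul ((continuous_spinor_coord hu.continuous 1).comp hγ)
  have h1 := tendsto_truncPairing S.ℓ_pos cf cg
  set J := ∫ s in (0 : ℝ)..S.ℓ, f s * star (g s) with hJ
  have h2 := ((Complex.continuous_im.tendsto _).comp h1).const_mul (-(e * S.ℓ))
  have green := Shell.integral_crossDensity h hu hc hu hc
  have hconj : ∫ s in (0 : ℝ)..S.ℓ, star (u (S.γ s) 0) * (star (S.tau s) * u (S.γ s) 1) =
      star J := by
    rw [hJ, intervalIntegral.integral_of_le S.ℓ_pos.le, intervalIntegral.integral_of_le S.ℓ_pos.le,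
      RCLike.star_def, ← integral_conj]
    congr 1
    funext s
    simp [hf, hg]
  rw [hconj] at green
  have hre : (∫ x in U, inner ℂ (u x) (sigmaGrad u x)).re = (∫ x in U, crossDensity u u x).re := by
    have i1 : Integrable (fun x => inner ℂ (u x) (sigmaGrad u x)) (volume.restrict U) :=
      integrable_inner hu.continuous hc
        ((continuous_sigmaGrad hu).memLp_of_hasCompactSupport (hasCompactSupport_sigmaGrad hc))
    have i2 : Integrable (crossDensity u u) (volume.restrict U) :=
      (integrable_crossDensity hu hu hc).integrableOn
    have e1 := integral_re (𝕜 := ℂ) i1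
    have e2 := integral_re (𝕜 := ℂ) i2
    simp only [RCLike.re_to_complex] at e1 e2
    rw [← e1, ← e2]
    congr 1
    funext x
    simp only [crossDensity, PiLp.inner_apply, RCLike.inner_apply, Fin.sum_univ_two,
      RCLike.star_def, Complex.add_re, Complex.mul_re, Complex.conj_re, Complex.conj_im]
    ring
  rw [hre, green]
  have hℓ := S.ℓ_pos.ne'
  refine Eq.subst (motive := fun y => Tendsto _ atTop (𝓝 y)) ?_ h2
  rw [Complex.im_ofReal_mul]
  simp only [RCLike.star_def, Complex.mul_re, Complex.mul_im, Complex.neg_re, Complex.neg_im,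
    Complex.I_re, Complex.I_im, Complex.ofReal_re, Complex.ofReal_im, Complex.conj_re,
    Complex.conj_im]
  field_simp
  ring

/-- Convergence of truncated boundary pairings of a trace to the `L²` pairing of `f` with
`σ · ∇ f`. -/
lemma Shell.IsTrace.tendsto_im_truncPairing (h : S.IsSide e U) {f g : SpinorL2}
    {φ : Fin 2 → BoundaryFunctional S.ℓ} (H : S.IsTrace U f g φ) :
    Tendsto (fun N => -(e * S.ℓ) * (truncPairing N (S.coef0 φ) (S.coef1 φ)).im) atTop
      (𝓝 (∫ x in U, inner ℂ (f x) (g x)).re) := by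
  obtain ⟨-, u, hu, hf, hg, hφ⟩ := H
  have mf : MemLp (f : Plane → Spinor) 2 (volume.restrict U) := (Lp.memLp f).restrict U
  have mg : MemLp (g : Plane → Spinor) 2 (volume.restrict U) := (Lp.memLp g).restrict U
  have mu := fun k => memLp_restrict (hu k).1.continuous (hu k).2 U
  have mdu := fun k => memLp_restrict (continuous_sigmaGrad (hu k).1)
    (hasCompactSupport_sigmaGrad (hu k).2) U
  have tf := (Lp.tendsto_Lp_iff_tendsto_eLpNorm'' u mu f mf).2 hf
  have tg := (Lp.tendsto_Lp_iff_tendsto_eLpNorm'' (fun k => sigmaGrad (u k)) mdu g mg).2 hg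
  -- the `L²` pairings converge
  have inn : ∀ {a b : Plane → Spinor} (ha : MemLp a 2 (volume.restrict U))
      (hb : MemLp b 2 (volume.restrict U)),
      inner ℂ (ha.toLp a) (hb.toLp b) = ∫ x in U, inner ℂ (a x) (b x) := by
    intro a b ha hb
    rw [L2.inner_def]
    refine integral_congr_ae ?_
    filter_upwards [ha.coeFn_toLp, hb.coeFn_toLp] with x h1 h2
    rw [h1, h2]
  have lim := (tf.inner tg (𝕜 := ℂ))
  simp only [inn] at lim
  have lim' := (Complex.continuous_re.tendsto _).comp lim
  -- the truncated pairings converge uniformly in the order of truncation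
  set p := fun k => graphPoint U (hu k).1 (hu k).2 with hp
  have tp : Tendsto p atTop (𝓝 (WithLp.toLp 2 (mf.toLp f, mg.toLp g))) :=
    ((WithLp.prod_continuous_toLp 2 _ _).tendsto _).comp (tf.prodMk_nhds tg)
  obtain ⟨C, hC0, hC⟩ := S.exists_norm_truncPairing_le_mul h
  set T : ℕ → ℕ → ℂ := fun k N => truncPairing N (S.bdry0 (u k)) (S.bdry1 (u k)) with hT
  have bound : ∀ k l N, ‖T k N - T l N‖ ≤ C * ‖p k - p l‖ * (‖p k‖ + ‖p l‖) := by
    intro k l N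
    have e1 : u k = (u k - u l) + u l := by simp
    have c1 : ContDiff ℝ ∞ (u k - u l) := (hu k).1.sub (hu l).1
    have c2 : HasCompactSupport (u k - u l) := (hu k).2.sub (hu l).2
    have e2 : T k N - T l N = truncPairing N (S.bdry0 (u k - u l)) (S.bdry1 (u k)) +
        truncPairing N (S.bdry0 (u l)) (S.bdry1 (u k - u l)) := by
      have a1 := S.bdry0_add c1.continuous (hu l).1.continuous
      have a2 := S.bdry1_add c1.continuous (hu l).1.continuous
      rw [← e1] at a1 a2
      simp only [hT, truncPairing, ← Finset.sum_sub_distrib, ← Finset.sum_add_distrib]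
      refine Finset.sum_congr rfl fun n _ => ?_
      rw [a1, a2]
      simp only [Pi.add_apply, star_add]
      ring
    have b1 := hC _ _ c1 c2 (hu k).1 (hu k).2 N
    have b2 := hC _ _ (hu l).1 (hu l).2 c1 c2 N
    have e3 := norm_graphPoint U c1 c2
    rw [← graphPoint_sub U (hu k).1 (hu k).2 (hu l).1 (hu l).2] at e3
    rw [← e3, ← norm_graphPoint U (hu k).1 (hu k).2] at b1
    rw [← e3, ← norm_graphPoint U (hu l).1 (hu l).2] at b2
    rw [e2]
    refine (norm_add_le _ _).trans ((add_le_add b1 b2).trans (le_of_eq ?_))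
    ring
  set F : ℕ → ℕ → ℝ := fun k N => -(e * S.ℓ) * (T k N).im with hF
  have K0 : Tendsto (fun x : ℕ × ℕ => |e * S.ℓ| *
      (C * ‖p x.1 - p x.2‖ * (‖p x.1‖ + ‖p x.2‖))) (atTop ×ˢ atTop) (𝓝 0) := by
    have t1 := tp.comp (tendsto_fst (f := atTop (α := ℕ)) (g := atTop (α := ℕ)))
    have t2 := tp.comp (tendsto_snd (f := atTop (α := ℕ)) (g := atTop (α := ℕ)))
    have := (((t1.sub t2).norm.const_mul C).mul (t1.norm.add t2.norm)).const_mul |e * S.ℓ|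
    simpa using this
  have unif : UniformCauchySeqOn F atTop Set.univ := by
    intro s hs
    obtain ⟨ε, hε, hεs⟩ := Metric.mem_uniformity_dist.1 hs
    filter_upwards [K0.eventually (gt_mem_nhds hε)] with x hx N _
    refine hεs (lt_of_le_of_lt ?_ hx)
    have e3 : F x.1 N - F x.2 N = -(e * S.ℓ) * (T x.1 N - T x.2 N).im := by
      simp only [hF, Complex.sub_im]
      ring
    rw [Real.dist_eq, e3, abs_mul, abs_neg]
    exact mul_le_mul_of_nonneg_left ((Complex.abs_im_le_norm _).trans (bound _ _ _))
      (abs_nonneg _)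
  have ptw : ∀ N, Tendsto (fun k => F k N) atTop
      (𝓝 (-(e * S.ℓ) * (truncPairing N (S.coef0 φ) (S.coef1 φ)).im)) := fun N =>
    ((Complex.continuous_im.tendsto _).comp (Shell.tendsto_truncPairing_bdry
      (fun k => (hu k).1.continuous) hφ N)).const_mul _
  have tunif := tendstoUniformlyOn_univ.1 (unif.tendstoUniformlyOn_of_tendsto fun N _ => ptw N)
  exact tunif.tendsto_of_eventually_tendsto
    (.of_forall fun k => Shell.tendsto_im_truncPairing_bdry h (hu k).1 (hu k).2) lim'

end trace


/-! ### The transmission condition in the rotated frame -/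

/-- The complex unit tangent `t₁ + i t₂`, as a smooth function on `Σ`. -/
noncomputable def Shell.tauFun (S : Shell) : SmoothPeriodic S.ℓ :=
  ⟨S.tau, S.contDiff_tau, S.periodic_tau⟩

lemma Shell.tauFun_mul_tauBar (S : Shell) : S.tauFun * S.tauBar = 1 :=
  Subtype.ext (funext fun s => S.tau_mul_star s)

lemma Shell.tauFun_eq (S : Shell) : S.tauFun = S.tangent 0 + Complex.I • S.tangent 1 := rfl

lemma Shell.tauBar_eq (S : Shell) : S.tauBar = S.tangent 0 - Complex.I • S.tangent 1 :=
  Subtype.ext (funext fun s => S.star_tau s)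

lemma Shell.sigmaDot_tangent (S : Shell) : sigmaDot S.tangent = !![0, S.tauBar; S.tauFun, 0] := by
  rw [S.tauFun_eq, S.tauBar_eq]
  ext i j : 2
  fin_cases i <;> fin_cases j <;> simp [sigmaDot, pauli₁, pauli₂, sub_eq_add_neg]

lemma Shell.sigmaDot_normal (S : Shell) : sigmaDot S.normal =
    !![0, Complex.I • S.tauBar; -Complex.I • S.tauFun, 0] := by
  rw [S.tauFun_eq, S.tauBar_eq]
  ext i j : 2
  fin_cases i <;> fin_cases j <;>
    simp [sigmaDot, pauli₁, pauli₂, Shell.normal, smul_sub, smul_smul, add_comm]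

/-- In the frame given by the unit tangent, the transmission condition is a pair of scalar
equations with constant coefficients. -/
lemma Shell.transmission_iff (S : Shell) (η τ lam : ℝ) (φp φm : Fin 2 → BoundaryFunctional S.ℓ) :
    S.Transmission η τ lam φp φm ↔ ∀ ψ : SmoothPeriodic S.ℓ,
      (φm 1 - φp 1) (S.tauBar * ψ) =
        -(1 / 2) * ((η + τ) * (φm 0 + φp 0) ψ + lam * (φm 1 + φp 1) (S.tauBar * ψ)) ∧
      (φm 0 - φp 0) ψ =
        1 / 2 * (lam * (φm 0 + φp 0) ψ + (η - τ) * (φm 1 + φp 1) (S.tauBar * ψ)) := by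
  have row : S.Transmission η τ lam φp φm ↔ ∀ ψ : SmoothPeriodic S.ℓ,
      -(φm 1 - φp 1) (S.tauBar * ψ) =
        1 / 2 * ((η + τ) * (φm 0 + φp 0) ψ + lam * (φm 1 + φp 1) (S.tauBar * ψ)) ∧
      (φm 0 - φp 0) (S.tauFun * ψ) =
        1 / 2 * (lam * (φm 0 + φp 0) (S.tauFun * ψ) + (η - τ) * (φm 1 + φp 1) ψ) := by
    have hI : ∀ x : ℂ, Complex.I * (Complex.I * x) = -x := fun x => by
      rw [← mul_assoc, Complex.I_mul_I, neg_one_mul]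
    rw [Shell.Transmission, S.sigmaDot_normal, S.sigmaDot_tangent, funext_iff, Fin.forall_fin_two,
      LinearMap.ext_iff, LinearMap.ext_iff, ← forall_and]
    refine forall_congr' fun ψ => and_congr ?_ ?_
    · simp [matFunctional, mulFunctional, constMat, pauli₃, add_mul]
      rw [hI]
      refine Iff.of_eq (congrArg₂ _ ?_ ?_) <;> ring
    · have k : ((η • 1 + -(τ • 1) : SmoothPeriodic S.ℓ) * ψ) = (η - τ : ℂ) • ψ := by
        refine Subtype.ext (funext fun s => ?_)
        simp [sub_eq_add_neg]
      have k' : -(Complex.I • S.tauFun) * ψ = (-Complex.I) • (S.tauFun * ψ) := by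
        refine Subtype.ext (funext fun s => ?_)
        simp [mul_assoc]
      simp [matFunctional, mulFunctional, constMat, pauli₃]
      rw [k, k', map_smul, map_smul, map_smul, map_smul]
      simp only [smul_eq_mul]
      rw [show Complex.I * (-Complex.I * φm 0 (S.tauFun * ψ) - -Complex.I * φp 0 (S.tauFun * ψ)) =
        φm 0 (S.tauFun * ψ) - φp 0 (S.tauFun * ψ) by
          linear_combination (φp 0 (S.tauFun * ψ) - φm 0 (S.tauFun * ψ)) * Complex.I_mul_I]
      refine Iff.of_eq (congrArg₂ _ rfl ?_)
      ring
  rw [row]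
  constructor
  · intro h ψ
    refine ⟨?_, ?_⟩
    · linear_combination -(h ψ).1
    · have := (h (S.tauBar * ψ)).2
      rwa [← mul_assoc, S.tauFun_mul_tauBar, one_mul] at this
  · intro h ψ
    refine ⟨?_, ?_⟩
    · rw [(h ψ).1]
      ring
    · have := (h (S.tauFun * ψ)).2
      rwa [← mul_assoc, mul_comm S.tauBar, S.tauFun_mul_tauBar, one_mul] at this

/-! ### Membership in the graph of the operator -/

/-- `f` lies in the domain of `𝒟_{η,τ,λ}` and `h = σ · ∇ f` away from `Σ`. -/
def Shell.IsDomainPair (S : Shell) (η τ lam : ℝ) (f h : SpinorL2) : Prop :=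
  IsWeakSigmaGrad S.Ω f h ∧ IsWeakSigmaGrad S.ext f h ∧
    ∃ φp φm : Fin 2 → BoundaryFunctional S.ℓ,
      S.IsTrace S.Ω f h φp ∧ S.IsTrace S.ext f h φm ∧ S.Transmission η τ lam φp φm

lemma Shell.mem_sigmaGradMax_graph (S : Shell) {f h : SpinorL2} :
    (∃ hf : f ∈ S.sigmaGradMax.domain, S.sigmaGradMax ⟨f, hf⟩ = h) ↔
      IsWeakSigmaGrad S.Ω f h ∧ IsWeakSigmaGrad S.ext f h := by
  have h1 : S.sigmaGradMax.graph = S.sigmaGradGraph :=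
    Submodule.toLinearPMap_graph_eq _ fun p hp => S.sigmaGradGraph_functional p hp
  have h2 : (f, h) ∈ S.sigmaGradMax.graph ↔ (f, h) ∈ S.sigmaGradGraph := by rw [h1]
  rw [LinearPMap.mem_graph_iff] at h2
  refine Iff.trans ?_ h2
  constructor
  · rintro ⟨hf, e⟩
    exact ⟨⟨f, hf⟩, rfl, e⟩
  · rintro ⟨⟨y, hy⟩, rfl, e⟩
    exact ⟨hy, e⟩

lemma Shell.mem_diracDomain_iff (S : Shell) {η τ lam : ℝ} {f : SpinorL2} :
    f ∈ S.diracDomain η τ lam ↔ ∃ h, S.IsDomainPair η τ lam f h := by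
  constructor
  · rintro ⟨hf, φp, φm, h1, h2, h3⟩
    obtain ⟨w1, w2⟩ := S.mem_sigmaGradMax_graph.1 ⟨hf, rfl⟩
    exact ⟨_, w1, w2, φp, φm, h1, h2, h3⟩
  · rintro ⟨h, w1, w2, φp, φm, h1, h2, h3⟩
    obtain ⟨hf, rfl⟩ := S.mem_sigmaGradMax_graph.2 ⟨w1, w2⟩
    exact ⟨hf, φp, φm, h1, h2, h3⟩

lemma Shell.IsDomainPair.dirac_apply {S : Shell} {η τ lam : ℝ} {f h : SpinorL2}
    (H : S.IsDomainPair η τ lam f h) (m : ℝ) (hf : f ∈ (S.dirac m η τ lam).domain) :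
    S.dirac m η τ lam ⟨f, hf⟩ = -Complex.I • h + (m : ℂ) • (act pauli₃).compLp f := by
  obtain ⟨hf', rfl⟩ := S.mem_sigmaGradMax_graph.2 ⟨H.1, H.2.1⟩
  rfl

lemma Shell.mem_pointSpectrum_iff (S : Shell) {m η τ lam : ℝ} {z : ℂ} :
    z ∈ pointSpectrum (S.dirac m η τ lam) ↔ ∃ f h : SpinorL2, f ≠ 0 ∧
      S.IsDomainPair η τ lam f h ∧ -Complex.I • h + (m : ℂ) • (act pauli₃).compLp f = z • f := by
  constructor
  · rintro ⟨⟨f, hf⟩, h0, h1⟩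
    obtain ⟨h, H⟩ := S.mem_diracDomain_iff.1 hf
    rw [H.dirac_apply m hf] at h1
    exact ⟨f, h, h0, H, h1⟩
  · rintro ⟨f, h, h0, H, h1⟩
    have hf : f ∈ (S.dirac m η τ lam).domain := S.mem_diracDomain_iff.2 ⟨h, H⟩
    refine ⟨⟨f, hf⟩, h0, ?_⟩
    rw [H.dirac_apply m hf]
    exact h1

/-! ### Symmetry of the operator -/

/-- The transmission condition makes the boundary terms from the two sides cancel. -/
lemma Shell.Transmission.im_truncPairing_eq {S : Shell} {η τ lam : ℝ}
    {φp φm : Fin 2 → BoundaryFunctional S.ℓ} (H : S.Transmission η τ lam φp φm) (N : ℕ) :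
    (truncPairing N (S.coef0 φm) (S.coef1 φm)).im =
      (truncPairing N (S.coef0 φp) (S.coef1 φp)).im := by
  rw [S.transmission_iff] at H
  simp only [truncPairing, Complex.im_sum]
  refine Finset.sum_congr rfl fun n _ => ?_
  obtain ⟨h1, h2⟩ := H (expPeriodic S.ℓ_pos (-n))
  simp only [Shell.coef0, Shell.coef1]
  set x := φm 0 (expPeriodic S.ℓ_pos (-n)) with hx
  set y := φm 1 (S.tauBar * expPeriodic S.ℓ_pos (-n)) with hy
  set x' := φp 0 (expPeriodic S.ℓ_pos (-n)) with hx'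
  set y' := φp 1 (S.tauBar * expPeriodic S.ℓ_pos (-n)) with hy'
  simp only [LinearMap.sub_apply, LinearMap.add_apply, ← hx, ← hy, ← hx', ← hy'] at h1 h2
  have e1 : ((1 / S.ℓ : ℂ)) = ((1 / S.ℓ : ℝ) : ℂ) := by simp
  have e2 : ((1 / 2 : ℂ)) = ((1 / 2 : ℝ) : ℂ) := by simp
  rw [e1]
  rw [e2] at h1 h2
  generalize (1 / S.ℓ : ℝ) = c
  have r1 := congrArg Complex.re h1
  have i1 := congrArg Complex.im h1
  have r2 := congrArg Complex.re h2
  have i2 := congrArg Complex.im h2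
  simp only [RCLike.star_def, map_mul, Complex.mul_re, Complex.mul_im, Complex.add_re,
    Complex.add_im, Complex.sub_re, Complex.sub_im, Complex.neg_re, Complex.neg_im,
    Complex.ofReal_re, Complex.ofReal_im, Complex.conj_re, Complex.conj_im] at r1 i1 r2 i2 ⊢
  linear_combination (c ^ 2 / 2) * ((y.re + y'.re) * i2 - (y.im + y'.im) * r2 +
    (x.im + x'.im) * r1 - (x.re + x'.re) * i1)


lemma Shell.measurableSet_ext (S : Shell) : MeasurableSet S.ext :=
  isClosed_closure.isOpen_compl.measurableSet

lemma Shell.ae_mem (S : Shell) : ∀ᵐ x, x ∈ S.Ω ∨ x ∈ S.ext := by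
  filter_upwards [measure_eq_zero_iff_ae_notMem.1 S.volume_frontier] with x hx
  by_contra! h
  refine hx ⟨not_not.1 h.2, ?_⟩
  rw [S.isOpen.interior_eq]
  exact h.1

lemma Shell.integral_eq_add (S : Shell) {g : Plane → ℂ} (hg : Integrable g) :
    ∫ x, g x = (∫ x in S.Ω, g x) + ∫ x in S.ext, g x := by
  rw [← setIntegral_union S.disjoint_ext S.measurableSet_ext hg.integrableOn hg.integrableOn,
    ← setIntegral_univ]
  refine setIntegral_congr_set ?_
  filter_upwards [S.ae_mem] with x hx
  exact propext ⟨fun _ => hx, fun _ => trivial⟩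

/-- `-i σ · ∇` is symmetric on the domain of `𝒟_{η,τ,λ}`. -/
lemma Shell.IsDomainPair.re_inner_eq_zero {S : Shell} {η τ lam : ℝ} {f h : SpinorL2}
    (H : S.IsDomainPair η τ lam f h) : (inner ℂ f h).re = 0 := by
  obtain ⟨-, -, φp, φm, hp, hm, ht⟩ := H
  have l1 := hp.tendsto_im_truncPairing (e := -1) (Or.inr ⟨rfl, rfl⟩)
  have l2 := hm.tendsto_im_truncPairing (e := 1) (Or.inl ⟨rfl, rfl⟩)
  have l3 := l1.add l2
  have z : ∀ N, -(-1 * S.ℓ) * (truncPairing N (S.coef0 φp) (S.coef1 φp)).im +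
      -(1 * S.ℓ) * (truncPairing N (S.coef0 φm) (S.coef1 φm)).im = 0 := by
    intro N
    rw [ht.im_truncPairing_eq N]
    ring
  simp only [z] at l3
  have l4 := tendsto_nhds_unique l3 tendsto_const_nhds
  rw [L2.inner_def, S.integral_eq_add (L2.integrable_inner f h), Complex.add_re]
  exact l4

lemma im_inner_act_pauli₃ (v : Spinor) : (inner ℂ v (act pauli₃ v)).im = 0 := by
  rw [PiLp.inner_apply, Fin.sum_univ_two, (act_pauli₃ v).1, (act_pauli₃ v).2]
  simp only [RCLike.inner_apply, Complex.add_im, Complex.mul_im, Complex.neg_re, Complex.neg_im,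
    Complex.conj_re, Complex.conj_im]
  ring

/-- The eigenvalues are real. -/
lemma Shell.conj_eq_of_eigen {S : Shell} {m η τ lam : ℝ} {z : ℂ} {f h : SpinorL2} (hf : f ≠ 0)
    (H : S.IsDomainPair η τ lam f h)
    (hz : -Complex.I • h + (m : ℂ) • (act pauli₃).compLp f = z • f) : star z = z := by
  have h1 := congrArg (fun g => (inner ℂ f g).im) hz
  simp only [inner_add_right, inner_smul_right, inner_self_eq_norm_sq_to_K] at h1
  have h2 : (inner ℂ f ((act pauli₃).compLp f)).im = 0 := by
    rw [L2.inner_def]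
    have e := integral_im (𝕜 := ℂ) (L2.integrable_inner f ((act pauli₃).compLp f))
    simp only [RCLike.im_to_complex] at e
    rw [← e]
    refine integral_eq_zero_of_ae ?_
    filter_upwards [(act pauli₃).coeFn_compLp f] with x hx
    rw [hx]
    exact im_inner_act_pauli₃ _
  have h3 : (-Complex.I * inner ℂ f h).im = 0 := by
    simp [H.re_inner_eq_zero]
  rw [Complex.add_im, Complex.im_ofReal_mul, h2, h3, mul_zero, add_zero] at h1
  have h4 : z.im * ‖f‖ ^ 2 = 0 := by
    rw [h1, ← RCLike.ofReal_pow]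
    exact (Complex.im_mul_ofReal z (‖f‖ ^ 2)).symm
  have h5 : z.im = 0 := (mul_eq_zero.1 h4).resolve_right (by simpa using hf)
  exact Complex.conj_eq_iff_im.2 h5

/-! ### Changing the sign outside `Ω` -/

lemma IsWeakSigmaGrad.congr_on {U : Set Plane} (hU : MeasurableSet U) {f h f' h' : Plane → Spinor}
    (H : IsWeakSigmaGrad U f h) (hf : ∀ᵐ x, x ∈ U → f x = f' x)
    (hh : ∀ᵐ x, x ∈ U → h x = h' x) : IsWeakSigmaGrad U f' h' := by
  intro φ h1 h2 h3
  have key := H φ h1 h2 h3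
  have e1 : ∫ x in U, inner ℂ (sigmaGrad φ x) (f x) =
      ∫ x in U, inner ℂ (sigmaGrad φ x) (f' x) :=
    setIntegral_congr_ae hU (hf.mono fun x hx hxU => by rw [hx hxU])
  have e2 : ∫ x in U, inner ℂ (φ x) (h x) = ∫ x in U, inner ℂ (φ x) (h' x) :=
    setIntegral_congr_ae hU (hh.mono fun x hx hxU => by rw [hx hxU])
  rwa [e1, e2] at key

lemma Shell.IsTrace.congr_on {S : Shell} {U : Set Plane} (hU : MeasurableSet U)
    {f h f' h' : Plane → Spinor} {φ : Fin 2 → BoundaryFunctional S.ℓ} (H : S.IsTrace U f h φ)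
    (hf : ∀ᵐ x, x ∈ U → f x = f' x) (hh : ∀ᵐ x, x ∈ U → h x = h' x) : S.IsTrace U f' h' φ := by
  obtain ⟨H0, u, H1, H2, H3, H4⟩ := H
  refine ⟨H0, u, H1, ?_, ?_, H4⟩
  · refine H2.congr fun k => eLpNorm_congr_ae ?_
    filter_upwards [(ae_restrict_iff' hU).2 hf] with x hx
    simp [hx]
  · refine H3.congr fun k => eLpNorm_congr_ae ?_
    filter_upwards [(ae_restrict_iff' hU).2 hh] with x hx
    simp [hx]

open Classical in
lemma Shell.memLp_flip (S : Shell) (f : SpinorL2) :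
    MemLp (fun x => if x ∈ S.Ω then f x else -f x) 2 volume := by
  have hm : AEStronglyMeasurable (fun x => if x ∈ S.Ω then f x else -f x) volume :=
    AEStronglyMeasurable.piecewise S.isOpen.measurableSet
      (Lp.aestronglyMeasurable f).restrict (Lp.aestronglyMeasurable f).neg.restrict
  refine (memLp_congr_norm hm (Lp.aestronglyMeasurable f) (.of_forall fun x => ?_)).2 (Lp.memLp f)
  by_cases hx : x ∈ S.Ω <;> simp [hx]

open Classical in
/-- `f₊ ⊕ f₋ ↦ f₊ ⊕ (-f₋)`. -/
noncomputable def Shell.flip (S : Shell) (f : SpinorL2) : SpinorL2 := (S.memLp_flip f).toLp _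

lemma Shell.flip_of_mem (S : Shell) (f : SpinorL2) : ∀ᵐ x, x ∈ S.Ω → S.flip f x = f x := by
  filter_upwards [(S.memLp_flip f).coeFn_toLp] with x hx hxΩ
  rw [Shell.flip, hx, if_pos hxΩ]

lemma Shell.flip_of_notMem (S : Shell) (f : SpinorL2) : ∀ᵐ x, x ∉ S.Ω → S.flip f x = -f x := by
  filter_upwards [(S.memLp_flip f).coeFn_toLp] with x hx hxΩ
  rw [Shell.flip, hx, if_neg hxΩ]

lemma Shell.flip_ne_zero (S : Shell) {f : SpinorL2} (hf : f ≠ 0) : S.flip f ≠ 0 := by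
  contrapose! hf
  refine Lp.ext ?_
  filter_upwards [S.flip_of_mem f, S.flip_of_notMem f,
    Lp.coeFn_zero Spinor 2 (volume : Measure Plane)] with x h1 h2 h3
  rw [hf] at h1 h2
  by_cases hx : x ∈ S.Ω
  · exact (h1 hx).symm
  · rw [h3, Pi.zero_apply] at h2 ⊢
    exact neg_eq_zero.1 (h2 hx).symm

/-- The algebraic core of the duality `(η, τ, λ) ↦ -4 (η, τ, λ) / d`: changing the sign of the
exterior trace exchanges the jump and the mean value. -/
lemma Shell.Transmission.flip {S : Shell} {η τ lam : ℝ} {φp φm : Fin 2 → BoundaryFunctional S.ℓ}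
    (hd : η ^ 2 - τ ^ 2 - lam ^ 2 ≠ 0) (H : S.Transmission η τ lam φp φm) :
    S.Transmission (-4 * η / (η ^ 2 - τ ^ 2 - lam ^ 2)) (-4 * τ / (η ^ 2 - τ ^ 2 - lam ^ 2))
      (-4 * lam / (η ^ 2 - τ ^ 2 - lam ^ 2)) φp ((-1 : ℂ) • φm) := by
  rw [S.transmission_iff] at H ⊢
  intro ψ
  obtain ⟨h1, h2⟩ := H ψ
  simp only [LinearMap.sub_apply, LinearMap.add_apply, Pi.smul_apply, LinearMap.smul_apply,
    smul_eq_mul] at h1 h2 ⊢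
  have hd' : ((η : ℂ) ^ 2 - (τ : ℂ) ^ 2 - (lam : ℂ) ^ 2) ≠ 0 := by exact_mod_cast hd
  push_cast
  set d : ℂ := (η : ℂ) ^ 2 - (τ : ℂ) ^ 2 - (lam : ℂ) ^ 2 with hdd
  constructor
  · field_simp
    rw [hdd]
    linear_combination (4 * lam : ℂ) * h1 + 4 * (η + τ) * h2
  · field_simp
    rw [hdd]
    linear_combination -(4 * (η - τ) : ℂ) * h1 - 4 * lam * h2

lemma Shell.IsDomainPair.flip {S : Shell} {η τ lam : ℝ} {f h : SpinorL2}
    (hd : η ^ 2 - τ ^ 2 - lam ^ 2 ≠ 0) (H : S.IsDomainPair η τ lam f h) :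
    S.IsDomainPair (-4 * η / (η ^ 2 - τ ^ 2 - lam ^ 2)) (-4 * τ / (η ^ 2 - τ ^ 2 - lam ^ 2))
      (-4 * lam / (η ^ 2 - τ ^ 2 - lam ^ 2)) (S.flip f) (S.flip h) := by
  have hΩ := S.isOpen.measurableSet
  have hin : ∀ f : SpinorL2, ∀ᵐ x, x ∈ S.Ω → f x = S.flip f x := fun f =>
    (S.flip_of_mem f).mono fun x hx hxΩ => (hx hxΩ).symm
  have hout : ∀ f : SpinorL2, ∀ᵐ x, x ∈ S.ext → ((-1 : ℂ) • f : SpinorL2) x = S.flip f x := by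
    intro f
    filter_upwards [S.flip_of_notMem f, Lp.coeFn_smul (-1 : ℂ) f] with x h1 h2 hx
    rw [h1 fun hxΩ => Set.disjoint_left.1 S.disjoint_ext hxΩ hx, h2]
    simp
  obtain ⟨w1, w2, φp, φm, t1, t2, tr⟩ := H
  exact ⟨w1.congr_on hΩ (hin f) (hin h),
    (w2.smul (-1)).congr_on S.measurableSet_ext (hout f) (hout h), φp, (-1 : ℂ) • φm,
    t1.congr_on hΩ (hin f) (hin h), (t2.smul (-1)).congr_on S.measurableSet_ext (hout f) (hout h),
    tr.flip hd⟩

lemma Shell.flip_eigen (S : Shell) {m : ℝ} {z : ℂ} {f h : SpinorL2}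
    (hz : -Complex.I • h + (m : ℂ) • (act pauli₃).compLp f = z • f) :
    -Complex.I • S.flip h + (m : ℂ) • (act pauli₃).compLp (S.flip f) = z • S.flip f := by
  have hpt : ∀ f h : SpinorL2, ∀ᵐ x,
      (-Complex.I • h + (m : ℂ) • (act pauli₃).compLp f : SpinorL2) x =
        -Complex.I • h x + (m : ℂ) • act pauli₃ (f x) := by
    intro f h
    filter_upwards [Lp.coeFn_add (-Complex.I • h) ((m : ℂ) • (act pauli₃).compLp f),
      Lp.coeFn_smul (-Complex.I) h, Lp.coeFn_smul (m : ℂ) ((act pauli₃).compLp f),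
      (act pauli₃).coeFn_compLp f] with x h1 h2 h3 h4
    rw [h1, Pi.add_apply, h2, h3, Pi.smul_apply, Pi.smul_apply, h4]
  refine Lp.ext ?_
  have h0 := hpt f h
  rw [hz] at h0
  filter_upwards [h0, hpt (S.flip f) (S.flip h), Lp.coeFn_smul z f, Lp.coeFn_smul z (S.flip f),
    S.flip_of_mem f, S.flip_of_notMem f, S.flip_of_mem h, S.flip_of_notMem h]
    with x h0 h1 h2 h3 h4 h5 h6 h7
  rw [h1, h3, Pi.smul_apply]
  rw [h2, Pi.smul_apply] at h0
  by_cases hx : x ∈ S.Ω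
  · rw [h4 hx, h6 hx, h0]
  · rw [h5 hx, h7 hx, smul_neg, map_neg, smul_neg, smul_neg, h0, neg_add]

lemma Shell.pointSpectrum_flip {S : Shell} {m η τ lam : ℝ} {z : ℂ}
    (hd : η ^ 2 - τ ^ 2 - lam ^ 2 ≠ 0) (hz : z ∈ pointSpectrum (S.dirac m η τ lam)) :
    z ∈ pointSpectrum (S.dirac m (-4 * η / (η ^ 2 - τ ^ 2 - lam ^ 2))
      (-4 * τ / (η ^ 2 - τ ^ 2 - lam ^ 2)) (-4 * lam / (η ^ 2 - τ ^ 2 - lam ^ 2))) := by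
  obtain ⟨f, h, hf, H, e⟩ := S.mem_pointSpectrum_iff.1 hz
  exact S.mem_pointSpectrum_iff.2 ⟨_, _, S.flip_ne_zero hf, H.flip hd, S.flip_eigen e⟩

lemma Shell.pointSpectrum_flip_iff {S : Shell} {m η τ lam : ℝ} {z : ℂ}
    (hd : η ^ 2 - τ ^ 2 - lam ^ 2 ≠ 0) :
    z ∈ pointSpectrum (S.dirac m η τ lam) ↔
      z ∈ pointSpectrum (S.dirac m (-4 * η / (η ^ 2 - τ ^ 2 - lam ^ 2))
        (-4 * τ / (η ^ 2 - τ ^ 2 - lam ^ 2)) (-4 * lam / (η ^ 2 - τ ^ 2 - lam ^ 2))) := by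
  refine ⟨Shell.pointSpectrum_flip hd, fun hz => ?_⟩
  set d := η ^ 2 - τ ^ 2 - lam ^ 2 with hdd
  -- the parameter map is an involution, since `d` is replaced by `16 / d`
  have hd' : (-4 * η / d) ^ 2 - (-4 * τ / d) ^ 2 - (-4 * lam / d) ^ 2 = 16 / d := by
    field_simp
    rw [hdd]
    ring
  have key := Shell.pointSpectrum_flip (by rw [hd']; positivity) hz
  rw [hd'] at key
  have inv : ∀ x : ℝ, -4 * (-4 * x / d) / (16 / d) = x := by
    intro x
    field_simp
    ring
  rwa [inv, inv, inv] at key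


/-! ### Charge conjugation -/

/-- The pointwise charge conjugation `v ↦ σ₁ v̄` on `ℂ²`. -/
noncomputable def spinorConj (v : Spinor) : Spinor := !₂[star (v 1), star (v 0)]

lemma spinorConj_zero (v : Spinor) : spinorConj v 0 = star (v 1) := rfl

lemma spinorConj_one (v : Spinor) : spinorConj v 1 = star (v 0) := rfl

lemma spinorConj_spinorConj (v : Spinor) : spinorConj (spinorConj v) = v := by
  ext j
  fin_cases j
  · exact star_star (v 0)
  · exact star_star (v 1)

lemma spinorConj_add (v w : Spinor) : spinorConj (v + w) = spinorConj v + spinorConj w := by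
  ext j
  fin_cases j
  · exact star_add (v 1) (w 1)
  · exact star_add (v 0) (w 0)

lemma spinorConj_smul (c : ℂ) (v : Spinor) : spinorConj (c • v) = star c • spinorConj v := by
  ext j
  fin_cases j
  · exact star_mul' c (v 1)
  · exact star_mul' c (v 0)

lemma norm_spinorConj (v : Spinor) : ‖spinorConj v‖ = ‖v‖ := by
  rw [EuclideanSpace.norm_eq, EuclideanSpace.norm_eq, Fin.sum_univ_two, Fin.sum_univ_two,
    spinorConj_zero, spinorConj_one, norm_star, norm_star, add_comm]

/-- Charge conjugation as a real-linear isometry. -/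
noncomputable def spinorConjₗᵢ : Spinor →ₗᵢ[ℝ] Spinor where
  toFun := spinorConj
  map_add' := spinorConj_add
  map_smul' c v := by
    have := spinorConj_smul (c : ℂ) v
    simpa using this
  norm_map' := norm_spinorConj

lemma spinorConj_sub (v w : Spinor) : spinorConj (v - w) = spinorConj v - spinorConj w :=
  map_sub spinorConjₗᵢ v w

lemma inner_spinorConj (v w : Spinor) :
    inner ℂ v (spinorConj w) = star (inner ℂ (spinorConj v) w) := by
  simp only [PiLp.inner_apply, Fin.sum_univ_two, RCLike.inner_apply, spinorConj_zero,
    spinorConj_one, RCLike.star_def, map_add, map_mul, Complex.conj_conj]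
  ring

lemma act_pauli₃_spinorConj (v : Spinor) :
    act pauli₃ (spinorConj v) = -spinorConj (act pauli₃ v) := by
  ext j
  fin_cases j
  · simp [(act_pauli₃ _).1, spinorConj_zero, (act_pauli₃ v).2]
  · simp [(act_pauli₃ _).2, spinorConj_one, (act_pauli₃ v).1]

lemma contDiff_spinorConj {u : Plane → Spinor} (hu : ContDiff ℝ ∞ u) :
    ContDiff ℝ ∞ fun x => spinorConj (u x) :=
  spinorConjₗᵢ.toContinuousLinearMap.contDiff.comp hu

lemma hasCompactSupport_spinorConj {u : Plane → Spinor} (hu : HasCompactSupport u) :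
    HasCompactSupport fun x => spinorConj (u x) :=
  hu.comp_left (map_zero spinorConjₗᵢ)

/-- Charge conjugation commutes with `σ · ∇`. -/
lemma sigmaGrad_spinorConj {u : Plane → Spinor} (hu : ContDiff ℝ ∞ u) (x : Plane) :
    sigmaGrad (fun x => spinorConj (u x)) x = spinorConj (sigmaGrad u x) := by
  have hd : ∀ w, fderiv ℝ (fun x => spinorConj (u x)) x w = spinorConj (fderiv ℝ u x w) := by
    intro w
    have h1 := (spinorConjₗᵢ.toContinuousLinearMap.hasFDerivAt.comp x
      (hu.differentiable (by simp) x).hasFDerivAt).fderiv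
    exact congrArg (fun L : Plane →L[ℝ] Spinor => L w) h1
  ext j
  fin_cases j
  · change sigmaGrad _ x 0 = spinorConj _ 0
    rw [sigmaGrad_apply_zero, spinorConj_zero, sigmaGrad_apply_one, hd, hd, spinorConj_one,
      spinorConj_one]
    simp only [RCLike.star_def, map_add, map_mul, Complex.conj_I]
    ring
  · change sigmaGrad _ x 1 = spinorConj _ 1
    rw [sigmaGrad_apply_one, spinorConj_one, sigmaGrad_apply_zero, hd, hd, spinorConj_zero,
      spinorConj_zero]
    simp only [RCLike.star_def, map_sub, map_mul, Complex.conj_I]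
    ring

lemma coeFn_chargeConj (f : SpinorL2) : ∀ᵐ x, chargeConj f x = spinorConj (f x) := by
  have h1 := (act pauli₁).coeFn_compLp (conjL2 f)
  have h2 : ∀ᵐ x, conjL2 f x = WithLp.toLp 2 fun j => star (f x j) :=
    LipschitzWith.coeFn_compLp _ _ f
  filter_upwards [h1, h2] with x h1 h2
  rw [chargeConj, h1, h2]
  ext j
  fin_cases j
  · exact (act_pauli₁ _).1
  · exact (act_pauli₁ _).2

lemma chargeConj_chargeConj (f : SpinorL2) : chargeConj (chargeConj f) = f := by
  refine Lp.ext ?_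
  filter_upwards [coeFn_chargeConj (chargeConj f), coeFn_chargeConj f] with x h1 h2
  rw [h1, h2, spinorConj_spinorConj]

lemma chargeConj_zero : chargeConj 0 = 0 := by
  refine Lp.ext ?_
  filter_upwards [coeFn_chargeConj 0, Lp.coeFn_zero Spinor 2 (volume : Measure Plane)] with x h1 h2
  rw [h1, h2]
  exact map_zero spinorConjₗᵢ

lemma chargeConj_smul (c : ℂ) (f : SpinorL2) : chargeConj (c • f) = star c • chargeConj f := by
  refine Lp.ext ?_
  filter_upwards [coeFn_chargeConj (c • f), coeFn_chargeConj f, Lp.coeFn_smul c f,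
    Lp.coeFn_smul (star c) (chargeConj f)] with x h1 h2 h3 h4
  rw [h1, h4, h3, Pi.smul_apply, Pi.smul_apply, h2, spinorConj_smul]

lemma chargeConj_add (f g : SpinorL2) : chargeConj (f + g) = chargeConj f + chargeConj g := by
  refine Lp.ext ?_
  filter_upwards [coeFn_chargeConj (f + g), coeFn_chargeConj f, coeFn_chargeConj g,
    Lp.coeFn_add f g, Lp.coeFn_add (chargeConj f) (chargeConj g)] with x h1 h2 h3 h4 h5
  rw [h1, h5, h4, Pi.add_apply, Pi.add_apply, h2, h3, spinorConj_add]

lemma compLp_pauli₃_chargeConj (f : SpinorL2) :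
    (act pauli₃).compLp (chargeConj f) = -chargeConj ((act pauli₃).compLp f) := by
  refine Lp.ext ?_
  filter_upwards [(act pauli₃).coeFn_compLp (chargeConj f), coeFn_chargeConj f,
    coeFn_chargeConj ((act pauli₃).compLp f), (act pauli₃).coeFn_compLp f,
    Lp.coeFn_neg (chargeConj ((act pauli₃).compLp f))] with x h1 h2 h3 h4 h5
  rw [h1, h2, h5, Pi.neg_apply, h3, h4, act_pauli₃_spinorConj]

/-- Charge conjugation anticommutes with the differential expression `-i σ · ∇ + m σ₃`. -/
lemma dirac_chargeConj (m : ℝ) (f h : SpinorL2) :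
    -Complex.I • chargeConj h + (m : ℂ) • (act pauli₃).compLp (chargeConj f) =
      -chargeConj (-Complex.I • h + (m : ℂ) • (act pauli₃).compLp f) := by
  rw [compLp_pauli₃_chargeConj, chargeConj_add, chargeConj_smul, chargeConj_smul]
  simp only [RCLike.star_def, map_neg, Complex.conj_I, Complex.conj_ofReal, neg_neg, smul_neg,
    neg_smul, neg_add]

lemma IsWeakSigmaGrad.chargeConj {U : Set Plane} {f h : SpinorL2} (H : IsWeakSigmaGrad U f h) :
    IsWeakSigmaGrad U (chargeConj f) (DiracShell.chargeConj h) := by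
  refine IsWeakSigmaGrad.congr (f := fun x => spinorConj (f x)) (h := fun x => spinorConj (h x))
    ?_ ((coeFn_chargeConj f).mono fun x hx => hx.symm)
    ((coeFn_chargeConj h).mono fun x hx => hx.symm)
  intro φ h1 h2 h3
  have key := H _ (contDiff_spinorConj h1) (hasCompactSupport_spinorConj h2)
    ((tsupport_comp_subset (g := spinorConj) (map_zero spinorConjₗᵢ) φ).trans h3)
  simp only [sigmaGrad_spinorConj h1] at key
  simp only [inner_spinorConj, RCLike.star_def]
  rw [integral_conj, integral_conj, key, map_neg]

/-- Complex conjugation of smooth functions on `Σ`. -/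
def conjPeriodic {ℓ : ℝ} (ψ : SmoothPeriodic ℓ) : SmoothPeriodic ℓ :=
  ⟨fun s => star ((ψ : ℝ → ℂ) s), contDiff_star_comp ψ.2.1, fun s => by
    simp only [ψ.2.2 s]⟩

lemma halfNorm_conjPeriodic {ℓ : ℝ} (hℓ : 0 < ℓ) (ψ : SmoothPeriodic ℓ) :
    halfNorm (conjPeriodic ψ) = halfNorm ψ := by
  have h : ∀ n, fourierCoefficient ℓ (conjPeriodic ψ) n = star (fourierCoefficient ℓ ψ (-n)) :=
    fun n => fourierCoefficient_star hℓ ψ n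
  unfold halfNorm
  congr 1
  rw [← (Equiv.neg ℤ).tsum_eq]
  refine tsum_congr fun n => ?_
  rw [h]
  simp only [Equiv.neg_apply, neg_neg, Int.cast_neg, abs_neg]
  rw [← ofReal_norm, norm_star, ofReal_norm]

lemma negHalfNorm_conj_le {ℓ : ℝ} (hℓ : 0 < ℓ) (F : SmoothPeriodic ℓ → ℂ) :
    negHalfNorm (fun ψ => star (F (conjPeriodic ψ))) ≤ negHalfNorm F := by
  refine iSup₂_le fun ψ hψ => ?_
  rw [← ofReal_norm, norm_star, ofReal_norm]
  exact le_iSup₂ (f := fun ψ (_ : halfNorm ψ ≤ 1) => ‖F ψ‖ₑ) (conjPeriodic ψ)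
    (by rwa [halfNorm_conjPeriodic hℓ])

/-- Charge conjugation of `ℂ²`-valued functionals on `Σ`. -/
def conjFunctional {ℓ : ℝ} (φ : Fin 2 → BoundaryFunctional ℓ) (j : Fin 2) :
    BoundaryFunctional ℓ where
  toFun ψ := star (φ j.rev (conjPeriodic ψ))
  map_add' ψ ψ' := by
    have : conjPeriodic (ψ + ψ') = conjPeriodic ψ + conjPeriodic ψ' :=
      Subtype.ext (funext fun _ => star_add _ _)
    rw [this, map_add, star_add]
  map_smul' c ψ := by
    have : conjPeriodic (c • ψ) = star c • conjPeriodic ψ :=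
      Subtype.ext (funext fun _ => star_mul' _ _)
    rw [this, map_smul, smul_eq_mul, star_mul', star_star, RingHom.id_apply, smul_eq_mul]

lemma conjFunctional_apply {ℓ : ℝ} (φ : Fin 2 → BoundaryFunctional ℓ) (j : Fin 2)
    (ψ : SmoothPeriodic ℓ) : conjFunctional φ j ψ = star (φ j.rev (conjPeriodic ψ)) := rfl

lemma spinorConj_apply (v : Spinor) (j : Fin 2) : spinorConj v j = star (v j.rev) := by
  fin_cases j <;> rfl

lemma Shell.boundaryPairing_spinorConj (S : Shell) (u : Plane → Spinor) (j : Fin 2)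
    (ψ : SmoothPeriodic S.ℓ) :
    S.boundaryPairing (fun x => spinorConj (u x)) j ψ =
      star (S.boundaryPairing u j.rev (conjPeriodic ψ)) := by
  unfold Shell.boundaryPairing
  rw [intervalIntegral.integral_of_le S.ℓ_pos.le, intervalIntegral.integral_of_le S.ℓ_pos.le,
    RCLike.star_def, ← integral_conj]
  congr 1
  funext s
  rw [spinorConj_apply, map_mul]
  congr 1
  exact (star_star _).symm

lemma Shell.IsTrace.chargeConj {S : Shell} {U : Set Plane} {f h : SpinorL2}
    {φ : Fin 2 → BoundaryFunctional S.ℓ} (H : S.IsTrace U f h φ) :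
    S.IsTrace U (chargeConj f) (DiracShell.chargeConj h) (conjFunctional φ) := by
  refine Shell.IsTrace.congr (f := fun x => spinorConj (f x)) (h := fun x => spinorConj (h x))
    ?_ ((coeFn_chargeConj f).mono fun x hx => hx.symm)
    ((coeFn_chargeConj h).mono fun x hx => hx.symm)
  obtain ⟨H0, u, H1, H2, H3, H4⟩ := H
  have hn : ∀ a b : Plane → Spinor,
      eLpNorm ((fun x => spinorConj (a x)) - fun x => spinorConj (b x)) 2 (volume.restrict U) =
        eLpNorm (a - b) 2 (volume.restrict U) := by
    intro a b
    refine eLpNorm_congr_norm_ae (.of_forall fun x => ?_)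
    rw [Pi.sub_apply, Pi.sub_apply, ← spinorConj_sub, norm_spinorConj]
  refine ⟨fun j => (negHalfNorm_conj_le S.ℓ_pos _).trans_lt (H0 j.rev),
    fun k x => spinorConj (u k x),
    fun k => ⟨contDiff_spinorConj (H1 k).1, hasCompactSupport_spinorConj (H1 k).2⟩, ?_, ?_,
    fun j => ?_⟩
  · simpa only [hn] using H2
  · have e : ∀ k, sigmaGrad (fun x => spinorConj (u k x)) =
        fun x => spinorConj (sigmaGrad (u k) x) := fun k =>
      funext fun x => sigmaGrad_spinorConj (H1 k).1 x
    simpa only [e, hn] using H3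
  · refine tendsto_of_tendsto_of_tendsto_of_le_of_le tendsto_const_nhds (H4 j.rev)
      (fun _ => zero_le) fun k => ?_
    refine le_trans (le_of_eq ?_) (negHalfNorm_conj_le S.ℓ_pos _)
    congr 1
    funext ψ
    rw [S.boundaryPairing_spinorConj, conjFunctional_apply, star_sub]

lemma Shell.Transmission.conj {S : Shell} {η τ lam : ℝ} {φp φm : Fin 2 → BoundaryFunctional S.ℓ}
    (H : S.Transmission η τ lam φp φm) :
    S.Transmission (-η) τ (-lam) (conjFunctional φp) (conjFunctional φm) := by
  rw [S.transmission_iff] at H ⊢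
  intro ψ
  -- test the original condition against `(t₁ + i t₂) ψ̄`
  obtain ⟨h1, h2⟩ := H (S.tauFun * conjPeriodic ψ)
  rw [← mul_assoc, mul_comm S.tauBar, S.tauFun_mul_tauBar, one_mul] at h1 h2
  have e : conjPeriodic (S.tauBar * ψ) = S.tauFun * conjPeriodic ψ :=
    Subtype.ext (funext fun s => (star_mul' _ _).trans (congrArg (· * _) (star_star _)))
  have g1 := congrArg star h1
  have g2 := congrArg star h2
  simp only [LinearMap.sub_apply, LinearMap.add_apply, conjFunctional_apply, e,
    show (0 : Fin 2).rev = 1 from rfl, show (1 : Fin 2).rev = 0 from rfl] at g1 g2 ⊢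
  simp only [star_sub, star_add, star_mul', star_neg] at g1 g2
  simp only [RCLike.star_def, Complex.conj_ofReal, map_div₀, map_one, Complex.conj_ofNat]
    at g1 g2 ⊢
  push_cast
  constructor
  · rw [g2]
    ring
  · rw [g1]
    ring

lemma Shell.IsDomainPair.chargeConj {S : Shell} {η τ lam : ℝ} {f h : SpinorL2}
    (H : S.IsDomainPair η τ lam f h) :
    S.IsDomainPair (-η) τ (-lam) (chargeConj f) (DiracShell.chargeConj h) := by
  obtain ⟨w1, w2, φp, φm, t1, t2, tr⟩ := H
  exact ⟨w1.chargeConj, w2.chargeConj, _, _, t1.chargeConj, t2.chargeConj, tr.conj⟩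

lemma Shell.chargeConj_mem_domain {S : Shell} {m η τ lam : ℝ} {f : SpinorL2}
    (hf : f ∈ (S.dirac m η τ lam).domain) : chargeConj f ∈ (S.dirac m (-η) τ (-lam)).domain := by
  obtain ⟨h, H⟩ := S.mem_diracDomain_iff.1 hf
  exact S.mem_diracDomain_iff.2 ⟨_, H.chargeConj⟩

/-- As the eigenvalues are real, charge conjugation maps them to their negatives. -/
lemma Shell.neg_mem_pointSpectrum {S : Shell} {m η τ lam : ℝ} {z : ℂ}
    (hz : z ∈ pointSpectrum (S.dirac m η τ lam)) :
    -z ∈ pointSpectrum (S.dirac m (-η) τ (-lam)) := by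
  obtain ⟨f, h, hf, H, e⟩ := S.mem_pointSpectrum_iff.1 hz
  refine S.mem_pointSpectrum_iff.2 ⟨_, _, fun h0 => hf ?_, H.chargeConj, ?_⟩
  · rw [← chargeConj_chargeConj f, h0, chargeConj_zero]
  · rw [dirac_chargeConj, e, chargeConj_smul, Shell.conj_eq_of_eigen hf H e, neg_smul]

end DiracShell

theorem mainTheorem7 (S : DiracShell.Shell) (m η τ lam : ℝ) :
    (η ^ 2 - τ ^ 2 - lam ^ 2 ≠ 0 → ∀ z : ℂ,
      z ∈ DiracShell.pointSpectrum (S.dirac m η τ lam) ↔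
        z ∈ DiracShell.pointSpectrum (S.dirac m
          (-4 * η / (η ^ 2 - τ ^ 2 - lam ^ 2))
          (-4 * τ / (η ^ 2 - τ ^ 2 - lam ^ 2))
          (-4 * lam / (η ^ 2 - τ ^ 2 - lam ^ 2)))) ∧
    (∀ z : ℂ, z ∈ DiracShell.pointSpectrum (S.dirac m η τ lam) ↔
      -z ∈ DiracShell.pointSpectrum (S.dirac m (-η) τ (-lam))) ∧
    (∀ f : DiracShell.SpinorL2, DiracShell.chargeConj (DiracShell.chargeConj f) = f) ∧
    (∀ f : DiracShell.SpinorL2, f ∈ (S.dirac m η τ lam).domain ↔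
      DiracShell.chargeConj f ∈ (S.dirac m (-η) τ (-lam)).domain) ∧
    (∀ (f : (S.dirac m η τ lam).domain) (g : (S.dirac m (-η) τ (-lam)).domain),
      (g : DiracShell.SpinorL2) = DiracShell.chargeConj f →
        S.dirac m (-η) τ (-lam) g = -DiracShell.chargeConj (S.dirac m η τ lam f)) := by
  refine ⟨fun hd z => DiracShell.Shell.pointSpectrum_flip_iff hd, fun z => ?_,
    DiracShell.chargeConj_chargeConj, fun f => ?_, ?_⟩
  · refine ⟨DiracShell.Shell.neg_mem_pointSpectrum, fun hz => ?_⟩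
    simpa only [neg_neg] using DiracShell.Shell.neg_mem_pointSpectrum hz
  · refine ⟨DiracShell.Shell.chargeConj_mem_domain, fun hf => ?_⟩
    simpa only [neg_neg, DiracShell.chargeConj_chargeConj] using
      DiracShell.Shell.chargeConj_mem_domain hf
  · rintro ⟨f, hf⟩ ⟨g, hg⟩ rfl
    obtain ⟨h, H⟩ := S.mem_diracDomain_iff.1 hf
    rw [H.dirac_apply m hf, H.chargeConj.dirac_apply m hg, DiracShell.dirac_chargeConj]
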